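/- Let $M$ be a smooth real manifold (finite-dimensional, Hausdorff, second countable, without boundary), let $E \to M$ be a smooth complex vector bundle of finite rank, and write $C^\infty(M)$ for the complex-valued smooth functions. Let $\star$ be a Hermitian star product on $M$, that is, an associative product $f \star g = \sum_{r\ge 0} \lambda^r C_r(f,g)$ on $C^\infty(M)[[\lambda]]$, $\mathbb{C}[[\lambda]]$-bilinear, with bidifferential operators $C_r$, $C_0(f,g) = fg$, $1 \star f = f = f \star 1$ and $\overline{f \star g} = \overline{g} \star \overline{f}$ (where $\overline{\lambda} = \lambda$). Let $h$ be a Hermitian (positive definite) fiber metric on $E$, antilinear in the first argument. Let $\bullet$ be a deformation quantization of $E$, that is, a right module structure $\phi \bullet f = \sum_{r \ge 0} \lambda^r R_r(\phi,f)$ on $\Gamma^\infty(E)[[\lambda]]$ over $(C^\infty(M)[[\lambda]],\star)$ with bidifferential operators $R_r$ and $R_0(\phi,f) = \phi f$. Order $\mathbb{R}[[\lambda]]$ by declaring a nonzero series positive if its lowest nonzero coefficient is positive. For a $^*$-algebra $\mathcal{B}$ over $\mathbb{C}[[\lambda]]$, a $\mathbb{C}[[\lambda]]$-linear functional $\omega\colon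 \mathcal{B} \to \mathbb{C}[[\lambda]]$ is positive if $\omega(b^*b) \ge 0$ for all $b$, and $b \in \mathcal{B}$ is positive if $\omega(b) \ge 0$ for all positive $\omega$. A deformation quantization of $h$ (with respect to $\bullet$) is a map $$\boldsymbol{h}(\phi,\psi) = \sum_{r \ge 0} \lambda^r \boldsymbol{h}_r(\phi,\psi), \qquad \boldsymbol{h}\colon \Gamma^\infty(E)[[\lambda]] \times \Gamma^\infty(E)[[\lambda]] \to C^\infty(M)[[\lambda]],$$ with sesquilinear bidifferential operators $\boldsymbol{h}_r$ and $\boldsymbol{h}_0 = h$, which is a completely positive inner product: it is $\mathbb{C}[[\lambda]]$-linear in the second argument, $\boldsymbol{h}(\phi,\psi) = \overline{\boldsymbol{h}(\psi,\phi)}$, $\boldsymbol{h}(\phi,\psi \bullet f) = \boldsymbol{h}(\phi,\psi) \star f$, $\boldsymbol{h}(\phi,\cdot) = 0$ implies $\phi = 0$, and for all $n$ and all $\phi_1,\dots,\phi_n \in \Gamma^\infty(E)[[\lambda]]$ the matrix $(\boldsymbol{h}(\phi_i,\phi_j))_{i,j}$ is a positive element of the $^*$-algebra $M_n(C^\infty(M)[[\lambda]],\star)$.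 Theorem. There exists a deformation quantization $\boldsymbol{h}$ of $h$ with respect to $\bullet$. It is unique up to isometry: for any two deformation quantizations $\boldsymbol{h}$, $\tilde{\boldsymbol{h}}$ of $h$ with respect to $\bullet$ there is a formal series $U = \mathrm{id} + \sum_{r\ge 1} \lambda^r U_r$ of differential operators $U_r$ on $\Gamma^\infty(E)$ such that $U(\phi \bullet f) = U(\phi) \bullet f$ and $\boldsymbol{h}(\phi,\psi) = \tilde{\boldsymbol{h}}(U(\phi),U(\psi))$ for all $\phi, \psi \in \Gamma^\infty(E)[[\lambda]]$ and $f \in C^\infty(M)[[\lambda]]$. -/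

import Mathlib

open scoped Manifold ContDiff PowerSeries ComplexConjugate
open Bundle
open Finset.HasAntidiagonal (antidiagonal)

noncomputable section

namespace DefQuant

/-! ### Algebraic differential operators -/

section DiffOps

variable {A : Type*} [CommRing A]
variable {P Q N : Type*} [AddCommGroup P] [Module A P] [AddCommGroup Q] [Module A Q]
  [AddCommGroup N] [Module A N]

/-- `IsDiffOp σ k D`: the (additive) map `D` between `A`-modules is a differential operator of
order at most `k` in the sense of Grothendieck, i.e. its `(k+1)`-fold commutators with
multiplications by elements of `A` vanish. In the target, `a` acts through `σ a`; `σ = id` gives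
the usual linear operators, and `σ = star` gives the antilinear ones. On smooth sections of vector
bundles these are the usual differential operators of order at most `k`. -/
def IsDiffOp (σ : A → A) : ℕ → (P → Q) → Prop
  | 0, D => ∀ a p, D (a • p) = σ a • D p
  | k + 1, D => ∀ a, IsDiffOp σ k (fun p => D (a • p) - σ a • D p)

/-- `B` is a bidifferential operator: a differential operator in each argument, of an order bounded
uniformly in the other argument. The first argument is treated via `σ` (`id`: bilinear case,
`star`: sesquilinear case), the second argument is linear. -/
def IsBidiffOp (σ : A → A) (B : P → Q → N) : Prop :=
  (∃ k, ∀ q, IsDiffOp σ k (fun p => B p q)) ∧ (∃ l, ∀ p, IsDiffOp (id : A → A) l (fun q => B p q))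

end DiffOps

/-! ### Formal power series with coefficients in a vector space -/

/-- `P[[λ]]`: formal power series in `λ` with coefficients in `P`. -/
def FormalSeries (P : Type*) : Type _ := ℕ → P

namespace FormalSeries

variable {P Q N : Type*}

/-- The series `∑_n λ^n p_n`. -/
def mk (p : ℕ → P) : FormalSeries P := p

/-- The coefficient of `λ^n`. -/
def coeff (n : ℕ) (p : FormalSeries P) : P := p n

@[simp] theorem coeff_mk (n : ℕ) (p : ℕ → P) : coeff n (mk p) = p n := rfl

@[ext] theorem ext {p q : FormalSeries P} (h : ∀ n, coeff n p = coeff n q) : p = q := funext h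

section Mod

variable [AddCommGroup P]

instance : AddCommGroup (FormalSeries P) := inferInstanceAs (AddCommGroup (ℕ → P))

@[simp] theorem coeff_add (p q : FormalSeries P) (n : ℕ) :
    coeff n (p + q) = coeff n p + coeff n q := rfl

@[simp] theorem coeff_zero (n : ℕ) : coeff n (0 : FormalSeries P) = 0 := rfl

/-- The constant series `p + 0 λ + 0 λ² + ⋯`. -/
def const (p : P) : FormalSeries P := mk fun n => if n = 0 then p else 0

/-- `ℂ[[λ]]` acts on `P[[λ]]` by the Cauchy product. -/
instance [Module ℂ P] : SMul ℂ⟦X⟧ (FormalSeries P) :=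
  ⟨fun c p => mk fun n => ∑ x ∈ antidiagonal n, PowerSeries.coeff x.1 c • coeff x.2 p⟩

theorem coeff_smul [Module ℂ P] (c : ℂ⟦X⟧) (p : FormalSeries P) (n : ℕ) :
    coeff n (c • p) = ∑ x ∈ antidiagonal n, PowerSeries.coeff x.1 c • coeff x.2 p := rfl

instance [Module ℂ P] : Module ℂ⟦X⟧ (FormalSeries P) where
  one_smul p := by
    ext n
    rw [coeff_smul, Finset.sum_eq_single (0, n)]
    · simp
    · rintro ⟨i, j⟩ hij hne
      rw [Finset.HasAntidiagonal.mem_antidiagonal] at hij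
      have hi : i ≠ 0 := by
        rintro rfl
        apply hne
        simp at hij
        simp [hij]
      simp [PowerSeries.coeff_one, hi]
    · simp
  mul_smul c d p := by
    ext n
    simp only [coeff_smul, PowerSeries.coeff_mul, Finset.sum_smul, Finset.smul_sum, mul_smul]
    rw [Finset.sum_sigma', Finset.sum_sigma']
    exact Finset.sum_bij' (fun x _ => ⟨(x.2.1, x.2.2 + x.1.2), (x.2.2, x.1.2)⟩)
      (fun x _ => ⟨(x.1.1 + x.2.1, x.2.2), (x.1.1, x.2.1)⟩)
      (by rintro ⟨⟨a, b⟩, ⟨c, d⟩⟩; simp; omega)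
      (by rintro ⟨⟨a, b⟩, ⟨c, d⟩⟩; simp; omega)
      (by rintro ⟨⟨a, b⟩, ⟨c, d⟩⟩; simp)
      (by rintro ⟨⟨a, b⟩, ⟨c, d⟩⟩; simp)
      (by rintro ⟨⟨a, b⟩, ⟨c, d⟩⟩; simp)
  smul_zero c := by ext n; simp [coeff_smul]
  smul_add c p q := by ext n; simp [coeff_smul, Finset.sum_add_distrib]
  add_smul c d p := by ext n; simp [coeff_smul, add_smul, Finset.sum_add_distrib]
  zero_smul p := by ext n; simp [coeff_smul]

end Mod

/-- The action `p ↦ ∑_r λ^r T_r(p)` of a formal series of maps `T = ∑_r λ^r T_r`: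
the `n`-th coefficient is `∑_{r+i=n} T_r(p_i)`. -/
def map₁ [AddCommGroup Q] (T : ℕ → P → Q) (p : FormalSeries P) : FormalSeries Q :=
  mk fun n => ∑ x ∈ antidiagonal n, T x.1 (coeff x.2 p)

/-- The `λ`-bilinear extension `(p, q) ↦ ∑_r λ^r B_r(p, q)`:
the `n`-th coefficient is `∑_{r+i+j=n} B_r(p_i, q_j)`. -/
def map₂ [AddCommGroup N] (B : ℕ → P → Q → N) (p : FormalSeries P) (q : FormalSeries Q) : FormalSeries N :=
  mk fun n => ∑ x ∈ antidiagonal n, ∑ y ∈ antidiagonal x.2, B x.1 (coeff y.1 p) (coeff y.2 q)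

theorem map₂_add_left [AddCommGroup P] [AddCommGroup N] {B : ℕ → P → Q → N} (hB : ∀ r p p' q, B r (p + p') q = B r p q + B r p' q)
    (p p' : FormalSeries P) (q : FormalSeries Q) :
    map₂ B (p + p') q = map₂ B p q + map₂ B p' q := by
  ext n; simp [map₂, hB, Finset.sum_add_distrib]

theorem map₂_add_right [AddCommGroup Q] [AddCommGroup N] {B : ℕ → P → Q → N} (hB : ∀ r p q q', B r p (q + q') = B r p q + B r p q')
    (p : FormalSeries P) (q q' : FormalSeries Q) :
    map₂ B p (q + q') = map₂ B p q + map₂ B p q' := by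
  ext n; simp [map₂, hB, Finset.sum_add_distrib]

theorem map₂_zero_left [AddCommGroup P] [AddCommGroup N] {B : ℕ → P → Q → N} (hB : ∀ r q, B r 0 q = 0) (q : FormalSeries Q) :
    map₂ B 0 q = 0 := by
  ext n; simp [map₂, hB]

theorem map₂_zero_right [AddCommGroup Q] [AddCommGroup N] {B : ℕ → P → Q → N} (hB : ∀ r p, B r p 0 = 0) (p : FormalSeries P) :
    map₂ B p 0 = 0 := by
  ext n; simp [map₂, hB]

end FormalSeries

/-! ### Positivity in `*`-algebras over `ℂ[[λ]] = ℝ[[λ]](i)` -/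

/-- The positive elements of the ordered ring `ℝ[[λ]]`: the lowest nonzero coefficient is
positive. -/
def IsPosSeries (a : ℝ⟦X⟧) : Prop :=
  ∃ r₀, (∀ r < r₀, PowerSeries.coeff r a = 0) ∧ 0 < PowerSeries.coeff r₀ a

/-- `c ≥ 0` for `c ∈ ℂ[[λ]]`: the series `c` is real, and zero or positive in `ℝ[[λ]]`. -/
def IsNonnegSeries (c : ℂ⟦X⟧) : Prop :=
  ∃ a : ℝ⟦X⟧, (a = 0 ∨ IsPosSeries a) ∧ PowerSeries.map Complex.ofRealHom a = c

section Positivity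

variable {B : Type*} [Ring B] [StarRing B] [Module ℂ⟦X⟧ B]

/-- A `ℂ[[λ]]`-linear functional `w` on a `*`-algebra is positive if `w(b* b) ≥ 0` for all `b`. -/
def IsPositiveFunctional (w : B →ₗ[ℂ⟦X⟧] ℂ⟦X⟧) : Prop := ∀ b : B, IsNonnegSeries (w (star b * b))

/-- An element of a `*`-algebra is positive if all positive functionals are nonnegative on it. -/
def IsPositiveElement (b : B) : Prop :=
  ∀ w : B →ₗ[ℂ⟦X⟧] ℂ⟦X⟧, IsPositiveFunctional w → IsNonnegSeries (w b)

/-- A completely positive (non-degenerate) inner product on a right module `P` over a `*`-algebra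
`B` over `ℂ[[λ]]`. Right modules over `B` are modules over `Bᵐᵒᵖ`. -/
structure IsCompletelyPositiveInnerProduct {P : Type*} [AddCommGroup P] [Module ℂ⟦X⟧ P]
    [Module Bᵐᵒᵖ P] (ip : P → P → B) : Prop where
  add_right : ∀ x y z, ip x (y + z) = ip x y + ip x z
  smul_right : ∀ (c : ℂ⟦X⟧) (x y : P), ip x (c • y) = c • ip x y
  star_symm : ∀ x y, ip x y = star (ip y x)
  act_right : ∀ (x y : P) (b : B), ip x (MulOpposite.op b • y) = ip x y * b
  nondegenerate : ∀ x, (∀ y, ip x y = 0) → x = 0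
  completely_positive : ∀ (n : ℕ) (x : Fin n → P),
    IsPositiveElement (Matrix.of fun i j => ip (x i) (x j) : Matrix (Fin n) (Fin n) B)

end Positivity

/-! ### Smooth functions and smooth sections -/

section Geometry

instance : ContMDiffRing 𝓘(ℝ, ℂ) ∞ ℂ :=
  { instNormedSpaceLieAddGroup (𝕜 := ℝ) (E := ℂ) (n := ∞) with
    contMDiff_mul := by
      rw [← modelWithCornersSelf_prod, chartedSpaceSelf_prod]
      exact contDiff_mul.contMDiff }

variable (V : Type*) [NormedAddCommGroup V] [NormedSpace ℝ V]
variable (M : Type*) [TopologicalSpace M] [ChartedSpace V M]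

/-- `C^∞(M)`: the commutative ring of smooth complex-valued functions on the real manifold `M`. -/
abbrev SmoothFun : Type _ := C^∞⟮𝓘(ℝ, V), M; 𝓘(ℝ, ℂ), ℂ⟯

variable {V M}

/-- The constant functions make `C^∞(M)` a `ℂ`-algebra. -/
instance : Algebra ℂ (SmoothFun V M) where
  smul c f := ⟨fun x => c * f x, contMDiff_const.mul f.contMDiff⟩
  algebraMap :=
    { toFun := fun c => ⟨fun _ => c, contMDiff_const⟩
      map_one' := rfl
      map_mul' := fun _ _ => rfl
      map_zero' := rfl
      map_add' := fun _ _ => rfl }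
  commutes' _ _ := mul_comm _ _
  smul_def' _ _ := rfl

/-- Pointwise complex conjugation. -/
instance : StarRing (SmoothFun V M) where
  star f := ⟨fun x => conj (f x), Complex.conjCLE.contDiff.contMDiff.comp f.contMDiff⟩
  star_involutive f := by ext x; exact Complex.conj_conj _
  star_mul f g := by
    ext x
    change conj (f x * g x) = conj (g x) * conj (f x)
    rw [map_mul, mul_comm]
  star_add f g := by ext x; exact map_add conj (f x) (g x)

variable (F : Type*) [NormedAddCommGroup F] [NormedSpace ℂ F]
variable (E : M → Type*) [TopologicalSpace (TotalSpace F E)] [∀ x, TopologicalSpace (E x)]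
  [FiberBundle F E] [∀ x, AddCommGroup (E x)] [∀ x, Module ℂ (E x)] [VectorBundle ℂ F E]

/-- A complex vector bundle is a real vector bundle. -/
instance realVectorBundle : VectorBundle ℝ F E where
  trivialization_linear' e _ :=
    ⟨fun b hb => ⟨(e.linear ℂ hb).map_add, fun c x => by
      have := (e.linear ℂ hb).map_smul (c : ℂ) x
      simpa using this⟩⟩
  continuousOn_coordChange' e e' _ _ := by
    have h := (ContinuousLinearMap.continuous_restrictScalars (𝕜 := ℂ) (E := F) (F := F)
      (𝕜' := ℝ)).comp_continuousOn (continuousOn_coordChange ℂ e e')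
    refine h.congr fun b hb => ?_
    ext y
    have : e.IsLinear ℝ := ⟨fun b hb => ⟨(e.linear ℂ hb).map_add, fun c x => by
      simpa using (e.linear ℂ hb).map_smul (c : ℂ) x⟩⟩
    have : e'.IsLinear ℝ := ⟨fun b hb => ⟨(e'.linear ℂ hb).map_add, fun c x => by
      simpa using (e'.linear ℂ hb).map_smul (c : ℂ) x⟩⟩
    exact (e.coordChangeL_apply (R := ℝ) e' hb y).trans
      (e.coordChangeL_apply (R := ℂ) e' hb y).symm

variable (V) in
/-- `Γ^∞(E)`: the smooth sections of `E`. -/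
abbrev Sections : Type _ := Cₛ^∞⟮𝓘(ℝ, V); F, E⟯

variable {F E}

theorem contMDiff_smul_section (f : SmoothFun V M) (φ : Sections V F E) :
    ContMDiff 𝓘(ℝ, V) (𝓘(ℝ, V).prod 𝓘(ℝ, F)) ∞
      (fun x => TotalSpace.mk' F x (f x • φ x)) := by
  intro x₀
  have hφ := φ.contMDiff x₀
  rw [contMDiffAt_section] at hφ ⊢
  set e := trivializationAt F E x₀
  have hf : ContMDiffAt 𝓘(ℝ, V) 𝓘(ℝ, F →L[ℝ] F) ∞
      (fun x => ContinuousLinearMap.lsmul ℝ ℂ (f x)) x₀ :=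
    (ContinuousLinearMap.lsmul ℝ ℂ (E := F)).contDiff.contMDiff.contMDiffAt.comp x₀
      (f.contMDiff x₀)
  refine (hf.clm_apply hφ).congr_of_eventuallyEq ?_
  filter_upwards [e.open_baseSet.mem_nhds (mem_baseSet_trivializationAt F E x₀)] with x hx
  exact (e.linear ℂ hx).map_smul _ _

/-- Pointwise multiplication makes `Γ^∞(E)` a module over `C^∞(M)`. -/
instance : Module (SmoothFun V M) (Sections V F E) where
  smul f φ := ⟨fun x => f x • φ x, contMDiff_smul_section f φ⟩
  one_smul φ := by ext x; exact one_smul ℂ _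
  mul_smul f g φ := by ext x; exact mul_smul (f x) (g x) (φ x)
  smul_zero f := by ext x; exact smul_zero (f x)
  smul_add f φ ψ := by ext x; exact smul_add (f x) (φ x) (ψ x)
  add_smul f g φ := by ext x; exact add_smul (f x) (g x) (φ x)
  zero_smul φ := by ext x; exact zero_smul ℂ (φ x)

instance : Module ℂ (Sections V F E) :=
  Module.compHom _ (algebraMap ℂ (SmoothFun V M))

variable (V F E) in
/-- A (positive definite) Hermitian fiber metric on `E`: a smooth family of positive definite
Hermitian forms on the fibers, antilinear in the first argument. -/
structure HermitianFiberMetric where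
  form : ∀ x, E x →ₗ⋆[ℂ] E x →ₗ[ℂ] ℂ
  conj_symm : ∀ x v w, conj (form x v w) = form x w v
  pos : ∀ x v, v ≠ 0 → 0 < (form x v v).re
  smooth : ∀ φ ψ : Sections V F E,
    ContMDiff 𝓘(ℝ, V) 𝓘(ℝ, ℂ) ∞ (fun x => form x (φ x) (ψ x))

/-- The map `Γ^∞(E) × Γ^∞(E) → C^∞(M)` induced by a fiber metric. -/
def HermitianFiberMetric.pairing (h : HermitianFiberMetric V F E) (φ ψ : Sections V F E) :
    SmoothFun V M :=
  ⟨fun x => h.form x (φ x) (ψ x), h.smooth φ ψ⟩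

/-! ### Star products -/

variable (V M) in
/-- A star product `f ⋆ g = ∑_r λ^r C_r(f, g)` on `C^∞(M)[[λ]]`. -/
structure StarProduct where
  C : ℕ → SmoothFun V M →ₗ[ℂ] SmoothFun V M →ₗ[ℂ] SmoothFun V M
  C_zero : ∀ f g, C 0 f g = f * g
  bidiff : ∀ r, IsBidiffOp (id : SmoothFun V M → SmoothFun V M) (fun f g => C r f g)
  assoc : ∀ f g k : FormalSeries (SmoothFun V M),
    FormalSeries.map₂ (C · · ·) (FormalSeries.map₂ (C · · ·) f g) k =
      FormalSeries.map₂ (C · · ·) f (FormalSeries.map₂ (C · · ·) g k)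
  one_star : ∀ f, FormalSeries.map₂ (C · · ·) (FormalSeries.const 1) f = f
  star_one : ∀ f, FormalSeries.map₂ (C · · ·) f (FormalSeries.const 1) = f

/-- The multiplication `⋆` on `C^∞(M)[[λ]]`. -/
def StarProduct.mul (S : StarProduct V M) (f g : FormalSeries (SmoothFun V M)) :
    FormalSeries (SmoothFun V M) :=
  FormalSeries.map₂ (S.C · · ·) f g

/-- Complex conjugation on `C^∞(M)[[λ]]`; the formal parameter `λ` is real. -/
def conjSeries (f : FormalSeries (SmoothFun V M)) : FormalSeries (SmoothFun V M) :=
  FormalSeries.mk fun n => star (FormalSeries.coeff n f)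

variable (V M) in
/-- A star product is Hermitian if complex conjugation is an involution for it. -/
structure HermitianStarProduct extends StarProduct V M where
  hermitian : ∀ f g, conjSeries (toStarProduct.mul f g) =
    toStarProduct.mul (conjSeries g) (conjSeries f)

/-- The algebra `(C^∞(M)[[λ]], ⋆)`. -/
def DeformedAlgebra (_S : HermitianStarProduct V M) : Type _ := FormalSeries (SmoothFun V M)

namespace DeformedAlgebra

variable (S : HermitianStarProduct V M)

instance : AddCommGroup (DeformedAlgebra S) :=
  inferInstanceAs (AddCommGroup (FormalSeries (SmoothFun V M)))

instance : Module ℂ⟦X⟧ (DeformedAlgebra S) :=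
  inferInstanceAs (Module ℂ⟦X⟧ (FormalSeries (SmoothFun V M)))

instance : Ring (DeformedAlgebra S) where
  __ := (inferInstance : AddCommGroup (DeformedAlgebra S))
  mul f g := S.mul f g
  one := FormalSeries.const (1 : SmoothFun V M)
  mul_assoc := S.assoc
  one_mul := S.one_star
  mul_one := S.star_one
  left_distrib f g k := FormalSeries.map₂_add_right (B := (S.C · · ·)) (by simp) f g k
  right_distrib f g k := FormalSeries.map₂_add_left (B := (S.C · · ·)) (by simp) f g k
  zero_mul f := FormalSeries.map₂_zero_left (B := (S.C · · ·)) (by simp) f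
  mul_zero f := FormalSeries.map₂_zero_right (B := (S.C · · ·)) (by simp) f

/-- The involution of `(C^∞(M)[[λ]], ⋆)` is complex conjugation. -/
instance : StarRing (DeformedAlgebra S) where
  star f := conjSeries f
  star_involutive _ := FormalSeries.ext fun _ => star_star _
  star_mul f g := S.hermitian f g
  star_add _ _ := FormalSeries.ext fun _ => star_add _ _

end DeformedAlgebra

/-! ### Deformation quantization of vector bundles and of fiber metrics -/

variable (F E) in
/-- A deformation quantization of `E`: a right module structure
`φ • f = ∑_r λ^r R_r(φ, f)` on `Γ^∞(E)[[λ]]` over `(C^∞(M)[[λ]], ⋆)`. -/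
structure BundleDeformation (S : HermitianStarProduct V M) where
  R : ℕ → Sections V F E →ₗ[ℂ] SmoothFun V M →ₗ[ℂ] Sections V F E
  R_zero : ∀ φ f, R 0 φ f = f • φ
  bidiff : ∀ r, IsBidiffOp (id : SmoothFun V M → SmoothFun V M) (fun φ f => R r φ f)
  act_mul : ∀ (φ : FormalSeries (Sections V F E)) (f g : FormalSeries (SmoothFun V M)),
    FormalSeries.map₂ (R · · ·) φ (S.mul f g) =
      FormalSeries.map₂ (R · · ·) (FormalSeries.map₂ (R · · ·) φ f) g
  act_one : ∀ φ, FormalSeries.map₂ (R · · ·) φ (FormalSeries.const 1) = φ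

/-- The right `(C^∞(M)[[λ]], ⋆)`-module `(Γ^∞(E)[[λ]], •)`. -/
def DeformedSections {S : HermitianStarProduct V M} (_D : BundleDeformation F E S) : Type _ :=
  FormalSeries (Sections V F E)

namespace DeformedSections

variable {S : HermitianStarProduct V M} (D : BundleDeformation F E S)

instance : AddCommGroup (DeformedSections D) :=
  inferInstanceAs (AddCommGroup (FormalSeries (Sections V F E)))

instance : Module ℂ⟦X⟧ (DeformedSections D) :=
  inferInstanceAs (Module ℂ⟦X⟧ (FormalSeries (Sections V F E)))

instance : Module (DeformedAlgebra S)ᵐᵒᵖ (DeformedSections D) where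
  smul f φ := FormalSeries.map₂ (D.R · · ·) φ f.unop
  one_smul φ := D.act_one φ
  mul_smul f g φ := D.act_mul φ g.unop f.unop
  smul_zero f := FormalSeries.map₂_zero_left (by simp) f.unop
  smul_add f φ ψ := FormalSeries.map₂_add_left (by simp) φ ψ f.unop
  add_smul f g φ := FormalSeries.map₂_add_right (by simp) φ f.unop g.unop
  zero_smul φ := FormalSeries.map₂_zero_right (by simp) φ

/-- The map `∑_r λ^r U_r` on `Γ^∞(E)[[λ]]`. -/
def map (U : ℕ → Sections V F E →ₗ[ℂ] Sections V F E) (φ : DeformedSections D) :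
    DeformedSections D :=
  FormalSeries.map₁ (U · ·) φ

/-- The map `∑_r λ^r h_r` on `Γ^∞(E)[[λ]] × Γ^∞(E)[[λ]]`. -/
def pair (h : ℕ → Sections V F E →ₗ⋆[ℂ] Sections V F E →ₗ[ℂ] SmoothFun V M)
    (φ ψ : DeformedSections D) : DeformedAlgebra S :=
  FormalSeries.map₂ (h · · ·) φ ψ

end DeformedSections

/-- A deformation quantization of the fiber metric `h₀` with respect to `•`: a completely positive
inner product `h = ∑_r λ^r h_r` on `(Γ^∞(E)[[λ]], •)` with sesquilinear bidifferential operators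
`h_r` and zeroth order `h₀`. -/
structure MetricDeformation {S : HermitianStarProduct V M} (D : BundleDeformation F E S)
    (h₀ : HermitianFiberMetric V F E) where
  h : ℕ → Sections V F E →ₗ⋆[ℂ] Sections V F E →ₗ[ℂ] SmoothFun V M
  h_zero : ∀ φ ψ, h 0 φ ψ = h₀.pairing φ ψ
  bidiff : ∀ r, IsBidiffOp (star : SmoothFun V M → SmoothFun V M) (fun φ ψ => h r φ ψ)
  inner : IsCompletelyPositiveInnerProduct (DeformedSections.pair D h)

/-- A self-equivalence of `•`: a formal series `U = id + ∑_{r ≥ 1} λ^r U_r` of differential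
operators that is right linear for `•`. -/
structure IsSelfEquivalence {S : HermitianStarProduct V M} (D : BundleDeformation F E S)
    (U : ℕ → Sections V F E →ₗ[ℂ] Sections V F E) : Prop where
  zero : U 0 = LinearMap.id
  diffOp : ∀ r, ∃ k, IsDiffOp (id : SmoothFun V M → SmoothFun V M) k (U r)
  act : ∀ (φ : DeformedSections D) (f : DeformedAlgebra S),
    DeformedSections.map D U (MulOpposite.op f • φ) =
      MulOpposite.op f • DeformedSections.map D U φ

/-- Two deformations of a fiber metric are isometric if a self-equivalence of `•` carries one into
the other. -/
def MetricDeformation.IsIsometric {S : HermitianStarProduct V M} {D : BundleDeformation F E S}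
    {h₀ : HermitianFiberMetric V F E} (H H' : MetricDeformation D h₀) : Prop :=
  ∃ U, IsSelfEquivalence D U ∧ ∀ φ ψ : DeformedSections D,
    DeformedSections.pair D H.h φ ψ =
      DeformedSections.pair D H'.h (DeformedSections.map D U φ) (DeformedSections.map D U ψ)

end Geometry

end DefQuant

end

/-! The main tool is a Parseval frame for the given metric: a locally finite family of sections σᵢ
with φ = ∑ h₀(σᵢ, φ) σᵢ for every φ (`exists_parseval_frame`), made from local orthonormal frames
and a partition of unity.

Existence. The frame writes h₀(φ, ψ) as the locally finite sum of conj(h₀(σᵢ, φ)) h₀(σᵢ, ψ), a sum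
of squares of module maps into the functions. Each h₀(σᵢ, ·) deforms to a map Tᵢ that is right
linear for • and ⋆: the obstruction at each order is a cocycle c (`obstruction_cocycle`), and b(φ) =
∑ c(σᵢ, h₀(σᵢ, φ)) has coboundary c (`exists_coboundary`, `exists_moduleMap`). Then h(φ, ψ) = ∑
Tᵢ(φ)^* ⋆ Tᵢ(ψ) is Hermitian and right linear and starts with h₀.

Complete positivity of this infinite sum needs an argument, because a functional need not commute
with it. A positive functional on smooth functions annihilates one of the squares of any locally
finite sequence (`exists_apply_mul_self_eq_zero`). Passing to lowest coefficients and using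
Cauchy–Schwarz, a positive functional on deformed matrices vanishes to any prescribed order in λ
after compression by a function supported far enough out (`exists_compress_eq_zero`). So to each
order only finitely many squares contribute, and the nonnegative series are λ-adically closed.

Uniqueness. For two deformations h and h', a Riesz argument with the frame gives, order by order,
differential operators W = id + O(λ) with h(φ, ψ) = h'(φ, Wψ). Hermitian symmetry makes W
self-adjoint for h'. Its square root U = id + O(λ) is then self-adjoint as well, so h(φ, ψ) = h'(φ,
U²ψ) = h'(Uφ, Uψ). Right linearity of U follows from self-adjointness and nondegeneracy.

Two devices keep this algebraic. Germs are expressed through the module structure, so that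
Grothendieck differential operators are local and commute with locally finite sums. Additive maps of
series that commute with λ are determined by constants, and the first nonvanishing coefficient of an
exact identity in the deformed structure is an identity in the classical one. -/

noncomputable section

namespace DefQuant

/-! ### Calculus of Grothendieck differential operators -/

section DiffOpCalculus

variable {A : Type*} [CommRing A]
variable {P Q N : Type*} [AddCommGroup P] [Module A P] [AddCommGroup Q] [Module A Q]
  [AddCommGroup N] [Module A N]

theorem IsDiffOp.zero (σ : A → A) (k : ℕ) : IsDiffOp σ k (fun _ : P => (0 : Q)) := by
  induction k with
  | zero => intro a p; simp
  | succ k ih => intro a; simpa using ih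

theorem IsDiffOp.succ {σ : A → A} {k : ℕ} {D : P → Q} (h : IsDiffOp σ k D) :
    IsDiffOp σ (k + 1) D := by
  induction k generalizing D with
  | zero =>
    intro a
    have : (fun p => D (a • p) - σ a • D p) = fun _ => (0 : Q) := by
      funext p; rw [h a p, sub_self]
    rw [this]; exact IsDiffOp.zero σ 0
  | succ k ih => intro a; exact ih (h a)

theorem IsDiffOp.mono {σ : A → A} {k l : ℕ} (hkl : k ≤ l) {D : P → Q} (h : IsDiffOp σ k D) :
    IsDiffOp σ l D := by
  induction hkl with
  | refl => exact h
  | step _ ih => exact ih.succ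

theorem IsDiffOp.add {σ : A → A} {k : ℕ} {D D' : P → Q} (h : IsDiffOp σ k D)
    (h' : IsDiffOp σ k D') : IsDiffOp σ k (fun p => D p + D' p) := by
  induction k generalizing D D' with
  | zero => intro a p; simp only [smul_add]; rw [h a p, h' a p]
  | succ k ih =>
    intro a
    convert ih (h a) (h' a) using 2
    rw [smul_add, add_sub_add_comm]

theorem IsDiffOp.neg {σ : A → A} {k : ℕ} {D : P → Q} (h : IsDiffOp σ k D) :
    IsDiffOp σ k (fun p => -D p) := by
  induction k generalizing D with
  | zero => intro a p; simp only [smul_neg]; rw [h a p]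
  | succ k ih =>
    intro a
    convert ih (h a) using 2
    rw [smul_neg]; abel

theorem IsDiffOp.sub {σ : A → A} {k : ℕ} {D D' : P → Q} (h : IsDiffOp σ k D)
    (h' : IsDiffOp σ k D') : IsDiffOp σ k (fun p => D p - D' p) := by
  simpa only [sub_eq_add_neg] using h.add h'.neg

theorem IsDiffOp.sum {σ : A → A} {k : ℕ} {ι : Type*} (s : Finset ι) {D : ι → P → Q}
    (h : ∀ i ∈ s, IsDiffOp σ k (D i)) : IsDiffOp σ k (fun p => ∑ i ∈ s, D i p) := by
  classical
  induction s using Finset.induction_on with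
  | empty => simpa using IsDiffOp.zero σ k
  | insert i s hi ih =>
    simp only [Finset.sum_insert hi]
    exact (h i (Finset.mem_insert_self i s)).add
      (ih fun j hj => h j (Finset.mem_insert_of_mem hj))

theorem IsDiffOp.smul {σ : A → A} {k : ℕ} {D : P → Q} (h : IsDiffOp σ k D) (b : A) :
    IsDiffOp σ k (fun p => b • D p) := by
  induction k generalizing D with
  | zero => intro a p; change b • D (a • p) = _; rw [h a p, smul_comm]
  | succ k ih =>
    intro a
    convert ih (h a) using 2
    rw [smul_sub, smul_comm b]

/-- Commutators satisfy [D'D, a] = D'[D, a] + [D', σ(a)]D, and both summands have total order one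
less, so induction on k + l applies. Additivity of D' lets it pass through the commutator of D. -/
theorem IsDiffOp.comp {σ τ : A → A} {k l : ℕ} {D : P → Q} {D' : Q → N} (hD' : IsDiffOp τ l D')
    (hadd : ∀ x y, D' (x - y) = D' x - D' y) (hD : IsDiffOp σ k D) :
    IsDiffOp (fun a => τ (σ a)) (k + l) (fun p => D' (D p)) := by
  have hadd' : ∀ x y, D' (x + y) = D' x + D' y := fun x y => by
    have h0 := hadd (x + y) y
    rw [add_sub_cancel_right] at h0
    rw [h0]; abel
  obtain ⟨n, hn⟩ : ∃ n, n = k + l := ⟨_, rfl⟩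
  rw [← hn]
  induction n generalizing k l D D' with
  | zero =>
    obtain rfl : k = 0 := by omega
    obtain rfl : l = 0 := by omega
    intro a p
    change D' (D (a • p)) = τ (σ a) • D' (D p)
    rw [hD a p, hD' (σ a)]
  | succ n ih =>
    intro a
    have key : (fun p => D' (D (a • p)) - τ (σ a) • D' (D p)) = fun p =>
        D' (D (a • p) - σ a • D p) + (D' (σ a • D p) - τ (σ a) • D' (D p)) := by
      funext p; rw [hadd]; abel
    rw [key]
    refine IsDiffOp.add ?_ ?_
    · cases k with
      | zero =>
        have : (fun p => D' (D (a • p) - σ a • D p)) = fun _ => (0 : N) := by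
          funext p; rw [hadd, hD a p, sub_self]
        rw [this]; exact IsDiffOp.zero _ _
      | succ k => exact ih hD' hadd (hD a) hadd' (by omega)
    · cases l with
      | zero =>
        have : (fun p => D' (σ a • D p) - τ (σ a) • D' (D p)) = fun _ => (0 : N) := by
          funext p; rw [hD', sub_self]
        rw [this]; exact IsDiffOp.zero _ _
      | succ l =>
        refine ih (D' := fun q => D' (σ a • q) - τ (σ a) • D' q) (hD' (σ a)) ?_ hD ?_ (by omega)
        · intro x y; rw [smul_sub, hadd, hadd, smul_sub]; abel
        · intro x y; rw [smul_add, hadd', hadd', smul_add]; abel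

theorem isDiffOp_star [StarRing A] : IsDiffOp (star : A → A) 0 (star : A → A) := by
  intro a p; simp

end DiffOpCalculus

/-! ### Maps of formal series that commute with λ -/

namespace FormalSeries

variable {P Q N : Type*} [AddCommGroup P] [AddCommGroup Q] [AddCommGroup N]

@[simp] theorem coeff_neg (p : FormalSeries P) (n : ℕ) : coeff n (-p) = -coeff n p := rfl
@[simp] theorem coeff_sub (p q : FormalSeries P) (n : ℕ) :
    coeff n (p - q) = coeff n p - coeff n q := rfl
theorem coeff_sum {ι : Type*} (s : Finset ι) (p : ι → FormalSeries P) (n : ℕ) :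
    coeff n (∑ i ∈ s, p i) = ∑ i ∈ s, coeff n (p i) :=
  map_sum (⟨⟨fun p => coeff n p, rfl⟩, fun _ _ => rfl⟩ : FormalSeries P →+ P) p s

theorem coeff_const (p : P) (n : ℕ) : coeff n (const p) = if n = 0 then p else 0 := rfl
@[simp] theorem coeff_const_zero (p : P) : coeff 0 (const p) = p := rfl
@[simp] theorem coeff_const_succ (p : P) (n : ℕ) : coeff (n + 1) (const p) = 0 := rfl

theorem const_add (p q : P) : const (p + q) = const p + const q := by
  ext n; cases n <;> simp

/-- Multiplication by the formal parameter. -/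
def shift (p : FormalSeries P) : FormalSeries P := mk fun n => Nat.casesOn n 0 fun m => coeff m p

/-- Division by the formal parameter, forgetting the constant term. -/
def tail (p : FormalSeries P) : FormalSeries P := mk fun n => coeff (n + 1) p

@[simp] theorem coeff_shift_zero (p : FormalSeries P) : coeff 0 (shift p) = 0 := rfl
@[simp] theorem coeff_shift_succ (p : FormalSeries P) (n : ℕ) :
    coeff (n + 1) (shift p) = coeff n p := rfl
@[simp] theorem coeff_tail (p : FormalSeries P) (n : ℕ) : coeff n (tail p) = coeff (n + 1) p := rfl

theorem const_add_shift_tail (p : FormalSeries P) : const (coeff 0 p) + shift (tail p) = p := by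
  ext n; cases n <;> simp

/-- Additive maps commuting with the formal parameter. -/
structure IsFormal (G : FormalSeries P → FormalSeries Q) : Prop where
  add : ∀ p q, G (p + q) = G p + G q
  shift : ∀ p, G (shift p) = FormalSeries.shift (G p)

namespace IsFormal

variable {G G' : FormalSeries P → FormalSeries Q}

theorem sub (hG : IsFormal G) (hG' : IsFormal G') : IsFormal (fun p => G p - G' p) where
  add p q := by simp only [hG.add, hG'.add]; abel
  shift p := by simp only [hG.shift, hG'.shift]; ext n; cases n <;> simp

theorem comp {G : FormalSeries Q → FormalSeries N} {G' : FormalSeries P → FormalSeries Q}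
    (hG : IsFormal G) (hG' : IsFormal G') : IsFormal (fun p => G (G' p)) where
  add p q := by simp only [hG'.add, hG.add]
  shift p := by simp only [hG'.shift, hG.shift]

theorem coeff_zero (hG : IsFormal G) (p : FormalSeries P) :
    coeff 0 (G p) = coeff 0 (G (const (coeff 0 p))) := by
  conv_lhs => rw [← const_add_shift_tail p, hG.add, hG.shift]
  simp

theorem coeff_succ (hG : IsFormal G) (p : FormalSeries P) (n : ℕ) :
    coeff (n + 1) (G p) = coeff (n + 1) (G (const (coeff 0 p))) + coeff n (G (tail p)) := by
  conv_lhs => rw [← const_add_shift_tail p, hG.add, hG.shift]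
  simp

/-- Since p = p₀ + λ · tail(p), the m-th coefficient of G(p) reduces to the constant p₀ and the
(m−1)-st coefficient of G on the tail. -/
theorem vanish (hG : IsFormal G) {n : ℕ} (h : ∀ p, ∀ m < n, coeff m (G (const p)) = 0)
    (p : FormalSeries P) {m : ℕ} (hm : m < n) : coeff m (G p) = 0 := by
  induction m generalizing p with
  | zero => rw [hG.coeff_zero, h _ _ hm]
  | succ m ih => rw [hG.coeff_succ, h _ _ hm, ih _ (by omega), add_zero]

theorem leading (hG : IsFormal G) {n : ℕ} (h : ∀ p, ∀ m < n, coeff m (G (const p)) = 0)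
    (p : FormalSeries P) : coeff n (G p) = coeff n (G (const (coeff 0 p))) := by
  cases n with
  | zero => exact hG.coeff_zero p
  | succ n => rw [hG.coeff_succ, hG.vanish h _ n.lt_succ_self, add_zero]

theorem ext_const (hG : IsFormal G) (hG' : IsFormal G') (h : ∀ p, G (const p) = G' (const p))
    (p : FormalSeries P) : G p = G' p := by
  rw [← sub_eq_zero]
  ext n
  refine (hG.sub hG').vanish (n := n + 1) (fun q m _ => ?_) p n.lt_succ_self
  simp [h q]

end IsFormal

theorem isFormal_map₁ {T : ℕ → P → Q} (hT : ∀ r p q, T r (p + q) = T r p + T r q) :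
    IsFormal (map₁ T) where
  add p q := by ext n; simp [map₁, hT, Finset.sum_add_distrib]
  shift p := by
    have h0 : ∀ r, T r 0 = 0 := fun r => by simpa using hT r 0 0
    ext n
    cases n with
    | zero => simp [map₁, h0]
    | succ n => simp [map₁, Finset.Nat.antidiagonal_succ', h0]

theorem coeff_map₁_const {T : ℕ → P → Q} (h0 : ∀ r, T r 0 = 0) (n : ℕ) (p : P) :
    coeff n (map₁ T (const p)) = T n p := by
  change ∑ x ∈ antidiagonal n, T x.1 (coeff x.2 (const p)) = _
  rw [Finset.sum_eq_single (n, 0)]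
  · simp
  · rintro ⟨i, j⟩ hij hne
    rw [Finset.HasAntidiagonal.mem_antidiagonal] at hij
    have hj : j ≠ 0 := by rintro rfl; apply hne; simp at hij; simp [hij]
    simp [coeff_const, hj, h0]
  · simp

theorem coeff_map₂ (B : ℕ → P → Q → N) (p : FormalSeries P) (q : FormalSeries Q) (n : ℕ) :
    coeff n (map₂ B p q) =
      ∑ x ∈ antidiagonal n, ∑ y ∈ antidiagonal x.2, B x.1 (coeff y.1 p) (coeff y.2 q) := rfl

theorem coeff_map₁ (T : ℕ → P → Q) (p : FormalSeries P) (n : ℕ) :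
    coeff n (map₁ T p) = ∑ x ∈ antidiagonal n, T x.1 (coeff x.2 p) := rfl

theorem isFormal_map₂_right {B : ℕ → P → Q → N} (hB : ∀ r p q q', B r p (q + q') = B r p q + B r p q')
    (p : FormalSeries P) : IsFormal (map₂ B p) where
  add q q' := map₂_add_right hB p q q'
  shift q := by
    have h0 : ∀ r p, B r p 0 = 0 := fun r p => by simpa using hB r p 0 0
    ext n
    cases n with
    | zero => simp [coeff_map₂, h0]
    | succ n =>
      rw [coeff_map₂, coeff_shift_succ, Finset.Nat.antidiagonal_succ', Finset.sum_cons,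
        Finset.sum_map, coeff_map₂]
      simp [Finset.Nat.antidiagonal_succ', h0]

theorem isFormal_map₂_left {B : ℕ → P → Q → N} (hB : ∀ r p p' q, B r (p + p') q = B r p q + B r p' q)
    (q : FormalSeries Q) : IsFormal (fun p => map₂ B p q) where
  add p p' := map₂_add_left hB p p' q
  shift p := by
    have h0 : ∀ r q, B r 0 q = 0 := fun r q => by simpa using hB r 0 0 q
    ext n
    cases n with
    | zero => simp [coeff_map₂, h0]
    | succ n =>
      rw [coeff_map₂, coeff_shift_succ, Finset.Nat.antidiagonal_succ', Finset.sum_cons,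
        Finset.sum_map, coeff_map₂]
      simp [Finset.Nat.antidiagonal_succ, h0]

theorem coeff_map₂_const_right {B : ℕ → P → Q → N} (h0 : ∀ r p, B r p 0 = 0) (n : ℕ)
    (p : FormalSeries P) (q : Q) :
    coeff n (map₂ B p (const q)) = ∑ x ∈ antidiagonal n, B x.1 (coeff x.2 p) q := by
  rw [coeff_map₂]
  refine Finset.sum_congr rfl fun x _ => ?_
  rw [Finset.sum_eq_single (x.2, 0)]
  · simp
  · rintro ⟨i, j⟩ hij hne
    rw [Finset.HasAntidiagonal.mem_antidiagonal] at hij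
    have hj : j ≠ 0 := by rintro rfl; apply hne; simp at hij; simp [hij]
    simp [coeff_const, hj, h0]
  · simp

theorem coeff_map₂_const_left {B : ℕ → P → Q → N} (h0 : ∀ r q, B r 0 q = 0) (n : ℕ)
    (p : P) (q : FormalSeries Q) :
    coeff n (map₂ B (const p) q) = ∑ x ∈ antidiagonal n, B x.1 p (coeff x.2 q) := by
  rw [coeff_map₂]
  refine Finset.sum_congr rfl fun x _ => ?_
  rw [Finset.sum_eq_single (0, x.2)]
  · simp
  · rintro ⟨i, j⟩ hij hne
    rw [Finset.HasAntidiagonal.mem_antidiagonal] at hij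
    have hj : i ≠ 0 := by rintro rfl; apply hne; simp at hij; simp [hij]
    simp [coeff_const, hj, h0]
  · simp

theorem coeff_map₂_const {B : ℕ → P → Q → N} (h0 : ∀ r q, B r 0 q = 0) (h0' : ∀ r p, B r p 0 = 0)
    (n : ℕ) (p : P) (q : Q) : coeff n (map₂ B (const p) (const q)) = B n p q := by
  rw [coeff_map₂_const_right h0', Finset.sum_eq_single (n, 0)]
  · simp
  · rintro ⟨i, j⟩ hij hne
    rw [Finset.HasAntidiagonal.mem_antidiagonal] at hij
    have hj : j ≠ 0 := by rintro rfl; apply hne; simp at hij; simp [hij]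
    simp [coeff_const, hj, h0]
  · simp

theorem coeff_zero_map₂ (B : ℕ → P → Q → N) (p : FormalSeries P) (q : FormalSeries Q) :
    coeff 0 (map₂ B p q) = B 0 (coeff 0 p) (coeff 0 q) := by simp [coeff_map₂]

theorem coeff_zero_map₁ (T : ℕ → P → Q) (p : FormalSeries P) :
    coeff 0 (map₁ T p) = T 0 (coeff 0 p) := by simp [coeff_map₁]

/-- Maps of two series that are additive and commute with the formal parameter in each argument. -/
structure IsFormal₂ (G : FormalSeries P → FormalSeries Q → FormalSeries N) : Prop where
  left : ∀ q, IsFormal (fun p => G p q)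
  right : ∀ p, IsFormal (G p)

namespace IsFormal₂

variable {G G' : FormalSeries P → FormalSeries Q → FormalSeries N}

theorem sub (hG : IsFormal₂ G) (hG' : IsFormal₂ G') : IsFormal₂ (fun p q => G p q - G' p q) where
  left q := (hG.left q).sub (hG'.left q)
  right p := (hG.right p).sub (hG'.right p)

/-- The device behind every obstruction argument: at the first order where G may be nonzero it
depends only on the classical parts of its arguments, even if these are series such as φ • f. -/
theorem leading (hG : IsFormal₂ G) {n : ℕ}
    (h : ∀ p q, ∀ m < n, coeff m (G (const p) (const q)) = 0)
    (p : FormalSeries P) (q : FormalSeries Q) :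
    coeff n (G p q) = coeff n (G (const (coeff 0 p)) (const (coeff 0 q))) := by
  rw [(hG.left q).leading (fun p _ hm' => (hG.right (const p)).vanish (h p) q hm'),
    (hG.right _).leading (h _)]

theorem ext_const (hG : IsFormal₂ G) (hG' : IsFormal₂ G')
    (h : ∀ p q, G (const p) (const q) = G' (const p) (const q))
    (p : FormalSeries P) (q : FormalSeries Q) : G p q = G' p q :=
  (hG.left q).ext_const (hG'.left q) (fun p => (hG.right _).ext_const (hG'.right _) (h p) q) p

end IsFormal₂

theorem isFormal₂_map₂ {B : ℕ → P → Q → N} (hl : ∀ r p p' q, B r (p + p') q = B r p q + B r p' q)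
    (hr : ∀ r p q q', B r p (q + q') = B r p q + B r p q') : IsFormal₂ (map₂ B) where
  left := isFormal_map₂_left hl
  right := isFormal_map₂_right hr

theorem C_smul_eq [Module ℂ P] (c : ℂ) (p : FormalSeries P) :
    PowerSeries.C c • p = mk fun n => c • coeff n p := by
  ext n
  rw [coeff_smul, Finset.sum_eq_single (0, n)]
  · simp
  · rintro ⟨i, j⟩ hij hne
    rw [Finset.HasAntidiagonal.mem_antidiagonal] at hij
    have hi : i ≠ 0 := by rintro rfl; apply hne; simp at hij; simp [hij]
    simp [PowerSeries.coeff_C, hi]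
  · simp

theorem X_smul_eq [Module ℂ P] (p : FormalSeries P) :
    (PowerSeries.X : ℂ⟦X⟧) • p = shift p := by
  ext n
  rw [coeff_smul]
  cases n with
  | zero => simp
  | succ n =>
    rw [Finset.Nat.antidiagonal_succ, Finset.sum_cons, Finset.sum_map,
      Finset.sum_eq_single (0, n)]
    · simp
    · rintro ⟨i, j⟩ hij hne
      rw [Finset.HasAntidiagonal.mem_antidiagonal] at hij
      have hi : i ≠ 0 := by rintro rfl; apply hne; simp at hij; simp [hij]
      simp [PowerSeries.coeff_X, hi]
    · simp

theorem isFormal_smul [Module ℂ P] (c : ℂ⟦X⟧) : IsFormal (fun p : FormalSeries P => c • p) :=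
  ⟨fun _ _ => smul_add _ _ _, fun p => by rw [← X_smul_eq, ← X_smul_eq, smul_comm]⟩

/-- A formal map that is `ℂ`-linear on constants is `ℂ[[λ]]`-linear. -/
theorem map_smul_of_isFormal [Module ℂ P] [Module ℂ Q] {G : FormalSeries P → FormalSeries Q}
    (hG : IsFormal G)
    (h : ∀ (c : ℂ) p n, coeff n (G (const (c • p))) = c • coeff n (G (const p)))
    (c : ℂ⟦X⟧) (p : FormalSeries P) : G (c • p) = c • G p := by
  have hC : ∀ (c : ℂ) (p : FormalSeries P), G (PowerSeries.C c • p) = PowerSeries.C c • G p := by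
    intro c
    refine IsFormal.ext_const (hG.comp (isFormal_smul _)) ((isFormal_smul _).comp hG) fun p => ?_
    ext n
    have : PowerSeries.C c • const p = const (c • p) := by
      rw [C_smul_eq]; ext n; cases n <;> simp
    rw [this, h, C_smul_eq, coeff_mk]
  ext n
  -- Splitting c = λc' + c₀ reduces each coefficient to the constant case and to the previous
  -- coefficient for c'.
  induction n generalizing c with
  | zero =>
    conv_lhs => rw [PowerSeries.eq_X_mul_shift_add_const c]
    conv_rhs => rw [PowerSeries.eq_X_mul_shift_add_const c]
    rw [add_smul, add_smul, mul_smul, mul_smul, X_smul_eq, X_smul_eq, hG.add, hG.shift, hC]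
    simp
  | succ n ih =>
    conv_lhs => rw [PowerSeries.eq_X_mul_shift_add_const c]
    conv_rhs => rw [PowerSeries.eq_X_mul_shift_add_const c]
    rw [add_smul, add_smul, mul_smul, mul_smul, X_smul_eq, X_smul_eq, hG.add, hG.shift, hC]
    simp only [coeff_add, coeff_shift_succ, ih]

end FormalSeries

/-- Recursive choice of a sequence whose `n`-th property only involves the first `n + 1` terms. -/
theorem exists_seq_of_step {α : Type*} [Inhabited α] (G : ℕ → (ℕ → α) → Prop)
    (hcongr : ∀ n T T', (∀ m ≤ n, T m = T' m) → G n T → G n T')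
    (hstep : ∀ n T, (∀ m < n, G m T) → ∃ t, G n (Function.update T n t)) :
    ∃ T, ∀ n, G n T := by
  choose! f hf using hstep
  -- The terms of `W n` below n are final and the others are placeholders equal to `default`; the
  -- desired sequence is the diagonal n ↦ `W (n + 1) n`.
  let W : ℕ → (ℕ → α) := fun n => Nat.rec (fun _ => default) (fun n T => Function.update T n (f n T)) n
  have hW : ∀ n, W (n + 1) = Function.update (W n) n (f n (W n)) := fun n => rfl
  have hstab : ∀ n m, m < n → ∀ k, W (n + k) m = W n m := by
    intro n m hm k
    induction k with
    | zero => rfl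
    | succ k ih => rw [← add_assoc, hW, Function.update_of_ne (by omega), ih]
  have hG : ∀ n, ∀ m < n, G m (W n) := by
    intro n
    induction n with
    | zero => intro m hm; omega
    | succ n ih =>
      intro m hm
      rcases Nat.lt_succ_iff_lt_or_eq.mp hm with h | rfl
      · refine hcongr m (W n) _ (fun l hl => ?_) (ih m h)
        rw [hW, Function.update_of_ne (by omega)]
      · rw [hW]; exact hf m (W m) ih
  refine ⟨fun n => W (n + 1) n, fun n => hcongr n (W (n + 1)) _ (fun m hm => ?_)
    (hG (n + 1) n n.lt_succ_self)⟩
  have := hstab (m + 1) m m.lt_succ_self (n - m)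
  rwa [show m + 1 + (n - m) = n + 1 by omega] at this

/-! ### Germs and locally finite sums in modules over the smooth functions -/

section Germs

variable (V : Type*) [NormedAddCommGroup V] [NormedSpace ℝ V]
variable {M : Type*} [TopologicalSpace M] [ChartedSpace V M]
variable {P Q N : Type*} [AddCommGroup P] [Module (SmoothFun V M) P] [AddCommGroup Q]
  [Module (SmoothFun V M) Q] [AddCommGroup N] [Module (SmoothFun V M) N]

/-- `p` has vanishing germ at `x`, expressed through the module structure: `p` maps to zero in the
localization of `P` at the maximal ideal of `x`. -/
def VanishesNear (x : M) (p : P) : Prop := ∃ a : SmoothFun V M, a x ≠ 0 ∧ a • p = 0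

variable {V}

namespace VanishesNear

variable {x : M} {p q : P}

theorem zero (x : M) : VanishesNear V x (0 : P) :=
  ⟨1, by simp, smul_zero _⟩

theorem add (hp : VanishesNear V x p) (hq : VanishesNear V x q) : VanishesNear V x (p + q) := by
  obtain ⟨a, ha, hp⟩ := hp
  obtain ⟨b, hb, hq⟩ := hq
  refine ⟨a * b, mul_ne_zero ha hb, ?_⟩
  rw [smul_add, mul_smul a b q, hq, mul_comm, mul_smul, hp]
  simp

theorem neg (hp : VanishesNear V x p) : VanishesNear V x (-p) := by
  obtain ⟨a, ha, hp⟩ := hp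
  exact ⟨a, ha, by rw [smul_neg, hp, neg_zero]⟩

theorem sub (hp : VanishesNear V x p) (hq : VanishesNear V x q) : VanishesNear V x (p - q) := by
  rw [sub_eq_add_neg]; exact hp.add hq.neg

theorem sum {ι : Type*} {s : Finset ι} {p : ι → P} (h : ∀ i ∈ s, VanishesNear V x (p i)) :
    VanishesNear V x (∑ i ∈ s, p i) :=
  Finset.sum_induction _ _ (fun _ _ => add) (zero x) h

theorem smul (hp : VanishesNear V x p) (b : SmoothFun V M) : VanishesNear V x (b • p) := by
  obtain ⟨a, ha, hp⟩ := hp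
  exact ⟨a, ha, by rw [smul_comm, hp, smul_zero]⟩

/-- Locality without coordinates. If a • p = 0, the commutator [D, a] sends p to −σ(a) • D p; by
induction some b with b(x) ≠ 0 kills this, so b σ(a) kills D p. -/
theorem diffOp {σ : SmoothFun V M → SmoothFun V M} (hσ : ∀ a, a x ≠ 0 → σ a x ≠ 0) {k : ℕ}
    {D : P → Q} (hD : IsDiffOp σ k D) (h0 : D 0 = 0) (hp : VanishesNear V x p) :
    VanishesNear V x (D p) := by
  induction k generalizing D with
  | zero =>
    obtain ⟨a, ha, hp⟩ := hp
    exact ⟨σ a, hσ a ha, by rw [← hD a p, hp, h0]⟩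
  | succ k ih =>
    obtain ⟨a, ha, hap⟩ := hp
    obtain ⟨b, hb, hbp⟩ := ih (hD a) (by simp [h0])
    refine ⟨b * σ a, mul_ne_zero hb (hσ a ha), ?_⟩
    rw [hap, h0, zero_sub, smul_neg, neg_eq_zero] at hbp
    rw [mul_smul, hbp]

end VanishesNear

variable (V M) in
/-- `q` is the locally finite sum of the family `p`. -/
def IsLocSum {ι : Type*} (p : ι → P) (q : P) : Prop :=
  ∀ x : M, ∃ s : Finset ι, VanishesNear V x (q - ∑ i ∈ s, p i) ∧ ∀ i ∉ s, VanishesNear V x (p i)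

variable (V M P) in
/-- Elements of `P` with vanishing germs are zero. -/
class IsSeparated : Prop where
  eq_zero : ∀ p : P, (∀ x : M, VanishesNear V x p) → p = 0

namespace IsLocSum

variable {ι : Type*} {p p' : ι → P} {q q' : P}

theorem sub_sum_of_subset {x : M} {s t : Finset ι} (hst : s ⊆ t)
    (hs : VanishesNear V x (q - ∑ i ∈ s, p i)) (h : ∀ i ∉ s, VanishesNear V x (p i)) :
    VanishesNear V x (q - ∑ i ∈ t, p i) := by
  classical
  have : q - ∑ i ∈ t, p i = (q - ∑ i ∈ s, p i) - ∑ i ∈ t \ s, p i := by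
    rw [← Finset.sum_sdiff hst]; abel
  rw [this]
  exact hs.sub (VanishesNear.sum fun i hi => h i (Finset.mem_sdiff.mp hi).2)

/-- The germ of a locally finite sum is computed by any finite set containing all indices with
nonvanishing germ. -/
theorem sub_sum {x : M} (h : IsLocSum V M p q) {t : Finset ι}
    (ht : ∀ i ∉ t, VanishesNear V x (p i)) : VanishesNear V x (q - ∑ i ∈ t, p i) := by
  classical
  obtain ⟨s, hs, hs'⟩ := h x
  have h1 := sub_sum_of_subset (Finset.subset_union_left (s₂ := t)) hs hs'
  have : q - ∑ i ∈ t, p i = (q - ∑ i ∈ s ∪ t, p i) + ∑ i ∈ (s ∪ t) \ t, p i := by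
    rw [← Finset.sum_sdiff (Finset.subset_union_right (s₁ := s) (s₂ := t))]; abel
  rw [this]
  exact h1.add (VanishesNear.sum fun i hi => ht i (Finset.mem_sdiff.mp hi).2)

theorem add (h : IsLocSum V M p q) (h' : IsLocSum V M p' q') :
    IsLocSum V M (fun i => p i + p' i) (q + q') := by
  classical
  intro x
  obtain ⟨s, hs, hs'⟩ := h x
  obtain ⟨t, ht, ht'⟩ := h' x
  refine ⟨s ∪ t, ?_, fun i hi => ?_⟩
  · rw [Finset.sum_add_distrib, add_sub_add_comm]
    exact (sub_sum_of_subset Finset.subset_union_left hs hs').add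
      (sub_sum_of_subset Finset.subset_union_right ht ht')
  · rw [Finset.mem_union, not_or] at hi
    exact (hs' i hi.1).add (ht' i hi.2)

/-- This replaces continuity: locality suffices to pass an additive map through an infinite, locally
finite sum. -/
theorem map {D : P → Q} (hsub : ∀ x y, D (x - y) = D x - D y)
    (hloc : ∀ (x : M) p, VanishesNear V x p → VanishesNear V x (D p)) (h : IsLocSum V M p q) :
    IsLocSum V M (fun i => D (p i)) (D q) := by
  intro x
  obtain ⟨s, hs, hs'⟩ := h x
  refine ⟨s, ?_, fun i hi => hloc x _ (hs' i hi)⟩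
  let D' : P →+ Q := AddMonoidHom.ofMapSub D hsub
  have : D q - ∑ i ∈ s, D (p i) = D (q - ∑ i ∈ s, p i) := by
    change D' q - ∑ i ∈ s, D' (p i) = D' (q - ∑ i ∈ s, p i)
    rw [map_sub, map_sum]
  rw [this]
  exact hloc x _ hs

theorem smul (h : IsLocSum V M p q) (a : SmoothFun V M) : IsLocSum V M (fun i => a • p i) (a • q) :=
  h.map (fun _ _ => smul_sub _ _ _) (fun _ _ hp => hp.smul a)

theorem neg (h : IsLocSum V M p q) : IsLocSum V M (fun i => -p i) (-q) :=
  h.map (D := fun p => -p) (fun _ _ => by abel) (fun _ _ hp => hp.neg)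

theorem sub (h : IsLocSum V M p q) (h' : IsLocSum V M p' q') :
    IsLocSum V M (fun i => p i - p' i) (q - q') := by
  simpa only [sub_eq_add_neg] using h.add h'.neg

theorem unique [IsSeparated V M P] (h : IsLocSum V M p q) (h' : IsLocSum V M p q') : q = q' := by
  rw [← sub_eq_zero]
  refine IsSeparated.eq_zero (V := V) (M := M) _ fun x => ?_
  obtain ⟨s, hs, hs'⟩ := (h.sub h') x
  simpa using hs

theorem vanishesNear {x : M} (h : IsLocSum V M p q) (hp : ∀ i, VanishesNear V x (p i)) :
    VanishesNear V x q := by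
  simpa using h.sub_sum (t := ∅) (fun i _ => hp i)

/-- Locally finite sums of differential operators of bounded order are differential operators. -/
theorem isDiffOp [IsSeparated V M Q] {σ : SmoothFun V M → SmoothFun V M} {k : ℕ}
    {D : ι → P → Q} {E : P → Q} (hD : ∀ i, IsDiffOp σ k (D i))
    (h : ∀ p, IsLocSum V M (fun i => D i p) (E p)) : IsDiffOp σ k E := by
  induction k generalizing D E with
  | zero =>
    intro a p
    refine (h (a • p)).unique ?_
    have := (h p).smul (σ a)
    convert this using 2 with i
    exact hD i a p
  | succ k ih =>
    exact fun a => ih (fun i => hD i a) fun p => (h (a • p)).sub ((h p).smul (σ a))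

end IsLocSum

theorem vanishesNear_of_isDiffOp_id {k : ℕ} {D : P → Q}
    (hD : IsDiffOp (id : SmoothFun V M → SmoothFun V M) k D) (h0 : D 0 = 0) (x : M) (p : P)
    (hp : VanishesNear V x p) : VanishesNear V x (D p) :=
  hp.diffOp (fun _ h => h) hD h0

theorem vanishesNear_of_isDiffOp_star {k : ℕ} {D : P → Q}
    (hD : IsDiffOp (star : SmoothFun V M → SmoothFun V M) k D) (h0 : D 0 = 0) (x : M) (p : P)
    (hp : VanishesNear V x p) : VanishesNear V x (D p) :=
  hp.diffOp (fun a h => (map_ne_zero (starRingEnd ℂ)).mpr h) hD h0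

end Germs

/-! ### Bump functions and gluing of locally finite families -/

section Manifold

variable {V : Type*} [NormedAddCommGroup V] [NormedSpace ℝ V]
variable {M : Type*} [TopologicalSpace M] [ChartedSpace V M]
variable {F : Type*} [NormedAddCommGroup F] [NormedSpace ℂ F]
variable {E : M → Type*} [TopologicalSpace (TotalSpace F E)] [∀ x, TopologicalSpace (E x)]
  [FiberBundle F E] [∀ x, AddCommGroup (E x)] [∀ x, Module ℂ (E x)] [VectorBundle ℂ F E]

/-- The smooth complex-valued function attached to a smooth real-valued one. -/
def ofRealFun (f : M → ℝ) (hf : ContMDiff 𝓘(ℝ, V) 𝓘(ℝ, ℝ) ∞ f) : SmoothFun V M :=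
  ⟨fun x => (f x : ℂ), Complex.ofRealCLM.contDiff.contMDiff.comp hf⟩

@[simp] theorem smul_section_apply (f : SmoothFun V M) (φ : Sections V F E) (x : M) :
    (f • φ) x = f x • φ x := rfl

@[simp] theorem star_smoothFun_apply (f : SmoothFun V M) (x : M) : (star f) x = conj (f x) := rfl

@[simp] theorem const_smul_smoothFun_apply (c : ℂ) (f : SmoothFun V M) (x : M) :
    (c • f) x = c * f x := rfl

@[simp] theorem const_smul_section_apply (c : ℂ) (φ : Sections V F E) (x : M) :
    (c • φ) x = c • φ x := rfl

theorem VanishesNear.eventually_smoothFun {f : SmoothFun V M} {x : M} (h : VanishesNear V x f) :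
    ∀ᶠ y in nhds x, f y = 0 := by
  obtain ⟨a, ha, haf⟩ := h
  filter_upwards [a.contMDiff.continuous.continuousAt.eventually_ne ha] with y hy
  have : a y * f y = 0 := congrArg (fun g : SmoothFun V M => g y) haf
  exact (mul_eq_zero.mp this).resolve_left hy

theorem VanishesNear.eventually_section {φ : Sections V F E} {x : M} (h : VanishesNear V x φ) :
    ∀ᶠ y in nhds x, φ y = 0 := by
  obtain ⟨a, ha, haf⟩ := h
  filter_upwards [a.contMDiff.continuous.continuousAt.eventually_ne ha] with y hy
  have : a y • φ y = 0 := congrArg (fun g : Sections V F E => g y) haf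
  exact (smul_eq_zero.mp this).resolve_left hy

instance : IsSeparated V M (SmoothFun V M) where
  eq_zero f h := by ext x; exact (h x).eventually_smoothFun.self_of_nhds

instance : IsSeparated V M (Sections V F E) where
  eq_zero f h := by ext x; exact (h x).eventually_section.self_of_nhds

variable [FiniteDimensional ℝ V] [IsManifold 𝓘(ℝ, V) ∞ M] [T2Space M]

/-- A smooth bump function at `x` supported in a given neighbourhood. -/
theorem exists_bump {x : M} {s : Set M} (hs : s ∈ nhds x) :
    ∃ a : SmoothFun V M, a x = 1 ∧ ∀ y ∉ s, a y = 0 := by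
  obtain ⟨b, -, hb⟩ := ((SmoothBumpFunction.nhds_basis_tsupport (I := 𝓘(ℝ, V)) x).mem_iff).mp hs
  refine ⟨ofRealFun b b.contMDiff, ?_, fun y hy => ?_⟩
  · change ((b x : ℝ) : ℂ) = 1
    rw [b.eq_one]; simp
  · change ((b y : ℝ) : ℂ) = 0
    rw [image_eq_zero_of_notMem_tsupport fun h => hy (hb h)]; simp

/-- For the converse direction, a bump function at x supported in the zero set of f serves as the
annihilator. -/
theorem vanishesNear_smoothFun_iff {f : SmoothFun V M} {x : M} :
    VanishesNear V x f ↔ ∀ᶠ y in nhds x, f y = 0 := by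
  refine ⟨fun h => h.eventually_smoothFun, fun h => ?_⟩
  obtain ⟨a, ha, ha'⟩ := exists_bump (V := V) h
  refine ⟨a, by simp [ha], ?_⟩
  ext y
  change a y * f y = 0
  by_cases hy : f y = 0
  · simp [hy]
  · simp [ha' y hy]

theorem vanishesNear_section_iff {φ : Sections V F E} {x : M} :
    VanishesNear V x φ ↔ ∀ᶠ y in nhds x, φ y = 0 := by
  refine ⟨fun h => h.eventually_section, fun h => ?_⟩
  obtain ⟨a, ha, ha'⟩ := exists_bump (V := V) h
  refine ⟨a, by simp [ha], ?_⟩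
  ext y
  change a y • φ y = 0
  by_cases hy : φ y = 0
  · simp [hy]
  · simp [ha' y hy]

theorem sum_smoothFun_apply {ι : Type*} (s : Finset ι) (p : ι → SmoothFun V M) (y : M) :
    (∑ i ∈ s, p i) y = ∑ i ∈ s, p i y :=
  map_sum (⟨⟨fun f => f y, rfl⟩, fun _ _ => rfl⟩ : SmoothFun V M →+ ℂ) p s

theorem sum_section_apply {ι : Type*} (s : Finset ι) (p : ι → Sections V F E) (y : M) :
    (∑ i ∈ s, p i) y = ∑ i ∈ s, p i y :=
  map_sum (⟨⟨fun f => f y, rfl⟩, fun _ _ => rfl⟩ : Sections V F E →+ E y) p s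

theorem exists_finset_of_locallyFinite {ι : Type*} {t : ι → Set M} (h : LocallyFinite t) (x : M) :
    ∃ s : Finset ι, ∀ᶠ y in nhds x, ∀ i ∉ s, y ∉ t i := by
  obtain ⟨u, hu, hfin⟩ := h x
  refine ⟨hfin.toFinset, ?_⟩
  filter_upwards [hu] with y hy i hi hyi
  exact hi (hfin.mem_toFinset.mpr ⟨y, hyi, hy⟩)

theorem exists_isLocSum_smoothFun {ι : Type*} (p : ι → SmoothFun V M)
    (h : LocallyFinite fun i => {x : M | ¬VanishesNear V x (p i)}) : ∃ q, IsLocSum V M p q := by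
  have hsupp : LocallyFinite fun i => Function.support (p i) := h.subset fun i x hx hv =>
    hx hv.eventually_smoothFun.self_of_nhds
  refine ⟨⟨fun x => ∑ᶠ i, p i x, contMDiff_finsum (fun i => (p i).contMDiff) hsupp⟩, fun x => ?_⟩
  obtain ⟨s, hs⟩ := exists_finset_of_locallyFinite h x
  refine ⟨s, ?_, fun i hi => not_not.mp (hs.self_of_nhds i hi)⟩
  rw [vanishesNear_smoothFun_iff]
  filter_upwards [hs] with y hy
  change (∑ᶠ i, p i y) - (∑ i ∈ s, p i) y = 0
  rw [sum_smoothFun_apply, finsum_eq_sum_of_support_subset, sub_self]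
  intro i hi
  by_contra hn
  exact hi (not_not.mp (hy i hn)).eventually_smoothFun.self_of_nhds

theorem exists_isLocSum_section {ι : Type*} (p : ι → Sections V F E)
    (h : LocallyFinite fun i => {x : M | ¬VanishesNear V x (p i)}) : ∃ q, IsLocSum V M p q := by
  have hsupp : LocallyFinite fun i => {x : M | p i x ≠ 0} := h.subset fun i x hx hv =>
    hx hv.eventually_section.self_of_nhds
  refine ⟨⟨fun x => ∑ᶠ i, p i x,
    ContMDiff.finsum_section_of_locallyFinite hsupp (fun i => (p i).contMDiff)⟩, fun x => ?_⟩
  obtain ⟨s, hs⟩ := exists_finset_of_locallyFinite h x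
  refine ⟨s, ?_, fun i hi => not_not.mp (hs.self_of_nhds i hi)⟩
  rw [vanishesNear_section_iff]
  filter_upwards [hs] with y hy
  change (∑ᶠ i, p i y) - (∑ i ∈ s, p i) y = 0
  rw [sum_section_apply, finsum_eq_sum_of_support_subset, sub_self]
  intro i hi
  by_contra hn
  exact hi (not_not.mp (hy i hn)).eventually_section.self_of_nhds

end Manifold

/-! ### Smooth square roots, local orthonormal frames and Parseval frames -/

section Frames

variable {V : Type*} [NormedAddCommGroup V] [NormedSpace ℝ V]
variable {M : Type*} [TopologicalSpace M] [ChartedSpace V M]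

/-- A pointwise positive function has a real smooth square root. -/
theorem exists_sqrt (f : SmoothFun V M) (hf : ∀ x, ∃ r : ℝ, 0 < r ∧ f x = r) :
    ∃ g : SmoothFun V M, star g = g ∧ g * g = f ∧ ∀ x, g x ≠ 0 := by
  have hre : ∀ x, 0 < (f x).re ∧ ((f x).re : ℂ) = f x := fun x => by
    obtain ⟨r, hr, h⟩ := hf x; simp [h, hr]
  have hsm : ContMDiff 𝓘(ℝ, V) 𝓘(ℝ, ℝ) ∞ (fun x => √(f x).re) := fun x =>
    (Real.contDiffAt_sqrt (hre x).1.ne').contMDiffAt.comp x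
      (Complex.reCLM.contDiff.contMDiff.comp f.contMDiff).contMDiffAt
  refine ⟨ofRealFun _ hsm, ?_, ?_, fun x => ?_⟩
  · ext x; exact Complex.conj_ofReal _
  · ext x
    change ((√(f x).re : ℝ) : ℂ) * ((√(f x).re : ℝ) : ℂ) = f x
    rw [← Complex.ofReal_mul, Real.mul_self_sqrt (hre x).1.le, (hre x).2]
  · change ((√(f x).re : ℝ) : ℂ) ≠ 0
    exact Complex.ofReal_ne_zero.mpr (Real.sqrt_pos.mpr (hre x).1).ne'

/-- A pointwise positive function has a real smooth inverse square root. -/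
theorem exists_inv_sqrt (f : SmoothFun V M) (hf : ∀ x, ∃ r : ℝ, 0 < r ∧ f x = r) :
    ∃ g : SmoothFun V M, star g = g ∧ g * g * f = 1 := by
  obtain ⟨g, hg, hgg, h0⟩ := exists_sqrt f hf
  have hsm : ContMDiff 𝓘(ℝ, V) 𝓘(ℝ, ℂ) ∞ (fun x => (g x)⁻¹) := fun x =>
    (contDiffAt_inv ℝ (h0 x)).contMDiffAt.comp x g.contMDiff.contMDiffAt
  refine ⟨⟨_, hsm⟩, ?_, ?_⟩
  · ext x
    change conj (g x)⁻¹ = (g x)⁻¹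
    rw [map_inv₀]
    congr 1
    exact congrArg (fun g : SmoothFun V M => g x) hg
  · ext x
    rw [← hgg]
    change (g x)⁻¹ * (g x)⁻¹ * (g x * g x) = 1
    field_simp [h0 x]

/-- A nonnegative function that is positive at a point has a global smooth real function which is
an inverse square root near that point. -/
theorem exists_local_inv_sqrt (f : SmoothFun V M) (hf : ∀ x, ∃ r : ℝ, 0 ≤ r ∧ f x = r) (x₀ : M)
    (h0 : f x₀ ≠ 0) :
    ∃ g : SmoothFun V M, star g = g ∧ ∀ᶠ x in nhds x₀, g x * g x * f x = 1 := by
  have hre : ∀ x, 0 ≤ (f x).re ∧ ((f x).re : ℂ) = f x := fun x => by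
    obtain ⟨r, hr, h⟩ := hf x; simp [h, hr]
  set c := (f x₀).re
  have hc : 0 < c := lt_of_le_of_ne (hre x₀).1 fun h => h0 (by
    rw [← (hre x₀).2]; exact_mod_cast h.symm)
  -- This term is positive where f < c/2 and zero where f ≥ c/2. Adding it to f gives a function
  -- that is positive everywhere and still equals f near x₀, where f is close to c.
  have hsm : ContMDiff 𝓘(ℝ, V) 𝓘(ℝ, ℝ) ∞ (fun x => Real.smoothTransition (1 - 2 * (f x).re / c)) := by
    have h1 : ContDiff ℝ ∞ (fun t : ℝ => Real.smoothTransition (1 - 2 * t / c)) :=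
      Real.smoothTransition.contDiff.comp (by fun_prop)
    exact h1.contMDiff.comp (Complex.reCLM.contDiff.contMDiff.comp f.contMDiff)
  obtain ⟨g, hg, hgf⟩ := exists_inv_sqrt (f + ofRealFun _ hsm) fun x => by
    refine ⟨(f x).re + Real.smoothTransition (1 - 2 * (f x).re / c), ?_, ?_⟩
    · rcases (hre x).1.eq_or_lt with h | h
      · rw [← h]; simp
      · have := Real.smoothTransition.nonneg (1 - 2 * (f x).re / c); linarith
    · rw [Complex.ofReal_add, (hre x).2]; rfl
  refine ⟨g, hg, ?_⟩
  have hcont : Continuous fun x => (f x).re := Complex.continuous_re.comp f.contMDiff.continuous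
  filter_upwards [hcont.continuousAt.eventually (lt_mem_nhds (show c / 2 < (f x₀).re by
    change c / 2 < c; linarith))] with x hx
  have h1 : g x * g x * (f x + (Real.smoothTransition (1 - 2 * (f x).re / c) : ℝ)) = 1 :=
    congrArg (fun g : SmoothFun V M => g x) hgf
  rwa [Real.smoothTransition.zero_of_nonpos, Complex.ofReal_zero, add_zero] at h1
  rw [sub_nonpos, le_div_iff₀ hc]; linarith

variable {F : Type*} [NormedAddCommGroup F] [NormedSpace ℂ F]
variable {E : M → Type*} [TopologicalSpace (TotalSpace F E)] [∀ x, TopologicalSpace (E x)]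
  [FiberBundle F E] [∀ x, AddCommGroup (E x)] [∀ x, Module ℂ (E x)] [VectorBundle ℂ F E]

@[simp] theorem HermitianFiberMetric.pairing_apply (h : HermitianFiberMetric V F E)
    (φ ψ : Sections V F E) (x : M) : h.pairing φ ψ x = h.form x (φ x) (ψ x) := rfl

theorem HermitianFiberMetric.form_self (h : HermitianFiberMetric V F E) (x : M) (v : E x) :
    ((h.form x v v).re : ℂ) = h.form x v v :=
  Complex.conj_eq_iff_real.mp (h.conj_symm x v v) |>.elim fun r hr => by rw [hr]; simp

theorem HermitianFiberMetric.form_self_nonneg (h : HermitianFiberMetric V F E) (x : M) (v : E x) :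
    0 ≤ (h.form x v v).re := by
  by_cases hv : v = 0
  · simp [hv]
  · exact (h.pos x v hv).le

theorem HermitianFiberMetric.form_self_ne_zero (h : HermitianFiberMetric V F E) {x : M} {v : E x}
    (hv : v ≠ 0) : h.form x v v ≠ 0 := fun h0 => by
  have := h.pos x v hv
  simp [h0] at this

theorem finrank_fiber [FiniteDimensional ℂ F] (x : M) :
    FiniteDimensional ℂ (E x) ∧ Module.finrank ℂ (E x) = Module.finrank ℂ F := by
  let e := trivializationAt F E x
  have hx : x ∈ e.baseSet := mem_baseSet_trivializationAt F E x
  let L : E x ≃ₗ[ℂ] F := e.linearEquivAt (R := ℂ) x hx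
  exact ⟨L.symm.finiteDimensional, L.finrank_eq⟩

variable [FiniteDimensional ℝ V] [IsManifold 𝓘(ℝ, V) ∞ M] [T2Space M]
variable [FiniteDimensional ℂ F] [ContMDiffVectorBundle ∞ F E 𝓘(ℝ, V)]

omit [FiniteDimensional ℂ F] in
/-- Every vector in a fiber is the value of a smooth section. -/
theorem exists_section_apply_eq (x : M) (v : E x) : ∃ φ : Sections V F E, φ x = v := by
  obtain ⟨s, hs, hsm⟩ := FiberBundle.exists_contMDiffOn_extend (k := ∞) 𝓘(ℝ, V) F v
  obtain ⟨b, -, hb⟩ := ((SmoothBumpFunction.nhds_basis_tsupport (I := 𝓘(ℝ, V)) x).mem_iff).mp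
    (interior_mem_nhds.mpr hs)
  refine ⟨⟨_, ContMDiffOn.smul_section_of_tsupport b.contMDiff.contMDiffOn isOpen_interior hb
    (hsm.mono interior_subset)⟩, ?_⟩
  change b x • FiberBundle.extend F v x = v
  rw [b.eq_one, one_smul, FiberBundle.extend_apply_self]

/-- A system of `m` sections that is orthonormal near `x₀`. -/
def HermitianFiberMetric.OrthonormalNear (h : HermitianFiberMetric V F E) (x₀ : M) {m : ℕ}
    (u : Fin m → Sections V F E) : Prop :=
  ∀ᶠ y in nhds x₀, ∀ i j, h.form y (u i y) (u j y) = if i = j then 1 else 0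

/-- Gram–Schmidt with smooth function coefficients; `exists_local_inv_sqrt` supplies a globally
defined normalising factor. -/
theorem HermitianFiberMetric.exists_orthonormalNear (h : HermitianFiberMetric V F E) (x₀ : M)
    (m : ℕ) (hm : m ≤ Module.finrank ℂ F) :
    ∃ u : Fin m → Sections V F E, h.OrthonormalNear x₀ u := by
  induction m with
  | zero => exact ⟨Fin.elim0, Filter.Eventually.of_forall fun y i => i.elim0⟩
  | succ m ih =>
    obtain ⟨u, hu⟩ := ih (by omega)
    obtain ⟨hfd, hfr⟩ := finrank_fiber (F := F) (E := E) x₀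
    -- Since m is below the rank, some nonzero vector at x₀ is orthogonal to the m vectors already
    -- found. Extended to a section and projected, it stays nonzero at x₀.
    have hker : LinearMap.ker (LinearMap.pi fun i => h.form x₀ (u i x₀)) ≠ ⊥ :=
      LinearMap.ker_ne_bot_of_finrank_lt (by rw [Module.finrank_fin_fun]; omega)
    obtain ⟨v, hv, hv0⟩ := Submodule.exists_mem_ne_zero_of_ne_bot hker
    have hv' : ∀ i, h.form x₀ (u i x₀) v = 0 := fun i => congrFun (LinearMap.mem_ker.mp hv) i
    obtain ⟨φ, hφ⟩ := exists_section_apply_eq (V := V) (F := F) x₀ v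
    set φ' : Sections V F E := φ - ∑ i, h.pairing (u i) φ • u i with hφ'
    have hφ'_apply : ∀ y, φ' y = φ y - ∑ i, h.form y (u i y) (φ y) • u i y := fun y => by
      rw [hφ', ContMDiffSection.coe_sub, Pi.sub_apply, sum_section_apply]; rfl
    have hx₀ : φ' x₀ = v := by rw [hφ'_apply, hφ]; simp [hv']
    obtain ⟨g, hg, hgf⟩ := exists_local_inv_sqrt (h.pairing φ' φ')
      (fun x => ⟨_, h.form_self_nonneg x (φ' x), (h.form_self x _).symm⟩) x₀
      (by rw [pairing_apply, hx₀]; exact h.form_self_ne_zero hv0)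
    refine ⟨Fin.snoc u (g • φ'), ?_⟩
    filter_upwards [hu, hgf] with y hy hgy
    have hgy' : conj (g y) = g y := congrArg (fun g : SmoothFun V M => g y) hg
    have hort : ∀ i, h.form y (u i y) (φ' y) = 0 := fun i => by
      rw [hφ'_apply, map_sub, map_sum]
      simp [hy i]
    have hort' : ∀ i, h.form y (φ' y) (u i y) = 0 := fun i => by
      rw [← h.conj_symm, hort, map_zero]
    intro i j
    refine Fin.lastCases ?_ (fun i => ?_) i <;> refine Fin.lastCases ?_ (fun j => ?_) j
    · simp only [Fin.snoc_last, smul_section_apply, map_smulₛₗ, LinearMap.smul_apply, smul_eq_mul,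
        hgy', if_true]
      rw [pairing_apply] at hgy
      rw [← hgy]; simp; ring
    · simp [hort', (Fin.castSucc_ne_last j).symm]
    · simp [hort, Fin.castSucc_ne_last i]
    · simp [hy i j]

-- Orthonormality makes the coordinate map L onto, and equality of dimensions makes it injective;
-- both sides have the same coordinates.
omit [FiniteDimensional ℝ V] [IsManifold 𝓘(ℝ, V) ∞ M] [T2Space M]
  [ContMDiffVectorBundle ∞ F E 𝓘(ℝ, V)] in
theorem HermitianFiberMetric.expand_orthonormal (h : HermitianFiberMetric V F E) (y : M)
    (u : Fin (Module.finrank ℂ F) → E y)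
    (hu : ∀ i j, h.form y (u i) (u j) = if i = j then 1 else 0) (v : E y) :
    ∑ i, h.form y (u i) v • u i = v := by
  obtain ⟨hfd, hfr⟩ := finrank_fiber (F := F) (E := E) y
  let L : E y →ₗ[ℂ] (Fin (Module.finrank ℂ F) → ℂ) := LinearMap.pi fun i => h.form y (u i)
  have hL : ∀ w i, L w i = h.form y (u i) w := fun w i => rfl
  have hinj : Function.Injective L := by
    rw [LinearMap.injective_iff_surjective_of_finrank_eq_finrank (by simp [hfr])]
    intro c
    refine ⟨∑ i, c i • u i, ?_⟩
    ext j
    rw [hL, map_sum]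
    simp [hu]
  apply hinj
  ext j
  rw [hL, hL, map_sum]
  simp [hu]

/-- Parseval frames: there is a locally finite family of sections `sᵢ` such that
`φ = ∑ᵢ h(sᵢ, φ) sᵢ` for every section `φ`. -/
theorem HermitianFiberMetric.exists_parseval_frame [SigmaCompactSpace M]
    (h : HermitianFiberMetric V F E) :
    ∃ s : M × Fin (Module.finrank ℂ F) → Sections V F E,
      LocallyFinite (fun i => {x : M | ¬VanishesNear V x (s i)}) ∧
      ∀ φ, IsLocSum V M (fun i => h.pairing (s i) φ • s i) φ := by
  choose u hu using fun x => h.exists_orthonormalNear x _ le_rfl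
  choose U hUsub hUo hxU using fun x => eventually_nhds_iff.mp (hu x)
  obtain ⟨ρ, hρ⟩ := SmoothPartitionOfUnity.exists_isSubordinate 𝓘(ℝ, V) isClosed_univ U hUo
    fun x _ => Set.mem_iUnion.mpr ⟨x, hxU x⟩
  let r : M → SmoothFun V M := fun i => ofRealFun (ρ i) (ρ i).contMDiff
  have hr : ∀ i y, r i y = (ρ i y : ℂ) := fun i y => rfl
  have hlf : LocallyFinite fun i => tsupport (ρ i) := ρ.locallyFinite.closure
  have hvan : ∀ i x, x ∉ tsupport (ρ i) → VanishesNear V x (r i) := fun i x hx => by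
    rw [vanishesNear_smoothFun_iff]
    filter_upwards [(isClosed_tsupport (ρ i)).isOpen_compl.mem_nhds hx] with y hy
    rw [hr, image_eq_zero_of_notMem_tsupport hy, Complex.ofReal_zero]
  obtain ⟨t, ht⟩ := exists_isLocSum_smoothFun (fun i => r i * r i) (hlf.subset fun i x hx => by
    by_contra hn
    exact hx ((hvan i x hn).smul (r i)))
  have htf : ∀ x, ∃ s : Finset M, (∀ᶠ y in nhds x, ∀ i ∉ s, y ∉ tsupport (ρ i)) ∧
      ∀ᶠ y in nhds x, t y = ∑ i ∈ s, r i y * r i y := fun x => by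
    obtain ⟨s, hs⟩ := exists_finset_of_locallyFinite hlf x
    refine ⟨s, hs, ?_⟩
    have := (ht.sub_sum (x := x) (t := s) fun i hi =>
      (hvan i x (hs.self_of_nhds i hi)).smul (r i)).eventually_smoothFun
    filter_upwards [this] with y hy
    have hy' : t y - (∑ i ∈ s, r i * r i) y = 0 := hy
    rw [sum_smoothFun_apply] at hy'
    exact sub_eq_zero.mp hy'
  -- The frame enters its reproducing formula twice, so the squares of the partition functions must
  -- sum to 1. Their sum t is positive, and g = t^(−1/2) rescales them.
  obtain ⟨g, hg, hgt⟩ := exists_inv_sqrt t fun x => by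
    obtain ⟨s, hs, hts⟩ := htf x
    refine ⟨∑ i ∈ s, ρ i x * ρ i x, ?_, ?_⟩
    · obtain ⟨i, hi⟩ := ρ.exists_pos_of_mem (Set.mem_univ x)
      have his : i ∈ s := by
        by_contra hn
        exact hs.self_of_nhds i hn (subset_tsupport _ hi.ne')
      exact Finset.sum_pos' (fun j _ => mul_self_nonneg _) ⟨i, his, mul_pos hi hi⟩
    · rw [hts.self_of_nhds]; push_cast; rfl
  have hg' : ∀ y, conj (g y) = g y := fun y => congrArg (fun g : SmoothFun V M => g y) hg
  have hs_van : ∀ (i : M × Fin (Module.finrank ℂ F)) (x : M), x ∉ tsupport (ρ i.1) → VanishesNear V x ((g * r i.1) • u i.1 i.2) :=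
    fun i x hx => by
      obtain ⟨a, ha, hav⟩ := hvan i.1 x hx
      refine ⟨a, ha, ?_⟩
      have : a * (g * r i.1) = 0 := by
        rw [mul_left_comm, show a * r i.1 = 0 from hav, mul_zero]
      rw [← mul_smul, this, zero_smul]
  refine ⟨fun i => (g * r i.1) • u i.1 i.2, ?_, fun φ x => ?_⟩
  · intro x
    obtain ⟨W, hW, hfin⟩ := hlf x
    refine ⟨W, hW, (hfin.prod (Set.finite_univ (α := Fin (Module.finrank ℂ F)))).subset ?_⟩
    rintro i ⟨y, hy, hyW⟩
    refine ⟨⟨y, ?_, hyW⟩, Set.mem_univ _⟩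
    by_contra hn
    exact hy (hs_van i y hn)
  · obtain ⟨s, hs, hts⟩ := htf x
    refine ⟨s ×ˢ Finset.univ, ?_, fun i hi => (hs_van i x (hs.self_of_nhds i.1 fun h => hi
      (Finset.mem_product.mpr ⟨h, Finset.mem_univ _⟩))).smul _⟩
    rw [vanishesNear_section_iff]
    filter_upwards [hts] with y hty
    have hgty : g y * g y * t y = 1 := congrArg (fun g : SmoothFun V M => g y) hgt
    rw [ContMDiffSection.coe_sub, Pi.sub_apply, sum_section_apply, sub_eq_zero, Finset.sum_product]
    -- Where ρᵢ ≠ 0 the i-th frame is orthonormal and reproduces φ, which leaves the weight g²ρᵢ²;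
    -- elsewhere both sides are zero.
    have hi : ∀ i, ∑ j, (h.pairing ((g * r i) • u i j) φ • (g * r i) • u i j : Sections V F E) y =
        (g y * g y * (r i y * r i y)) • φ y := fun i => by
      by_cases hρy : ρ i y = 0
      · have h0 : ∀ j, ((h.pairing ((g * r i) • u i j) φ • (g * r i) • u i j : Sections V F E)) y = 0 :=
          fun j => by
            rw [smul_section_apply, smul_section_apply]
            change _ • (g y * r i y) • _ = _
            rw [hr, hρy]; simp
        rw [Finset.sum_congr rfl fun j _ => h0 j, hr, hρy]; simp
      · have hyU : y ∈ U i := hρ i (subset_tsupport _ hρy)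
        conv_rhs => rw [← h.expand_orthonormal y (fun j => u i j y) (hUsub i y hyU) (φ y)]
        rw [Finset.smul_sum]
        refine Finset.sum_congr rfl fun j _ => ?_
        change h.form y ((g y * r i y) • u i j y) (φ y) • (g y * r i y) • u i j y = _
        rw [map_smulₛₗ, LinearMap.smul_apply, map_mul, hg', hr, Complex.conj_ofReal, smul_smul,
          smul_smul, smul_eq_mul]
        congr 1; ring
    rw [Finset.sum_congr rfl fun i _ => hi i, ← Finset.sum_smul, ← Finset.mul_sum, ← hty, hgty,
      one_smul]

end Frames

/-! ### Deforming the pairing with a section into a right module morphism -/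

section ModuleMaps

variable {V : Type*} [NormedAddCommGroup V] [NormedSpace ℝ V]
variable {M : Type*} [TopologicalSpace M] [ChartedSpace V M]
variable {F : Type*} [NormedAddCommGroup F] [NormedSpace ℂ F]
variable {E : M → Type*} [TopologicalSpace (TotalSpace F E)] [∀ x, TopologicalSpace (E x)]
  [FiberBundle F E] [∀ x, AddCommGroup (E x)] [∀ x, Module ℂ (E x)] [VectorBundle ℂ F E]

namespace HermitianFiberMetric

variable (h : HermitianFiberMetric V F E)

theorem pairing_add_left (φ φ' ψ : Sections V F E) :
    h.pairing (φ + φ') ψ = h.pairing φ ψ + h.pairing φ' ψ := by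
  ext x; change h.form x (φ x + φ' x) (ψ x) = _; rw [map_add]; rfl

theorem pairing_add_right (φ ψ ψ' : Sections V F E) :
    h.pairing φ (ψ + ψ') = h.pairing φ ψ + h.pairing φ ψ' := by
  ext x; exact map_add (h.form x (φ x)) _ _

theorem pairing_smul_left (f : SmoothFun V M) (φ ψ : Sections V F E) :
    h.pairing (f • φ) ψ = star f * h.pairing φ ψ := by
  ext x; change h.form x (f x • φ x) (ψ x) = _; rw [map_smulₛₗ]; rfl

theorem pairing_smul_right (f : SmoothFun V M) (φ ψ : Sections V F E) :
    h.pairing φ (f • ψ) = f * h.pairing φ ψ := by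
  ext x; exact map_smul (h.form x (φ x)) _ _

theorem star_pairing (φ ψ : Sections V F E) : star (h.pairing φ ψ) = h.pairing ψ φ := by
  ext x; exact h.conj_symm x _ _

theorem pairing_sub_left (φ φ' ψ : Sections V F E) :
    h.pairing (φ - φ') ψ = h.pairing φ ψ - h.pairing φ' ψ := by
  rw [eq_sub_iff_add_eq, ← pairing_add_left, sub_add_cancel]

theorem pairing_sub_right (φ ψ ψ' : Sections V F E) :
    h.pairing φ (ψ - ψ') = h.pairing φ ψ - h.pairing φ ψ' := by
  rw [eq_sub_iff_add_eq, ← pairing_add_right, sub_add_cancel]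

theorem pairing_zero_left (ψ : Sections V F E) : h.pairing 0 ψ = 0 := by
  simpa using h.pairing_sub_left 0 0 ψ

theorem pairing_zero_right (φ : Sections V F E) : h.pairing φ 0 = 0 := by
  simpa using h.pairing_sub_right φ 0 0

theorem isDiffOp_pairing_right (φ : Sections V F E) :
    IsDiffOp (id : SmoothFun V M → SmoothFun V M) 0 (h.pairing φ) :=
  fun a ψ => h.pairing_smul_right a φ ψ

theorem eq_zero_of_pairing_self {φ : Sections V F E} (hφ : h.pairing φ φ = 0) : φ = 0 := by
  ext x
  by_contra hx
  exact h.form_self_ne_zero hx (congrArg (fun g : SmoothFun V M => g x) hφ)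

/-- Pairing with a fixed section as a linear map. -/
def pairingLin (s : Sections V F E) : Sections V F E →ₗ[ℂ] SmoothFun V M where
  toFun := h.pairing s
  map_add' := h.pairing_add_right s
  map_smul' c φ := h.pairing_smul_right (algebraMap ℂ _ c) s φ

end HermitianFiberMetric

theorem isLocSum_const_smul_smoothFun {ι : Type*} {p : ι → SmoothFun V M} {q : SmoothFun V M}
    (h : IsLocSum V M p q) (c : ℂ) : IsLocSum V M (fun i => c • p i) (c • q) := by
  exact h.smul (algebraMap ℂ (SmoothFun V M) c)

theorem isFormal₂_mul (S : StarProduct V M) : FormalSeries.IsFormal₂ S.mul :=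
  FormalSeries.isFormal₂_map₂ (B := (S.C · · ·)) (by simp) (by simp)

theorem isFormal_linear {P Q : Type*} [AddCommGroup P] [AddCommGroup Q] [Module ℂ P] [Module ℂ Q]
    (T : ℕ → P →ₗ[ℂ] Q) : FormalSeries.IsFormal (FormalSeries.map₁ (T · ·)) :=
  FormalSeries.isFormal_map₁ (by simp)

/-- The right action on formal sections. -/
def BundleDeformation.act {S : HermitianStarProduct V M} (D : BundleDeformation F E S)
    (φ : FormalSeries (Sections V F E)) (f : FormalSeries (SmoothFun V M)) :
    FormalSeries (Sections V F E) :=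
  FormalSeries.map₂ (D.R · · ·) φ f

theorem isFormal₂_act {S : HermitianStarProduct V M} (D : BundleDeformation F E S) :
    FormalSeries.IsFormal₂ D.act :=
  FormalSeries.isFormal₂_map₂ (B := (D.R · · ·)) (by simp) (by simp)

variable [FiniteDimensional ℝ V] [IsManifold 𝓘(ℝ, V) ∞ M] [T2Space M]

/-- A Parseval frame provides a homotopy: a cocycle is a coboundary. -/
theorem exists_coboundary (h : HermitianFiberMetric V F E) {ι : Type*} {σ : ι → Sections V F E}
    (hlf : LocallyFinite (fun i => {x : M | ¬VanishesNear V x (σ i)}))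
    (hσ : ∀ φ, IsLocSum V M (fun i => h.pairing (σ i) φ • σ i) φ)
    (c : Sections V F E →ₗ[ℂ] SmoothFun V M →ₗ[ℂ] SmoothFun V M)
    (hc : ∀ φ f g, c φ (f * g) = c (f • φ) g + c φ f * g)
    {k l : ℕ} (hk : ∀ f, IsDiffOp (id : SmoothFun V M → SmoothFun V M) k (fun φ => c φ f))
    (hl : ∀ φ, IsDiffOp (id : SmoothFun V M → SmoothFun V M) l (c φ)) :
    ∃ b : Sections V F E →ₗ[ℂ] SmoothFun V M,
      IsDiffOp (id : SmoothFun V M → SmoothFun V M) l b ∧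
      (∀ φ f, b (f • φ) = c φ f + b φ * f) ∧
      ∀ x : M, (∀ φ f, VanishesNear V x (c φ f)) → ∀ φ, VanishesNear V x (b φ) := by
  -- The homotopy is b(φ) = ∑ c(σᵢ, h(σᵢ, φ)). The cocycle identity turns b(fφ) into ∑ c(h(σᵢ, φ)σᵢ,
  -- f) + b(φ)f, and the first sum is c(φ, f) by the frame property and locality of c(·, f).
  have hex : ∀ φ, ∃ q, IsLocSum V M (fun i => c (σ i) (h.pairing (σ i) φ)) q := fun φ =>
    exists_isLocSum_smoothFun _ (hlf.subset fun i x hx hv => hx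
      (vanishesNear_of_isDiffOp_id (hk _) (by simp) x _ hv))
  choose b hb using hex
  refine ⟨⟨⟨b, fun φ ψ => ?_⟩, fun z φ => ?_⟩, ?_, fun φ f => ?_, fun x hx φ => ?_⟩
  · refine (hb _).unique ?_
    simpa only [h.pairing_add_right, map_add] using (hb φ).add (hb ψ)
  · refine (hb _).unique ?_
    have := isLocSum_const_smul_smoothFun (hb φ) z
    have e : ∀ i, h.pairing (σ i) (z • φ) = z • h.pairing (σ i) φ := fun i =>
      h.pairing_smul_right (algebraMap ℂ _ z) _ _
    simp only [e, map_smul]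
    exact this
  · rw [← zero_add l]
    exact IsLocSum.isDiffOp (fun i => IsDiffOp.comp (σ := id) (τ := id) (hl (σ i)) (map_sub _)
      (h.isDiffOp_pairing_right (σ i))) hb
  · refine (hb _).unique ?_
    have h1 := (hσ φ).map (D := fun φ => c φ f) (fun x y => by simp)
      (vanishesNear_of_isDiffOp_id (hk f) (by simp))
    have h2 := h1.add ((hb φ).smul f)
    simp only [smul_eq_mul] at h2
    simp only [h.pairing_smul_right]
    convert h2 using 2 with i
    · rw [mul_comm, hc, mul_comm f]
    · exact mul_comm _ _
  · exact (hb φ).vanishesNear fun i => hx _ _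

section Recursion

variable {S : HermitianStarProduct V M} (D : BundleDeformation F E S)

omit [FiniteDimensional ℝ V] [IsManifold 𝓘(ℝ, V) ∞ M] [T2Space M]

/-- The coefficient of `λ^n` in `T(φ • f)`. -/
def mapAct (n : ℕ) (T : ℕ → Sections V F E →ₗ[ℂ] SmoothFun V M) :
    Sections V F E →ₗ[ℂ] SmoothFun V M →ₗ[ℂ] SmoothFun V M :=
  ∑ x ∈ antidiagonal n, (D.R x.2).compr₂ (T x.1)

/-- The coefficient of `λ^n` in `T(φ) ⋆ f`. -/
def mapMul (S : HermitianStarProduct V M) (n : ℕ) (T : ℕ → Sections V F E →ₗ[ℂ] SmoothFun V M) :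
    Sections V F E →ₗ[ℂ] SmoothFun V M →ₗ[ℂ] SmoothFun V M :=
  ∑ x ∈ antidiagonal n, (S.C x.1).comp (T x.2)

theorem mapAct_apply (n : ℕ) (T : ℕ → Sections V F E →ₗ[ℂ] SmoothFun V M) (φ : Sections V F E)
    (f : SmoothFun V M) : mapAct D n T φ f = ∑ x ∈ antidiagonal n, T x.1 (D.R x.2 φ f) := by
  simp [mapAct, LinearMap.sum_apply]

theorem mapMul_apply (n : ℕ) (T : ℕ → Sections V F E →ₗ[ℂ] SmoothFun V M) (φ : Sections V F E)
    (f : SmoothFun V M) : mapMul S n T φ f = ∑ x ∈ antidiagonal n, S.C x.1 (T x.2 φ) f := by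
  simp [mapMul, LinearMap.sum_apply]

theorem coeff_mapAct (n : ℕ) (T : ℕ → Sections V F E →ₗ[ℂ] SmoothFun V M) (φ : Sections V F E)
    (f : SmoothFun V M) : FormalSeries.coeff n (FormalSeries.map₁ (T · ·)
      (D.act (FormalSeries.const φ) (FormalSeries.const f))) = mapAct D n T φ f := by
  rw [mapAct_apply, FormalSeries.coeff_map₁]
  refine Finset.sum_congr rfl fun x _ => ?_
  rw [BundleDeformation.act, FormalSeries.coeff_map₂_const (by simp) (by simp)]

theorem coeff_mapMul (n : ℕ) (T : ℕ → Sections V F E →ₗ[ℂ] SmoothFun V M) (φ : Sections V F E)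
    (f : SmoothFun V M) : FormalSeries.coeff n (S.mul (FormalSeries.map₁ (T · ·)
      (FormalSeries.const φ)) (FormalSeries.const f)) = mapMul S n T φ f := by
  rw [mapMul_apply, StarProduct.mul, FormalSeries.coeff_map₂_const_right (by simp)]
  refine Finset.sum_congr rfl fun x _ => ?_
  rw [FormalSeries.coeff_map₁_const (by simp)]

theorem isFormal₂_mapAct (T : ℕ → Sections V F E →ₗ[ℂ] SmoothFun V M) :
    FormalSeries.IsFormal₂ fun φ f => FormalSeries.map₁ (T · ·) (D.act φ f) :=
  ⟨fun f => (isFormal_linear T).comp ((isFormal₂_act D).left f),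
    fun φ => (isFormal_linear T).comp ((isFormal₂_act D).right φ)⟩

theorem isFormal₂_mapMul (T : ℕ → Sections V F E →ₗ[ℂ] SmoothFun V M) :
    FormalSeries.IsFormal₂ fun φ f => S.mul (FormalSeries.map₁ (T · ·) φ) f :=
  ⟨fun f => ((isFormal₂_mul S.toStarProduct).left f).comp (isFormal_linear T),
    fun _ => (isFormal₂_mul S.toStarProduct).right _⟩

theorem mapAct_congr {n : ℕ} {T T' : ℕ → Sections V F E →ₗ[ℂ] SmoothFun V M}
    (h : ∀ m ≤ n, T m = T' m) : mapAct D n T = mapAct D n T' :=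
  Finset.sum_congr rfl fun x hx => by
    rw [h x.1 (Finset.HasAntidiagonal.antidiagonal.fst_le hx)]

theorem mapMul_congr {n : ℕ} {T T' : ℕ → Sections V F E →ₗ[ℂ] SmoothFun V M}
    (h : ∀ m ≤ n, T m = T' m) : mapMul S n T = mapMul S n T' :=
  Finset.sum_congr rfl fun x hx => by
    rw [h x.2 (Finset.HasAntidiagonal.antidiagonal.snd_le hx)]

/-- The conditions on the term `T_n` of a deformation of `h(s, ·)` into a module morphism. -/
structure IsModuleMapTerm (h : HermitianFiberMetric V F E) (s : Sections V F E) (n k : ℕ)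
    (T : ℕ → Sections V F E →ₗ[ℂ] SmoothFun V M) : Prop where
  zero : n = 0 → ∀ φ, T 0 φ = h.pairing s φ
  diffOp : IsDiffOp (id : SmoothFun V M → SmoothFun V M) k (T n)
  vanishes : ∀ x : M, VanishesNear V x s → ∀ φ, VanishesNear V x (T n φ)
  eq : mapAct D n T = mapMul S n T

theorem IsModuleMapTerm.congr {h : HermitianFiberMetric V F E} {s : Sections V F E} {n k : ℕ}
    {T T' : ℕ → Sections V F E →ₗ[ℂ] SmoothFun V M} (hTT' : ∀ m ≤ n, T m = T' m)
    (hT : IsModuleMapTerm D h s n k T) : IsModuleMapTerm D h s n k T' where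
  zero hn φ := by rw [← hTT' 0 (Nat.zero_le n)]; exact hT.zero hn φ
  diffOp := by rw [← hTT' n le_rfl]; exact hT.diffOp
  vanishes := by rw [← hTT' n le_rfl]; exact hT.vanishes
  eq := by rw [← mapAct_congr D hTT', ← mapMul_congr hTT', hT.eq]

theorem exists_moduleMapTerm_zero (h : HermitianFiberMetric V F E) (s : Sections V F E)
    (T : ℕ → Sections V F E →ₗ[ℂ] SmoothFun V M) :
    ∃ t, IsModuleMapTerm D h s 0 0 (Function.update T 0 t) := by
  refine ⟨h.pairingLin s, fun _ φ => ?_, ?_, fun x hx φ => ?_, ?_⟩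
  · simp only [Function.update_self]; rfl
  · simp only [Function.update_self]; exact h.isDiffOp_pairing_right s
  · simp only [Function.update_self]
    obtain ⟨a, ha, has⟩ := hx
    refine ⟨star a, (map_ne_zero (starRingEnd ℂ)).mpr ha, ?_⟩
    change star a * h.pairing s φ = 0
    rw [← h.pairing_smul_left, has, h.pairing_zero_left]
  · ext1 φ; ext1 f
    rw [mapAct_apply, mapMul_apply]
    simp only [Finset.Nat.antidiagonal_zero, Finset.sum_singleton, Function.update_self, D.R_zero,
      S.C_zero]
    exact (h.pairing_smul_right f s φ).trans (mul_comm _ _)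

/-- The obstruction to solving the equation of order `n` is a cocycle. -/
theorem obstruction_cocycle {n : ℕ} {T : ℕ → Sections V F E →ₗ[ℂ] SmoothFun V M}
    (heq : ∀ m < n, mapAct D m T = mapMul S m T) (φ : Sections V F E) (f g : SmoothFun V M) :
    (mapMul S n T - mapAct D n T) φ (f * g) =
      (mapMul S n T - mapAct D n T) (f • φ) g + (mapMul S n T - mapAct D n T) φ f * g := by
  set c := mapMul S n T - mapAct D n T with hc_def
  -- The defect d(φ, f) = T(φ) ⋆ f − T(φ • f) satisfies d(φ, f ⋆ g) = d(φ • f, g) + d(φ, f) ⋆ g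
  -- exactly, by associativity of ⋆ and the module law. Since d starts at order n, the coefficient
  -- of λⁿ is the classical cocycle identity.
  set d := fun φ f => S.mul (FormalSeries.map₁ (T · ·) φ) f -
    FormalSeries.map₁ (T · ·) (D.act φ f) with hd_def
  have hd : FormalSeries.IsFormal₂ d := (isFormal₂_mapMul T).sub (isFormal₂_mapAct D T)
  have hd_lt : ∀ φ f, ∀ m < n,
      FormalSeries.coeff m (d (FormalSeries.const φ) (FormalSeries.const f)) = 0 :=
    fun φ f m hm => by
      rw [hd_def, FormalSeries.coeff_sub, coeff_mapAct, coeff_mapMul, heq m hm, sub_self]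
  have hd_n : ∀ φ f, FormalSeries.coeff n (d φ f) =
      c (FormalSeries.coeff 0 φ) (FormalSeries.coeff 0 f) := fun φ f => by
    rw [hd.leading hd_lt, hd_def, FormalSeries.coeff_sub, coeff_mapAct, coeff_mapMul, hc_def]; rfl
  have hd_cocycle : ∀ φ f g, d φ (S.mul f g) = d (D.act φ f) g + S.mul (d φ f) g := by
    intro φ f g
    have e1 : S.mul (d φ f) g = S.mul (S.mul (FormalSeries.map₁ (T · ·) φ) f) g -
        S.mul (FormalSeries.map₁ (T · ·) (D.act φ f)) g := by
      have := (isFormal₂_mul S.toStarProduct).left g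
      rw [eq_sub_iff_add_eq, ← this.add, hd_def, sub_add_cancel]
    have e2 : D.act φ (S.mul f g) = D.act (D.act φ f) g := D.act_mul φ f g
    have e3 : S.mul (S.mul (FormalSeries.map₁ (T · ·) φ) f) g =
      S.mul (FormalSeries.map₁ (T · ·) φ) (S.mul f g) := S.assoc _ _ _
    rw [e1, e3, hd_def]
    simp only [e2]
    abel
  have := congrArg (FormalSeries.coeff n) (hd_cocycle (FormalSeries.const φ)
    (FormalSeries.const f) (FormalSeries.const g))
  rw [FormalSeries.coeff_add, hd_n, hd_n] at this
  have e : FormalSeries.coeff n (S.mul (d (FormalSeries.const φ) (FormalSeries.const f))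
      (FormalSeries.const g)) = c φ f * g := by
    rw [StarProduct.mul, FormalSeries.coeff_map₂_const_right (by simp),
      Finset.sum_eq_single (0, n)]
    · rw [hd_n, S.C_zero]; rfl
    · rintro ⟨i, j⟩ hij hne
      rw [Finset.HasAntidiagonal.mem_antidiagonal] at hij
      have hj : j < n := by
        rcases Nat.eq_zero_or_pos i with rfl | hi
        · exact absurd (by simp at hij; simp [hij]) hne
        · simp at hij; omega
      rw [hd_lt _ _ j hj]; simp
    · simp
  rw [e] at this
  simpa [StarProduct.mul, BundleDeformation.act, FormalSeries.coeff_zero_map₂, S.C_zero,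
    D.R_zero] using this

/-- The bound has to be independent of T: later the operators for infinitely many frame sections are
summed, and `IsLocSum.isDiffOp` requires one common order. -/
theorem exists_order_mapAct (n : ℕ) (κ : ℕ → ℕ) :
    ∃ k, ∀ T : ℕ → Sections V F E →ₗ[ℂ] SmoothFun V M,
      (∀ m ≤ n, IsDiffOp (id : SmoothFun V M → SmoothFun V M) (κ m) (T m)) →
      (∀ f, IsDiffOp (id : SmoothFun V M → SmoothFun V M) k (fun φ => mapAct D n T φ f)) ∧
      ∀ φ, IsDiffOp (id : SmoothFun V M → SmoothFun V M) k (mapAct D n T φ) := by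
  choose k₁ h₁ using fun r => (D.bidiff r).1
  choose k₂ h₂ using fun r => (D.bidiff r).2
  refine ⟨(antidiagonal n).sup fun x => max (k₁ x.2 + κ x.1) (k₂ x.2 + κ x.1), fun T hT => ?_⟩
  have hle : ∀ x ∈ antidiagonal n, max (k₁ x.2 + κ x.1) (k₂ x.2 + κ x.1) ≤ (antidiagonal n).sup
      fun x => max (k₁ x.2 + κ x.1) (k₂ x.2 + κ x.1) := fun x hx =>
    Finset.le_sup (f := fun x : ℕ × ℕ => max (k₁ x.2 + κ x.1) (k₂ x.2 + κ x.1)) hx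
  have hT' := fun x (hx : x ∈ antidiagonal n) =>
    hT x.1 (Finset.HasAntidiagonal.antidiagonal.fst_le hx)
  constructor
  · intro f
    simp only [mapAct_apply]
    exact IsDiffOp.sum _ fun x hx => (IsDiffOp.comp (σ := id) (τ := id) (hT' x hx) (by simp)
      (h₁ x.2 f)).mono ((le_max_left _ _).trans (hle x hx))
  · intro φ
    rw [show ⇑(mapAct D n T φ) = fun f => ∑ x ∈ antidiagonal n, T x.1 (D.R x.2 φ f) from
      funext fun f => mapAct_apply D n T φ f]
    exact IsDiffOp.sum _ fun x hx => (IsDiffOp.comp (σ := id) (τ := id) (hT' x hx) (by simp)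
      (h₂ x.2 φ)).mono ((le_max_right _ _).trans (hle x hx))

theorem exists_order_mapMul (n : ℕ) (κ : ℕ → ℕ) :
    ∃ k, ∀ T : ℕ → Sections V F E →ₗ[ℂ] SmoothFun V M,
      (∀ m ≤ n, IsDiffOp (id : SmoothFun V M → SmoothFun V M) (κ m) (T m)) →
      (∀ f, IsDiffOp (id : SmoothFun V M → SmoothFun V M) k (fun φ => mapMul S n T φ f)) ∧
      ∀ φ, IsDiffOp (id : SmoothFun V M → SmoothFun V M) k (mapMul S n T φ) := by
  choose k₁ h₁ using fun r => (S.bidiff r).1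
  choose k₂ h₂ using fun r => (S.bidiff r).2
  refine ⟨(antidiagonal n).sup fun x => max (κ x.2 + k₁ x.1) (k₂ x.1), fun T hT => ?_⟩
  have hle : ∀ x ∈ antidiagonal n, max (κ x.2 + k₁ x.1) (k₂ x.1) ≤ (antidiagonal n).sup
      fun x => max (κ x.2 + k₁ x.1) (k₂ x.1) := fun x hx =>
    Finset.le_sup (f := fun x : ℕ × ℕ => max (κ x.2 + k₁ x.1) (k₂ x.1)) hx
  have hT' := fun x (hx : x ∈ antidiagonal n) =>
    hT x.2 (Finset.HasAntidiagonal.antidiagonal.snd_le hx)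
  constructor
  · intro f
    simp only [mapMul_apply]
    exact IsDiffOp.sum _ fun x hx => (IsDiffOp.comp (σ := id) (τ := id) (h₁ x.1 f) (by simp)
      (hT' x hx)).mono ((le_max_left _ _).trans (hle x hx))
  · intro φ
    rw [show ⇑(mapMul S n T φ) = fun f => ∑ x ∈ antidiagonal n, S.C x.1 (T x.2 φ) f from
      funext fun f => mapMul_apply n T φ f]
    exact IsDiffOp.sum _ fun x hx => (h₂ x.1 _).mono ((le_max_right _ _).trans (hle x hx))

/-- The unknown of order n meets only the classical action `D.R 0`, so the equation of order n is
affine in it. -/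
theorem mapAct_update {n : ℕ} {T : ℕ → Sections V F E →ₗ[ℂ] SmoothFun V M} (hT : T n = 0)
    (b : Sections V F E →ₗ[ℂ] SmoothFun V M) (φ : Sections V F E) (f : SmoothFun V M) :
    mapAct D n (Function.update T n b) φ f = mapAct D n T φ f + b (f • φ) := by
  have hsplit : Function.update T n b = T + Pi.single n b := by
    funext m
    by_cases hm : m = n
    · subst hm; simp [hT]
    · rw [Function.update_of_ne hm, Pi.add_apply, Pi.single_eq_of_ne hm, add_zero]
  rw [mapAct_apply, mapAct_apply, hsplit]
  simp only [Pi.add_apply, LinearMap.add_apply, Finset.sum_add_distrib]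
  congr 1
  rw [Finset.sum_eq_single (n, 0)]
  · simp [D.R_zero]
  · rintro ⟨i, j⟩ hij hne
    rw [Finset.HasAntidiagonal.mem_antidiagonal] at hij
    have hi : i ≠ n := by rintro rfl; apply hne; simp at hij; simp [hij]
    simp [Pi.single_eq_of_ne hi]
  · simp

theorem mapMul_update {n : ℕ} {T : ℕ → Sections V F E →ₗ[ℂ] SmoothFun V M} (hT : T n = 0)
    (b : Sections V F E →ₗ[ℂ] SmoothFun V M) (φ : Sections V F E) (f : SmoothFun V M) :
    mapMul S n (Function.update T n b) φ f = mapMul S n T φ f + b φ * f := by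
  have hsplit : Function.update T n b = T + Pi.single n b := by
    funext m
    by_cases hm : m = n
    · subst hm; simp [hT]
    · rw [Function.update_of_ne hm, Pi.add_apply, Pi.single_eq_of_ne hm, add_zero]
  rw [mapMul_apply, mapMul_apply, hsplit]
  simp only [Pi.add_apply, LinearMap.add_apply, map_add, Finset.sum_add_distrib]
  congr 1
  rw [Finset.sum_eq_single (0, n)]
  · simp [S.C_zero]
  · rintro ⟨i, j⟩ hij hne
    rw [Finset.HasAntidiagonal.mem_antidiagonal] at hij
    have hj : j ≠ n := by rintro rfl; apply hne; simp at hij; simp [hij]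
    simp [Pi.single_eq_of_ne hj]
  · simp

end Recursion

section Frame

variable {S : HermitianStarProduct V M} (D : BundleDeformation F E S)
variable (h : HermitianFiberMetric V F E) {ι : Type*} {σ : ι → Sections V F E}

/-- With `mapMul_update`, the equation of order n becomes b(fφ) − b(φ)f = c(φ, f) for the
obstruction c of the lower terms, which `exists_coboundary` solves. The order k is fixed before s,
and b inherits the vanishing of s. -/
theorem exists_moduleMapTerm_pos
    (hlf : LocallyFinite (fun i => {x : M | ¬VanishesNear V x (σ i)}))
    (hσ : ∀ φ, IsLocSum V M (fun i => h.pairing (σ i) φ • σ i) φ) {n : ℕ} (hn : 0 < n)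
    (κ : ℕ → ℕ) : ∃ k, ∀ s T, (∀ m < n, IsModuleMapTerm D h s m (κ m) T) →
      ∃ t, IsModuleMapTerm D h s n k (Function.update T n t) := by
  obtain ⟨k₁, h₁⟩ := exists_order_mapAct D n κ
  obtain ⟨k₂, h₂⟩ := exists_order_mapMul (F := F) (E := E) (S := S) n κ
  refine ⟨max k₂ k₁, fun s T hT => ?_⟩
  set T' := Function.update T n 0 with hT'
  have hT'lt : ∀ m < n, T' m = T m := fun m hm => Function.update_of_ne hm.ne _ _
  have hT'n : T' n = 0 := Function.update_self _ _ _
  have hterm : ∀ m < n, IsModuleMapTerm D h s m (κ m) T' := fun m hm =>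
    (hT m hm).congr D fun l hl => (hT'lt l (hl.trans_lt hm)).symm
  have hdiff : ∀ m ≤ n, IsDiffOp (id : SmoothFun V M → SmoothFun V M) (κ m) (T' m) := by
    intro m hm
    rcases hm.eq_or_lt with rfl | hm
    · rw [hT'n]; exact IsDiffOp.zero _ _
    · exact (hterm m hm).diffOp
  have hvan : ∀ m ≤ n, ∀ x : M, VanishesNear V x s → ∀ φ, VanishesNear V x (T' m φ) := by
    intro m hm x hx φ
    rcases hm.eq_or_lt with rfl | hm
    · rw [hT'n]; exact VanishesNear.zero x
    · exact (hterm m hm).vanishes x hx φ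
  obtain ⟨h₁l, h₁r⟩ := h₁ T' hdiff
  obtain ⟨h₂l, h₂r⟩ := h₂ T' hdiff
  obtain ⟨b, hb, hbc, hbv⟩ := exists_coboundary h hlf hσ (mapMul S n T' - mapAct D n T')
    (obstruction_cocycle D fun m hm => (hterm m hm).eq) (k := max k₂ k₁) (l := max k₂ k₁)
    (fun f => ((h₂l f).mono (le_max_left _ _)).sub ((h₁l f).mono (le_max_right _ _)))
    (fun φ => ((h₂r φ).mono (le_max_left _ _)).sub ((h₁r φ).mono (le_max_right _ _)))
  -- The n-th term is about to be overwritten, so it may be zero beforehand; the obstruction then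
  -- involves only the lower terms.
  rw [show (∃ t, IsModuleMapTerm D h s n (max k₂ k₁) (Function.update T n t)) ↔
    ∃ t, IsModuleMapTerm D h s n (max k₂ k₁) (Function.update T' n t) by rw [hT']; simp]
  refine ⟨b, fun h0 => absurd h0 hn.ne', ?_, ?_, ?_⟩
  · rwa [Function.update_self]
  · rw [Function.update_self]
    intro x hx
    refine hbv x fun φ f => ?_
    rw [LinearMap.sub_apply, LinearMap.sub_apply, mapAct_apply, mapMul_apply]
    refine VanishesNear.sub (VanishesNear.sum fun y hy => ?_) (VanishesNear.sum fun y hy => ?_)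
    · obtain ⟨k, hk⟩ := (S.bidiff y.1).1
      exact vanishesNear_of_isDiffOp_id (hk f) (by simp) x _
        (hvan _ (Finset.HasAntidiagonal.antidiagonal.snd_le hy) x hx φ)
    · exact hvan _ (Finset.HasAntidiagonal.antidiagonal.fst_le hy) x hx _
  · ext1 φ; ext1 f
    rw [mapAct_update D hT'n, mapMul_update hT'n, hbc, LinearMap.sub_apply, LinearMap.sub_apply]
    abel

/-- Every section `s` yields a morphism of right modules `T = ∑ λ^r T_r` from the deformed sections
to the deformed functions with `T₀ = h(s, ·)`, supported where `s` is. The orders of the `T_r` are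
bounded independently of `s`. -/
theorem exists_moduleMap
    (hlf : LocallyFinite (fun i => {x : M | ¬VanishesNear V x (σ i)}))
    (hσ : ∀ φ, IsLocSum V M (fun i => h.pairing (σ i) φ • σ i) φ) :
    ∃ (κ : ℕ → ℕ) (T : Sections V F E → ℕ → Sections V F E →ₗ[ℂ] SmoothFun V M),
      (∀ s φ, T s 0 φ = h.pairing s φ) ∧
      (∀ s n, IsDiffOp (id : SmoothFun V M → SmoothFun V M) (κ n) (T s n)) ∧
      (∀ s n (x : M), VanishesNear V x s → ∀ φ, VanishesNear V x (T s n φ)) ∧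
      ∀ s φ f, FormalSeries.map₁ (T s · ·) (D.act φ f) =
        S.mul (FormalSeries.map₁ (T s · ·) φ) f := by
  -- The recursion picks the n-th terms for all s simultaneously, so that each order bound is chosen
  -- uniformly in s.
  have key : ∃ T : ℕ → Sections V F E → Sections V F E →ₗ[ℂ] SmoothFun V M, ∀ n,
      ∃ k, ∀ s, IsModuleMapTerm D h s n k (fun m => T m s) := by
    refine exists_seq_of_step _ ?_ ?_
    · rintro n T T' hTT' ⟨k, hk⟩
      exact ⟨k, fun s => (hk s).congr D fun m hm => by rw [hTT' m hm]⟩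
    · intro n T hT
      have hupd : ∀ (t : Sections V F E → Sections V F E →ₗ[ℂ] SmoothFun V M) s,
          (fun m => Function.update T n t m s) = Function.update (fun m => T m s) n (t s) := by
        intro t s
        funext m
        by_cases hm : m = n
        · subst hm; simp
        · simp [Function.update_of_ne hm]
      rcases Nat.eq_zero_or_pos n with rfl | hn
      · choose t ht using fun s => exists_moduleMapTerm_zero D h s (fun m => T m s)
        exact ⟨t, 0, fun s => by rw [hupd]; exact ht s⟩
      · choose! κ hκ using hT
        obtain ⟨k, hk⟩ := exists_moduleMapTerm_pos D h hlf hσ hn κ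
        choose t ht using fun s => hk s (fun m => T m s) fun m hm => hκ m hm s
        exact ⟨t, k, fun s => by rw [hupd]; exact ht s⟩
  obtain ⟨T, hT⟩ := key
  choose κ hκ using hT
  refine ⟨κ, fun s n => T n s, fun s => (hκ 0 s).zero rfl, fun s n => (hκ n s).diffOp,
    fun s n => (hκ n s).vanishes, fun s φ f => ?_⟩
  refine (isFormal₂_mapAct D _).ext_const (isFormal₂_mapMul _) (fun φ f => ?_) φ f
  ext1 n
  rw [coeff_mapAct, coeff_mapMul, (hκ n s).eq]

end Frame

end ModuleMaps

/-! ### The deformed metric as a locally finite sum of squares -/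

section SumOfSquares

variable {V : Type*} [NormedAddCommGroup V] [NormedSpace ℝ V]
variable {M : Type*} [TopologicalSpace M] [ChartedSpace V M]

theorem isFormal_conjSeries :
    FormalSeries.IsFormal (conjSeries : FormalSeries (SmoothFun V M) → _) where
  add p q := by ext1 n; exact star_add _ _
  shift p := by
    ext1 n
    cases n with
    | zero => exact star_zero _
    | succ n => rfl

@[simp] theorem coeff_conjSeries (f : FormalSeries (SmoothFun V M)) (n : ℕ) :
    FormalSeries.coeff n (conjSeries f) = star (FormalSeries.coeff n f) := rfl

theorem conjSeries_conjSeries (f : FormalSeries (SmoothFun V M)) : conjSeries (conjSeries f) = f := by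
  ext1 n; simp

theorem IsLocSum.star {ι : Type*} {p : ι → SmoothFun V M} {q : SmoothFun V M}
    (h : IsLocSum V M p q) : IsLocSum V M (fun i => star (p i)) (star q) :=
  h.map star_sub (fun x p => vanishesNear_of_isDiffOp_star isDiffOp_star (star_zero _) x p)

theorem IsLocSum.finsetSum {ι κ P : Type*} [AddCommGroup P] [Module (SmoothFun V M) P]
    {p : κ → ι → P} {q : κ → P} (s : Finset κ) (h : ∀ j ∈ s, IsLocSum V M (p j) (q j)) :
    IsLocSum V M (fun i => ∑ j ∈ s, p j i) (∑ j ∈ s, q j) := by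
  classical
  induction s using Finset.induction_on with
  | empty =>
    intro x
    exact ⟨∅, by simpa using VanishesNear.zero x, fun i _ => by simpa using VanishesNear.zero x⟩
  | insert j s hj ih =>
    simp only [Finset.sum_insert hj]
    exact (h j (Finset.mem_insert_self j s)).add
      (ih fun j' hj' => h j' (Finset.mem_insert_of_mem hj'))

variable (V M) in
/-- Locally finite sums of series, coefficient by coefficient. -/
def IsSeriesLocSum {ι : Type*} (p : ι → FormalSeries (SmoothFun V M))
    (q : FormalSeries (SmoothFun V M)) : Prop :=
  ∀ n, IsLocSum V M (fun i => FormalSeries.coeff n (p i)) (FormalSeries.coeff n q)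

theorem IsSeriesLocSum.unique {ι : Type*} {p : ι → FormalSeries (SmoothFun V M)}
    {q q' : FormalSeries (SmoothFun V M)} (h : IsSeriesLocSum V M p q)
    (h' : IsSeriesLocSum V M p q') : q = q' := by
  ext1 n; exact (h n).unique (h' n)

theorem IsSeriesLocSum.conj {ι : Type*} {p : ι → FormalSeries (SmoothFun V M)}
    {q : FormalSeries (SmoothFun V M)} (h : IsSeriesLocSum V M p q) :
    IsSeriesLocSum V M (fun i => conjSeries (p i)) (conjSeries q) :=
  fun n => (h n).star

theorem IsSeriesLocSum.mul_right {ι : Type*} {p : ι → FormalSeries (SmoothFun V M)}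
    {q : FormalSeries (SmoothFun V M)} (h : IsSeriesLocSum V M p q) (S : StarProduct V M)
    (f : FormalSeries (SmoothFun V M)) :
    IsSeriesLocSum V M (fun i => S.mul (p i) f) (S.mul q f) := by
  intro n
  simp only [StarProduct.mul, FormalSeries.coeff_map₂]
  refine IsLocSum.finsetSum _ fun x _ => IsLocSum.finsetSum _ fun y _ => ?_
  obtain ⟨k, hk⟩ := (S.bidiff x.1).1
  exact (h y.1).map (D := fun g => S.C x.1 g (FormalSeries.coeff y.2 f)) (fun a b => by simp)
    (vanishesNear_of_isDiffOp_id (hk _) (by simp))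

variable {F : Type*} [NormedAddCommGroup F] [NormedSpace ℂ F]
variable {E : M → Type*} [TopologicalSpace (TotalSpace F E)] [∀ x, TopologicalSpace (E x)]
  [FiberBundle F E] [∀ x, AddCommGroup (E x)] [∀ x, Module ℂ (E x)] [VectorBundle ℂ F E]

/-- The `λ`-sesquilinear extension of a sequence of sesquilinear maps. -/
def sesqSeries (h : ℕ → Sections V F E →ₗ⋆[ℂ] Sections V F E →ₗ[ℂ] SmoothFun V M)
    (φ ψ : FormalSeries (Sections V F E)) : FormalSeries (SmoothFun V M) :=
  FormalSeries.map₂ (h · · ·) φ ψ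

theorem isFormal₂_sesqSeries (h : ℕ → Sections V F E →ₗ⋆[ℂ] Sections V F E →ₗ[ℂ] SmoothFun V M) :
    FormalSeries.IsFormal₂ (sesqSeries h) :=
  FormalSeries.isFormal₂_map₂ (B := (h · · ·)) (by simp) (by simp)

/-- If the coefficients of φ below n vanish, testing against the constant series φₙ gives h₀(φₙ, φₙ)
at order n, so φₙ = 0. Only the definiteness of the zeroth order matters. -/
theorem sesqSeries_nondegenerate
    {h : ℕ → Sections V F E →ₗ⋆[ℂ] Sections V F E →ₗ[ℂ] SmoothFun V M}
    {h₀ : HermitianFiberMetric V F E} (hh : ∀ φ ψ, h 0 φ ψ = h₀.pairing φ ψ)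
    (φ : FormalSeries (Sections V F E)) (hφ : ∀ ψ, sesqSeries h φ ψ = 0) : φ = 0 := by
  ext1 n
  induction n using Nat.strong_induction_on with
  | _ n ih =>
    apply h₀.eq_zero_of_pairing_self
    have := congrArg (FormalSeries.coeff n) (hφ (FormalSeries.const (FormalSeries.coeff n φ)))
    rw [sesqSeries, FormalSeries.coeff_map₂_const_right (by simp), Finset.sum_eq_single (0, n)] at this
    · rw [← hh]; exact this
    · rintro ⟨i, j⟩ hij hne
      rw [Finset.HasAntidiagonal.mem_antidiagonal] at hij
      have hj : j < n := by
        rcases Nat.eq_zero_or_pos i with rfl | hi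
        · exact absurd (by simp at hij; simp [hij]) hne
        · simp at hij; omega
      rw [ih j hj]; simp
    · simp

/-- The square `T(φ)^* ⋆ T(ψ)` of a series of maps. -/
def square (S : HermitianStarProduct V M) (T : ℕ → Sections V F E →ₗ[ℂ] SmoothFun V M)
    (φ ψ : FormalSeries (Sections V F E)) : FormalSeries (SmoothFun V M) :=
  S.mul (conjSeries (FormalSeries.map₁ (T · ·) φ)) (FormalSeries.map₁ (T · ·) ψ)

theorem isFormal₂_square (S : HermitianStarProduct V M)
    (T : ℕ → Sections V F E →ₗ[ℂ] SmoothFun V M) : FormalSeries.IsFormal₂ (square S T) :=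
  ⟨fun ψ => ((isFormal₂_mul S.toStarProduct).left _).comp
      (isFormal_conjSeries.comp (isFormal_linear T)),
    fun φ => ((isFormal₂_mul S.toStarProduct).right _).comp (isFormal_linear T)⟩

/-- The coefficients of `square S T` as sesquilinear maps. -/
def squareCoeff (S : HermitianStarProduct V M) (T : ℕ → Sections V F E →ₗ[ℂ] SmoothFun V M)
    (n : ℕ) (φ ψ : Sections V F E) : SmoothFun V M :=
  ∑ x ∈ antidiagonal n, ∑ y ∈ antidiagonal x.2, S.C x.1 (star (T y.1 φ)) (T y.2 ψ)

theorem coeff_square_const (S : HermitianStarProduct V M)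
    (T : ℕ → Sections V F E →ₗ[ℂ] SmoothFun V M) (n : ℕ) (φ ψ : Sections V F E) :
    FormalSeries.coeff n (square S T (FormalSeries.const φ) (FormalSeries.const ψ)) =
      squareCoeff S T n φ ψ := by
  rw [square, StarProduct.mul, FormalSeries.coeff_map₂, squareCoeff]
  refine Finset.sum_congr rfl fun x _ => Finset.sum_congr rfl fun y _ => ?_
  rw [coeff_conjSeries, FormalSeries.coeff_map₁_const (by simp),
    FormalSeries.coeff_map₁_const (by simp)]

theorem squareCoeff_add_left (S : HermitianStarProduct V M)
    (T : ℕ → Sections V F E →ₗ[ℂ] SmoothFun V M) (n : ℕ) (φ φ' ψ : Sections V F E) :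
    squareCoeff S T n (φ + φ') ψ = squareCoeff S T n φ ψ + squareCoeff S T n φ' ψ := by
  simp [squareCoeff, star_add, Finset.sum_add_distrib]

theorem squareCoeff_add_right (S : HermitianStarProduct V M)
    (T : ℕ → Sections V F E →ₗ[ℂ] SmoothFun V M) (n : ℕ) (φ ψ ψ' : Sections V F E) :
    squareCoeff S T n φ (ψ + ψ') = squareCoeff S T n φ ψ + squareCoeff S T n φ ψ' := by
  simp [squareCoeff, Finset.sum_add_distrib]

theorem star_const_smul (c : ℂ) (f : SmoothFun V M) : star (c • f) = conj c • star f := by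
  ext x; exact map_mul conj c (f x)

theorem squareCoeff_smul_left (S : HermitianStarProduct V M)
    (T : ℕ → Sections V F E →ₗ[ℂ] SmoothFun V M) (n : ℕ) (c : ℂ) (φ ψ : Sections V F E) :
    squareCoeff S T n (c • φ) ψ = conj c • squareCoeff S T n φ ψ := by
  simp only [squareCoeff, map_smul, star_const_smul, LinearMap.smul_apply, Finset.smul_sum]

theorem squareCoeff_smul_right (S : HermitianStarProduct V M)
    (T : ℕ → Sections V F E →ₗ[ℂ] SmoothFun V M) (n : ℕ) (c : ℂ) (φ ψ : Sections V F E) :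
    squareCoeff S T n φ (c • ψ) = c • squareCoeff S T n φ ψ := by
  simp only [squareCoeff, map_smul, Finset.smul_sum]

theorem square_eq_map₂ (S : HermitianStarProduct V M)
    (T : ℕ → Sections V F E →ₗ[ℂ] SmoothFun V M) (φ ψ : FormalSeries (Sections V F E)) :
    square S T φ ψ = FormalSeries.map₂ (squareCoeff S T) φ ψ := by
  refine (isFormal₂_square S T).ext_const (FormalSeries.isFormal₂_map₂
    (fun r => squareCoeff_add_left S T r) (fun r => squareCoeff_add_right S T r)) (fun φ ψ => ?_) φ ψ
  ext1 n
  rw [coeff_square_const, FormalSeries.coeff_map₂_const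
    (fun r q => by simpa using squareCoeff_add_left S T r 0 0 q)
    (fun r q => by simpa using squareCoeff_add_right S T r q 0 0)]

theorem conjSeries_square (S : HermitianStarProduct V M)
    (T : ℕ → Sections V F E →ₗ[ℂ] SmoothFun V M) (φ ψ : FormalSeries (Sections V F E)) :
    conjSeries (square S T φ ψ) = square S T ψ φ := by
  rw [square, S.hermitian, conjSeries_conjSeries]; rfl

theorem exists_order_squareCoeff (S : HermitianStarProduct V M) (κ : ℕ → ℕ) (n : ℕ) :
    ∃ k, ∀ T : ℕ → Sections V F E →ₗ[ℂ] SmoothFun V M,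
      (∀ m, IsDiffOp (id : SmoothFun V M → SmoothFun V M) (κ m) (T m)) →
      (∀ ψ, IsDiffOp (star : SmoothFun V M → SmoothFun V M) k (fun φ => squareCoeff S T n φ ψ)) ∧
      ∀ φ, IsDiffOp (id : SmoothFun V M → SmoothFun V M) k (squareCoeff S T n φ) := by
  choose k₁ h₁ using fun r => (S.bidiff r).1
  choose k₂ h₂ using fun r => (S.bidiff r).2
  let ord (x y : ℕ × ℕ) : ℕ := max (κ y.1 + 0 + k₁ x.1) (κ y.2 + k₂ x.1)
  let tot : ℕ := (antidiagonal n).sup fun x => (antidiagonal x.2).sup (ord x)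
  have hle : ∀ x ∈ antidiagonal n, ∀ y ∈ antidiagonal x.2, ord x y ≤ tot := fun x hx y hy =>
    (Finset.le_sup (f := ord x) hy).trans
      (Finset.le_sup (f := fun x : ℕ × ℕ => (antidiagonal x.2).sup (ord x)) hx)
  refine ⟨tot, fun T hT => ⟨fun ψ => ?_, fun φ => ?_⟩⟩
  · refine IsDiffOp.sum _ fun x hx => IsDiffOp.sum _ fun y hy => ?_
    have h1 := IsDiffOp.comp (σ := id) (τ := star) isDiffOp_star star_sub (hT y.1)
    exact (IsDiffOp.comp (σ := star) (τ := id) (h₁ x.1 (T y.2 ψ)) (by simp) h1).mono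
      ((le_max_left _ _).trans (hle x hx y hy))
  · refine IsDiffOp.sum _ fun x hx => IsDiffOp.sum _ fun y hy => ?_
    exact (IsDiffOp.comp (σ := id) (τ := id) (h₂ x.1 (star (T y.1 φ))) (by simp) (hT y.2)).mono
      ((le_max_right _ _).trans (hle x hx y hy))

theorem vanishesNear_squareCoeff (S : HermitianStarProduct V M)
    {T : ℕ → Sections V F E →ₗ[ℂ] SmoothFun V M} {x : M}
    (hT : ∀ n φ, VanishesNear V x (T n φ)) (n : ℕ) (φ ψ : Sections V F E) :
    VanishesNear V x (squareCoeff S T n φ ψ) := by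
  refine VanishesNear.sum fun y _ => VanishesNear.sum fun z _ => ?_
  obtain ⟨k, hk⟩ := (S.bidiff y.1).2
  exact vanishesNear_of_isDiffOp_id (hk _) (by simp) x _ (hT _ _)

variable [FiniteDimensional ℝ V] [IsManifold 𝓘(ℝ, V) ∞ M] [T2Space M]

/-- A Parseval frame deforms `h₀` into a locally finite sum of squares of module morphisms. -/
theorem exists_sum_of_squares {S : HermitianStarProduct V M} (D : BundleDeformation F E S)
    (h₀ : HermitianFiberMetric V F E) {ι : Type*} {σ : ι → Sections V F E}
    (hlf : LocallyFinite (fun i => {x : M | ¬VanishesNear V x (σ i)}))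
    (hσ : ∀ φ, IsLocSum V M (fun i => h₀.pairing (σ i) φ • σ i) φ) :
    ∃ (T : ι → ℕ → Sections V F E →ₗ[ℂ] SmoothFun V M)
      (h : ℕ → Sections V F E →ₗ⋆[ℂ] Sections V F E →ₗ[ℂ] SmoothFun V M),
      (∀ i φ f, FormalSeries.map₁ (T i · ·) (D.act φ f) =
        S.mul (FormalSeries.map₁ (T i · ·) φ) f) ∧
      (∀ i n (x : M), VanishesNear V x (σ i) → ∀ φ, VanishesNear V x (T i n φ)) ∧
      (∀ φ ψ, h 0 φ ψ = h₀.pairing φ ψ) ∧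
      (∀ r, IsBidiffOp (star : SmoothFun V M → SmoothFun V M) (fun φ ψ => h r φ ψ)) ∧
      ∀ φ ψ, IsSeriesLocSum V M (fun i => square S (T i) φ ψ) (sesqSeries h φ ψ) := by
  obtain ⟨κ, T, hT0, hTd, hTv, hTm⟩ := exists_moduleMap D h₀ hlf hσ
  -- The maps Tᵢ vanish wherever the germ of σᵢ does, so the squares inherit local finiteness from
  -- the frame.
  have hex : ∀ n φ ψ, ∃ q, IsLocSum V M (fun i => squareCoeff S (T (σ i)) n φ ψ) q :=
    fun n φ ψ => exists_isLocSum_smoothFun _ (hlf.subset fun i x hx hv => hx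
      (vanishesNear_squareCoeff S (fun n φ => hTv (σ i) n x hv φ) n φ ψ))
  choose q hq using hex
  let h : ℕ → Sections V F E →ₗ⋆[ℂ] Sections V F E →ₗ[ℂ] SmoothFun V M := fun n =>
    LinearMap.mk₂'ₛₗ (starRingEnd ℂ) (RingHom.id ℂ) (q n)
      (fun φ φ' ψ => (hq _ _ _).unique (by
        simpa only [squareCoeff_add_left] using (hq n φ ψ).add (hq n φ' ψ)))
      (fun c φ ψ => (hq _ _ _).unique (by
        simpa only [squareCoeff_smul_left] using isLocSum_const_smul_smoothFun (hq n φ ψ) (conj c)))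
      (fun φ ψ ψ' => (hq _ _ _).unique (by
        simpa only [squareCoeff_add_right] using (hq n φ ψ).add (hq n φ ψ')))
      (fun c φ ψ => (hq _ _ _).unique (by
        simpa only [squareCoeff_smul_right, RingHom.id_apply] using isLocSum_const_smul_smoothFun (hq n φ ψ) c))
  refine ⟨fun i => T (σ i), h, fun i => hTm (σ i), fun i => hTv (σ i), fun φ ψ => ?_, fun r => ?_,
    fun φ ψ n => ?_⟩
  · refine (hq 0 φ ψ).unique ?_
    -- Pairing φ with the frame expansion of ψ gives h₀(φ, ψ) = ∑ h₀(σᵢ, ψ) h₀(φ, σᵢ), whose terms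
    -- are the classical squares.
    have := (hσ ψ).map (D := h₀.pairing φ) (h₀.pairing_sub_right φ)
      (vanishesNear_of_isDiffOp_id (h₀.isDiffOp_pairing_right φ) (h₀.pairing_zero_right φ))
    convert this using 2 with i
    simp only [squareCoeff, Finset.Nat.antidiagonal_zero, Finset.sum_singleton, S.C_zero, hT0,
      h₀.pairing_smul_right, h₀.star_pairing]
    exact mul_comm _ _
  · obtain ⟨k, hk⟩ := exists_order_squareCoeff (F := F) (E := E) S κ r
    exact ⟨⟨k, fun ψ => IsLocSum.isDiffOp (fun i => (hk (T (σ i)) (hTd _)).1 ψ)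
      fun φ => hq r φ ψ⟩, ⟨k, fun φ => IsLocSum.isDiffOp (fun i => (hk (T (σ i)) (hTd _)).2 φ)
      fun ψ => hq r φ ψ⟩⟩
  · simp only [square_eq_map₂, sesqSeries, FormalSeries.coeff_map₂]
    exact IsLocSum.finsetSum _ fun x _ => IsLocSum.finsetSum _ fun y _ => hq _ _ _

end SumOfSquares

/-! ### Nonnegative formal series -/

section NonnegSeries

theorem isNonnegSeries_zero : IsNonnegSeries 0 := ⟨0, Or.inl rfl, map_zero _⟩

theorem IsPosSeries.add {a b : ℝ⟦X⟧} (ha : IsPosSeries a) (hb : IsPosSeries b) :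
    IsPosSeries (a + b) := by
  obtain ⟨r, har, ha⟩ := ha
  obtain ⟨s, hbs, hb⟩ := hb
  rcases lt_trichotomy r s with h | rfl | h
  · exact ⟨r, fun i hi => by rw [map_add, har i hi, hbs i (hi.trans h), add_zero],
      by rwa [map_add, hbs r h, add_zero]⟩
  · exact ⟨r, fun i hi => by rw [map_add, har i hi, hbs i hi, add_zero],
      by rw [map_add]; exact add_pos ha hb⟩
  · exact ⟨s, fun i hi => by rw [map_add, hbs i hi, har i (hi.trans h), add_zero],
      by rwa [map_add, har s h, zero_add]⟩

theorem IsNonnegSeries.add {c d : ℂ⟦X⟧} (hc : IsNonnegSeries c) (hd : IsNonnegSeries d) :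
    IsNonnegSeries (c + d) := by
  obtain ⟨a, ha, rfl⟩ := hc
  obtain ⟨b, hb, rfl⟩ := hd
  refine ⟨a + b, ?_, map_add _ _ _⟩
  rcases ha with rfl | ha
  · simpa using hb
  · rcases hb with rfl | hb
    · simpa using Or.inr ha
    · exact Or.inr (ha.add hb)

theorem IsNonnegSeries.sum {ι : Type*} {s : Finset ι} {c : ι → ℂ⟦X⟧}
    (h : ∀ i ∈ s, IsNonnegSeries (c i)) : IsNonnegSeries (∑ i ∈ s, c i) :=
  Finset.sum_induction _ _ (fun _ _ => IsNonnegSeries.add) isNonnegSeries_zero h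

/-- This is how positivity over ℂ[[λ]] yields classical positivity: a coefficient below which
everything vanishes is either zero or the positive lowest one. -/
theorem IsNonnegSeries.coeff_nonneg {c : ℂ⟦X⟧} (hc : IsNonnegSeries c) {r : ℕ}
    (h : ∀ s < r, PowerSeries.coeff s c = 0) :
    ∃ t : ℝ, 0 ≤ t ∧ PowerSeries.coeff r c = t := by
  obtain ⟨a, ha, rfl⟩ := hc
  refine ⟨PowerSeries.coeff r a, ?_, by simp⟩
  rcases ha with rfl | ⟨r₀, h0, hpos⟩
  · simp
  · rcases lt_trichotomy r r₀ with hr | rfl | hr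
    · rw [h0 r hr]
    · exact hpos.le
    · have := h r₀ hr
      rw [PowerSeries.coeff_map] at this
      exact absurd (Complex.ofReal_eq_zero.mp this) hpos.ne'

/-- The nonnegative series are closed in the `λ`-adic topology. -/
theorem isNonnegSeries_of_approx {c : ℂ⟦X⟧}
    (h : ∀ r, ∃ b, IsNonnegSeries b ∧ ∀ s < r, PowerSeries.coeff s c = PowerSeries.coeff s b) :
    IsNonnegSeries c := by
  classical
  have hre : ∀ s, ((PowerSeries.coeff s c).re : ℂ) = PowerSeries.coeff s c := fun s => by
    obtain ⟨b, ⟨a, -, rfl⟩, hb⟩ := h (s + 1)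
    rw [hb s s.lt_succ_self, PowerSeries.coeff_map]
    simp
  refine ⟨PowerSeries.mk fun s => (PowerSeries.coeff s c).re, ?_, ?_⟩
  · by_cases hz : ∃ r, (PowerSeries.coeff r c).re ≠ 0
    · right
      refine ⟨Nat.find hz, fun r hr => ?_, ?_⟩
      · rw [PowerSeries.coeff_mk]; exact not_not.mp (Nat.find_min hz hr)
      · rw [PowerSeries.coeff_mk]
        -- One order beyond the lowest nonzero coefficient, so that this coefficient itself is
        -- shared with the approximant.
        obtain ⟨b, hb, hcb⟩ := h (Nat.find hz + 1)
        obtain ⟨t, ht, hbt⟩ := hb.coeff_nonneg (r := Nat.find hz) fun s hs => by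
          rw [← hcb s (hs.trans (Nat.lt_succ_self _)), ← hre, not_not.mp (Nat.find_min hz hs),
            Complex.ofReal_zero]
        have hne := Nat.find_spec hz
        rw [hcb _ (Nat.lt_succ_self _), hbt, Complex.ofReal_re] at hne ⊢
        exact lt_of_le_of_ne ht hne.symm
    · left
      push Not at hz
      ext r
      simp [hz r]
  · ext r
    rw [PowerSeries.coeff_map, PowerSeries.coeff_mk]
    exact hre r

end NonnegSeries

/-! ### Positive functionals on the undeformed algebra -/

section ClassicalPositivity

/-- Degenerate case of the Cauchy–Schwarz inequality. -/
theorem eq_zero_of_positive_of_self_eq_zero {B : Type*} [Ring B] [StarRing B] [Algebra ℂ B]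
    [StarModule ℂ B] (v : B →ₗ[ℂ] ℂ) (hv : ∀ b, ∃ t : ℝ, 0 ≤ t ∧ v (star b * b) = t) {a : B}
    (ha : v (star a * a) = 0) (b : B) : v (star a * b) = 0 := by
  -- The quadratic term of v((za + b)^*(za + b)) drops out because v(a^*a) = 0. What remains is
  -- real-affine in z and nonnegative, so its linear part vanishes; real and imaginary z separate
  -- v(a^*b) from v(b^*a).
  have key : ∀ z : ℂ, ∃ t : ℝ, 0 ≤ t ∧
      conj z * v (star a * b) + z * v (star b * a) + v (star b * b) = t := fun z => by
    obtain ⟨t, ht, h⟩ := hv (z • a + b)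
    refine ⟨t, ht, ?_⟩
    rw [← h]
    simp only [star_add, star_smul, add_mul, mul_add, smul_mul_assoc, mul_smul_comm, map_add,
      map_smul, ha, smul_eq_mul, mul_zero, zero_add]
    simp only [Complex.star_def]
    ring
  obtain ⟨c, hc, hcb⟩ := hv b
  set α := v (star a * b)
  set β := v (star b * a)
  have hre : ∀ z : ℂ, 0 ≤ (conj z * α + z * β).re + c ∧ (conj z * α + z * β).im = 0 := fun z => by
    obtain ⟨t, ht, h⟩ := key z
    rw [hcb] at h
    have h1 := congrArg Complex.re h
    have h2 := congrArg Complex.im h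
    simp only [Complex.add_re, Complex.add_im, Complex.ofReal_re, Complex.ofReal_im] at h1 h2
    constructor
    · rw [Complex.add_re, h1]; exact ht
    · rw [Complex.add_im]; linarith
  have hlin : ∀ x : ℝ, 0 ≤ x → (∀ s : ℝ, 0 ≤ -s * x + c) → x = 0 := fun x hx h => by
    by_contra hne
    have hpos : 0 < x := lt_of_le_of_ne hx (Ne.symm hne)
    have := h ((c + 1) / x)
    rw [neg_mul, div_mul_cancel₀ _ hne] at this
    linarith
  have h1 := (hre 1).2
  have h2 := (hre Complex.I).2
  simp at h1 h2
  have h3 : α.re + β.re = 0 := by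
    have h := fun s : ℝ => (hre s).1
    simp at h
    have h' : ∀ s : ℝ, 0 ≤ s * (α.re + β.re) + c := fun s => by have := h s; linarith
    rcases le_total 0 (α.re + β.re) with hx | hx
    · exact hlin _ hx fun s => h' (-s)
    · have := hlin (-(α.re + β.re)) (by linarith) fun s => by have := h' s; linarith
      linarith
  have h4 : α.im - β.im = 0 := by
    have h := fun s : ℝ => (hre (s * Complex.I)).1
    simp at h
    have h' : ∀ s : ℝ, 0 ≤ s * (α.im - β.im) + c := fun s => by have := h s; linarith
    rcases le_total 0 (α.im - β.im) with hx | hx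
    · exact hlin _ hx fun s => h' (-s)
    · have := hlin (-(α.im - β.im)) (by linarith) fun s => by have := h' s; linarith
      linarith
  apply Complex.ext
  · rw [Complex.zero_re]; linarith
  · rw [Complex.zero_im]; linarith

variable {V : Type*} [NormedAddCommGroup V] [NormedSpace ℝ V]
variable {M : Type*} [TopologicalSpace M] [ChartedSpace V M]

instance : StarModule ℂ (SmoothFun V M) := ⟨star_const_smul⟩

variable [FiniteDimensional ℝ V] [IsManifold 𝓘(ℝ, V) ∞ M] [T2Space M]

/-- Positive functionals on smooth functions have compact support: they annihilate one of the
squares of any locally finite sequence. -/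
theorem exists_apply_mul_self_eq_zero (u : SmoothFun V M →ₗ[ℂ] ℂ)
    (hu : ∀ f, ∃ t : ℝ, 0 ≤ t ∧ u (star f * f) = t) (η : ℕ → SmoothFun V M)
    (hη : ∀ m, star (η m) = η m)
    (hlf : LocallyFinite fun m => {x : M | ¬VanishesNear V x (η m)}) :
    ∃ m, u (η m * η m) = 0 := by
  classical
  by_contra! hne
  have hpos : ∀ m, ∃ t : ℝ, 0 < t ∧ u (η m * η m) = t := fun m => by
    obtain ⟨t, ht, h⟩ := hu (η m)
    rw [hη] at h
    refine ⟨t, lt_of_le_of_ne ht fun h0 => hne m ?_, h⟩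
    rw [h, ← h0, Complex.ofReal_zero]
  choose a ha hua using hpos
  -- With these weights, the m-th term of q = ∑ cₘηₘ² is worth exactly m under u. Positivity then
  -- gives u(1 + q) ≥ m for every m, which is absurd.
  let c (m : ℕ) : ℝ := m / a m
  have hc : ∀ m, 0 ≤ c m := fun m => div_nonneg (Nat.cast_nonneg m) (ha m).le
  obtain ⟨q, hq⟩ := exists_isLocSum_smoothFun (fun m => (c m : ℂ) • (η m * η m))
    (hlf.subset fun m x hx hv => hx
      ((hv.smul (η m)).smul (algebraMap ℂ (SmoothFun V M) (c m))))
  have hreal : ∀ m x, ∃ t : ℝ, η m x = t := fun m x =>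
    Complex.conj_eq_iff_real.mp (congrArg (fun g : SmoothFun V M => g x) (hη m))
  choose e he using hreal
  obtain ⟨t₀, ht₀, hut₀⟩ := hu 1
  have hle : ∀ m : ℕ, (m : ℝ) ≤ (u (1 + q)).re := fun m => by
    -- The summand 1 makes the difference strictly positive, so it is the square of a smooth real
    -- function and u is nonnegative on it.
    obtain ⟨g, hg, hgg, -⟩ := exists_sqrt (1 + q - (c m : ℂ) • (η m * η m)) fun x => by
      obtain ⟨s, hs, hs'⟩ := hq x
      have h1 := (hq.sub_sum (t := insert m s) fun i hi => hs' i fun h =>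
        hi (Finset.mem_insert_of_mem h)).eventually_smoothFun.self_of_nhds
      change q x - (∑ i ∈ insert m s, (c i : ℂ) • (η i * η i)) x = 0 at h1
      rw [sum_smoothFun_apply] at h1
      refine ⟨1 + ∑ i ∈ (insert m s).erase m, c i * (e i x * e i x), ?_, ?_⟩
      · have : 0 ≤ ∑ i ∈ (insert m s).erase m, c i * (e i x * e i x) :=
          Finset.sum_nonneg fun i _ => mul_nonneg (hc i) (mul_self_nonneg _)
        linarith
      · change 1 + q x - c m * (η m x * η m x) = _
        rw [sub_eq_zero.mp h1, ← Finset.add_sum_erase _ _ (Finset.mem_insert_self m s)]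
        change 1 + (c m * (η m x * η m x) + ∑ i ∈ (insert m s).erase m, c i * (η i x * η i x)) - _ = _
        push_cast
        simp only [he]
        ring
    obtain ⟨t, ht, hut⟩ := hu g
    rw [hg, hgg, map_sub, map_smul, hua, sub_eq_iff_eq_add] at hut
    rw [hut, smul_eq_mul, ← Complex.ofReal_mul, ← Complex.ofReal_add, Complex.ofReal_re,
      div_mul_cancel₀ _ (ha m).ne']
    linarith
  obtain ⟨m, hm⟩ := exists_nat_gt (u (1 + q)).re
  exact absurd (hle m) (not_le.mpr hm)

/-- Cutoff functions along a compact exhaustion. -/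
theorem exists_cutoffs [SigmaCompactSpace M] :
    ∃ (K : ℕ → Set M) (η : ℕ → SmoothFun V M), Monotone K ∧ (∀ m, IsCompact (K m)) ∧
      (∀ m, star (η m) = η m) ∧ (∀ m, ∀ x ∈ K m, VanishesNear V x (η m)) ∧
      (∀ m, ∀ x ∉ K (m + 1), VanishesNear V x (η m - 1)) ∧ ∀ x, ∃ m, K m ∈ nhds x := by
  have := FiniteDimensional.proper ℝ V
  have : LocallyCompactSpace M := ChartedSpace.locallyCompactSpace V M
  let K := CompactExhaustion.choice M
  have hex : ∀ m, ∃ f : C^∞⟮𝓘(ℝ, V), M; 𝓘(ℝ), ℝ⟯, (∀ᶠ x in nhdsSet (K m), f x = 0) ∧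
      (∀ᶠ x in nhdsSet (interior (K (m + 1)))ᶜ, f x = 1) ∧ ∀ x, f x ∈ Set.Icc (0 : ℝ) 1 := fun m =>
    exists_contMDiffMap_zero_one_nhds_of_isClosed 𝓘(ℝ, V) (K.isCompact m).isClosed
      isOpen_interior.isClosed_compl
      (Set.disjoint_compl_right_iff_subset.mpr (K.subset_interior_succ m))
  choose f hf0 hf1 _ using hex
  refine ⟨K, fun m => ofRealFun (f m) (f m).contMDiff, fun m n h => K.subset h, K.isCompact,
    fun m => ?_, fun m x hx => ?_, fun m x hx => ?_, K.exists_mem_nhds⟩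
  · ext x; exact Complex.conj_ofReal _
  · rw [vanishesNear_smoothFun_iff]
    filter_upwards [(eventually_nhdsSet_iff_forall.mp (hf0 m)) x hx] with y hy
    change ((f m y : ℝ) : ℂ) = 0
    rw [hy, Complex.ofReal_zero]
  · rw [vanishesNear_smoothFun_iff]
    filter_upwards [(eventually_nhdsSet_iff_forall.mp (hf1 m)) x
      fun h => hx (interior_subset h)] with y hy
    change ((f m y : ℝ) : ℂ) - 1 = 0
    rw [hy, Complex.ofReal_one, sub_self]

end ClassicalPositivity

/-! ### Positive functionals on deformed matrices and their lowest coefficients -/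

section MatrixFunctionals

variable {V : Type*} [NormedAddCommGroup V] [NormedSpace ℝ V]
variable {M : Type*} [TopologicalSpace M] [ChartedSpace V M]

theorem StarProduct.smul_mul (S : StarProduct V M) (c : ℂ⟦X⟧) (f g : FormalSeries (SmoothFun V M)) :
    S.mul (c • f) g = c • S.mul f g := by
  refine FormalSeries.map_smul_of_isFormal ((isFormal₂_mul S).left g) (fun c p n => ?_) c f
  simp only [StarProduct.mul]
  rw [FormalSeries.coeff_map₂_const_left (by simp), FormalSeries.coeff_map₂_const_left (by simp)]
  simp [Finset.smul_sum]

theorem StarProduct.mul_smul (S : StarProduct V M) (c : ℂ⟦X⟧) (f g : FormalSeries (SmoothFun V M)) :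
    S.mul f (c • g) = c • S.mul f g := by
  refine FormalSeries.map_smul_of_isFormal ((isFormal₂_mul S).right f) (fun c p n => ?_) c g
  simp only [StarProduct.mul]
  rw [FormalSeries.coeff_map₂_const_right (by simp), FormalSeries.coeff_map₂_const_right (by simp)]
  simp [Finset.smul_sum]

theorem StarProduct.coeff_zero_mul (S : StarProduct V M) (f g : FormalSeries (SmoothFun V M)) :
    FormalSeries.coeff 0 (S.mul f g) = FormalSeries.coeff 0 f * FormalSeries.coeff 0 g := by
  rw [StarProduct.mul, FormalSeries.coeff_zero_map₂, S.C_zero]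

variable (S : HermitianStarProduct V M)

namespace DeformedAlgebra

instance : IsScalarTower ℂ⟦X⟧ (DeformedAlgebra S) (DeformedAlgebra S) :=
  ⟨fun c f g => S.smul_mul c f g⟩

instance : SMulCommClass ℂ⟦X⟧ (DeformedAlgebra S) (DeformedAlgebra S) :=
  ⟨fun c f g => (S.mul_smul c f g).symm⟩

/-- The coefficient of order zero as a homomorphism onto the undeformed algebra. -/
def classicalLimit : DeformedAlgebra S →+* SmoothFun V M where
  toFun f := FormalSeries.coeff 0 f
  map_one' := rfl
  map_mul' := S.coeff_zero_mul
  map_zero' := rfl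
  map_add' _ _ := rfl

/-- A smooth function as a constant series. -/
def ofFun : SmoothFun V M →+ DeformedAlgebra S where
  toFun f := FormalSeries.const f
  map_zero' := FormalSeries.ext fun n => by cases n <;> rfl
  map_add' := FormalSeries.const_add

theorem classicalLimit_ofFun (f : SmoothFun V M) : classicalLimit S (ofFun S f) = f := rfl

theorem star_ofFun (f : SmoothFun V M) : star (ofFun S f) = ofFun S (star f) := by
  refine FormalSeries.ext fun n => ?_
  cases n with
  | zero => rfl
  | succ n => exact star_zero _

theorem ofFun_smul (c : ℂ) (f : SmoothFun V M) :
    ofFun S (c • f) = PowerSeries.C c • ofFun S f := by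
  refine Eq.trans ?_ (FormalSeries.C_smul_eq c (FormalSeries.const f)).symm
  refine FormalSeries.ext fun n => ?_
  cases n with
  | zero => rfl
  | succ n => exact (smul_zero c).symm

theorem exists_eq_X_smul {f : DeformedAlgebra S} (hf : classicalLimit S f = 0) :
    ∃ g : DeformedAlgebra S, f = (PowerSeries.X : ℂ⟦X⟧) • g := by
  refine ⟨FormalSeries.tail f, ?_⟩
  refine Eq.trans ?_ (FormalSeries.X_smul_eq (FormalSeries.tail f)).symm
  refine FormalSeries.ext fun n => ?_
  cases n with
  | zero => exact hf
  | succ n => rfl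

end DeformedAlgebra

open DeformedAlgebra

variable {n : Type*}

variable [Fintype n] [DecidableEq n]

/-- The compression of a functional on matrices by a diagonal matrix. -/
def compress (w : Matrix n n (DeformedAlgebra S) →ₗ[ℂ⟦X⟧] ℂ⟦X⟧) (f : SmoothFun V M) :
    Matrix n n (DeformedAlgebra S) →ₗ[ℂ⟦X⟧] ℂ⟦X⟧ where
  toFun Z := w (Matrix.diagonal (fun _ => ofFun S f) * Z * Matrix.diagonal fun _ => ofFun S f)
  map_add' Y Z := by rw [mul_add, add_mul, map_add]
  map_smul' c Z := by rw [mul_smul_comm, smul_mul_assoc, map_smul, RingHom.id_apply]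

theorem star_diagonal_ofFun {f : SmoothFun V M} (hf : star f = f) :
    star (Matrix.diagonal fun _ : n => ofFun S f) = Matrix.diagonal fun _ => ofFun S f := by
  rw [Matrix.star_eq_conjTranspose, Matrix.diagonal_conjTranspose]
  congr 1
  funext i
  change star (ofFun S f) = _
  rw [star_ofFun, hf]

/-- With f real and d the diagonal matrix of f, d Z^*Z d = (Zd)^*(Zd) is again a square. -/
theorem isPositiveFunctional_compress {w : Matrix n n (DeformedAlgebra S) →ₗ[ℂ⟦X⟧] ℂ⟦X⟧}
    (hw : IsPositiveFunctional w) {f : SmoothFun V M} (hf : star f = f) :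
    IsPositiveFunctional (compress S w f) := fun Z => by
  have := hw (Z * Matrix.diagonal fun _ => ofFun S f)
  rw [star_mul, star_diagonal_ofFun S hf] at this
  change IsNonnegSeries (w _)
  convert this using 2
  simp only [mul_assoc]

/-- The lowest coefficient of a functional on the deformed matrices. -/
def leadingFunctional (w : Matrix n n (DeformedAlgebra S) →ₗ[ℂ⟦X⟧] ℂ⟦X⟧) (r : ℕ) :
    Matrix n n (SmoothFun V M) →ₗ[ℂ] ℂ where
  toFun Y := PowerSeries.coeff r (w (Y.map (ofFun S)))
  map_add' Y Z := by rw [Matrix.map_add _ (map_add _), map_add, map_add]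
  map_smul' c Y := by
    have : (c • Y).map (ofFun S) = PowerSeries.C c • Y.map (ofFun S) := by
      ext1 i j; exact ofFun_smul S c (Y i j)
    rw [this, map_smul, smul_eq_mul, PowerSeries.coeff_C_mul]; rfl

variable {S}

/-- Z differs from its classical part by a multiple of λ, whose image under w has no coefficient up
to order r. Hence the lowest coefficient of w is a functional on the undeformed matrices. -/
theorem coeff_eq_leadingFunctional {w : Matrix n n (DeformedAlgebra S) →ₗ[ℂ⟦X⟧] ℂ⟦X⟧} {r : ℕ}
    (hw : ∀ Z, ∀ s < r, PowerSeries.coeff s (w Z) = 0) (Z : Matrix n n (DeformedAlgebra S)) :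
    PowerSeries.coeff r (w Z) = leadingFunctional S w r (Z.map (classicalLimit S)) := by
  have hz : ∀ i j, ∃ g : DeformedAlgebra S,
      Z i j - ofFun S (classicalLimit S (Z i j)) = (PowerSeries.X : ℂ⟦X⟧) • g := fun i j =>
    exists_eq_X_smul S (by rw [map_sub, classicalLimit_ofFun, sub_self])
  choose g hg using hz
  have key : Z = (Z.map (classicalLimit S)).map (ofFun S) + (PowerSeries.X : ℂ⟦X⟧) • Matrix.of g := by
    ext1 i j
    change Z i j = ofFun S (classicalLimit S (Z i j)) + (PowerSeries.X : ℂ⟦X⟧) • g i j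
    rw [← hg]; abel
  conv_lhs => rw [key, map_add, map_smul, map_add, smul_eq_mul]
  have h0 : PowerSeries.coeff r (PowerSeries.X * w (Matrix.of g)) = 0 := by
    cases r with
    | zero => simp
    | succ r => rw [PowerSeries.coeff_succ_X_mul, hw _ _ r.lt_succ_self]
  rw [h0, add_zero]; rfl

theorem leadingFunctional_nonneg {w : Matrix n n (DeformedAlgebra S) →ₗ[ℂ⟦X⟧] ℂ⟦X⟧} {r : ℕ}
    (hw : ∀ Z, ∀ s < r, PowerSeries.coeff s (w Z) = 0) (hpos : IsPositiveFunctional w)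
    (Y : Matrix n n (SmoothFun V M)) :
    ∃ t : ℝ, 0 ≤ t ∧ leadingFunctional S w r (star Y * Y) = t := by
  obtain ⟨t, ht, h⟩ := (hpos (Y.map (ofFun S))).coeff_nonneg (hw _)
  refine ⟨t, ht, ?_⟩
  rw [← h, coeff_eq_leadingFunctional hw, Matrix.map_mul]
  rfl

theorem diagonal_map_classicalLimit (f : SmoothFun V M) :
    (Matrix.diagonal fun _ : n => ofFun S f).map (classicalLimit S) = Matrix.diagonal fun _ => f := by
  rw [Matrix.diagonal_map (map_zero _)]; rfl

variable [FiniteDimensional ℝ V] [IsManifold 𝓘(ℝ, V) ∞ M] [T2Space M]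

/-- Positive functionals on the deformed matrices have compact support up to each order. -/
theorem exists_compress_eq_zero {w : Matrix n n (DeformedAlgebra S) →ₗ[ℂ⟦X⟧] ℂ⟦X⟧}
    (hw : IsPositiveFunctional w) {η : ℕ → SmoothFun V M} (hη : ∀ m, star (η m) = η m)
    (hlf : LocallyFinite fun m => {x : M | ¬VanishesNear V x (η m)})
    (hmul : ∀ l m, l < m → ofFun S (η l) * ofFun S (η m) = ofFun S (η m)) (r : ℕ) :
    ∃ m, ∀ Z, ∀ s < r, PowerSeries.coeff s (compress S w (η m) Z) = 0 := by
  induction r with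
  | zero => exact ⟨0, fun Z s hs => by omega⟩
  | succ r ih =>
    obtain ⟨m, hm⟩ := ih
    have hmul' : ∀ l m, l < m → ofFun S (η m) * ofFun S (η l) = ofFun S (η m) := fun l m h => by
      have := congrArg star (hmul l m h)
      rwa [star_mul, star_ofFun, star_ofFun, hη, hη] at this
    set w' := compress S w (η m) with hw'
    have hpos := leadingFunctional_nonneg hm (isPositiveFunctional_compress S hw (hη m))
    set v := leadingFunctional S w' r with hv
    -- Restricting the lowest coefficient v to scalar matrices f · 1 gives a positive functional on
    -- functions. The shifted index m + 1 + j exceeds m, as the absorption rule `hmul` requires.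
    obtain ⟨j, hj⟩ := exists_apply_mul_self_eq_zero
      (v ∘ₗ Matrix.diagonalLinearMap n ℂ (SmoothFun V M) ∘ₗ LinearMap.pi fun _ => LinearMap.id)
      (fun f => by
        obtain ⟨t, ht, h⟩ := hpos (Matrix.diagonal fun _ => f)
        refine ⟨t, ht, ?_⟩
        rw [← h, Matrix.star_eq_conjTranspose, Matrix.diagonal_conjTranspose,
          Matrix.diagonal_mul_diagonal]
        rfl)
      (fun j => η (m + 1 + j)) (fun j => hη _)
      (hlf.comp_injective (add_right_injective (m + 1)))
    refine ⟨m + 1 + j, fun Z s hs => ?_⟩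
    -- Because the later cutoff absorbs η_m on either side, compressing w by it is the same as
    -- compressing w' by it.
    have hcomp : compress S w (η (m + 1 + j)) Z = w' (Matrix.diagonal (fun _ => ofFun S (η (m + 1 + j))) *
        Z * Matrix.diagonal fun _ => ofFun S (η (m + 1 + j))) := by
      change w _ = w _
      congr 1
      have h1 := fun l m hlm => congrArg (fun f => Matrix.diagonal fun _ : n => f) (hmul l m hlm)
      have h2 := fun l m hlm => congrArg (fun f => Matrix.diagonal fun _ : n => f) (hmul' l m hlm)
      simp only [← Matrix.diagonal_mul_diagonal] at h1 h2
      conv_lhs => rw [← h1 m (m + 1 + j) (by omega)]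
      conv_lhs => enter [2]; rw [h1 m (m + 1 + j) (by omega), ← h2 m (m + 1 + j) (by omega)]
      simp only [mul_assoc]
    rw [hcomp]
    rcases Nat.lt_succ_iff_lt_or_eq.mp hs with h | rfl
    · exact hm _ _ h
    · rw [coeff_eq_leadingFunctional hm, Matrix.map_mul, Matrix.map_mul, diagonal_map_classicalLimit,
        mul_assoc]
      have hstar : star (Matrix.diagonal fun _ : n => η (m + 1 + j)) =
          Matrix.diagonal fun _ => η (m + 1 + j) := by
        rw [Matrix.star_eq_conjTranspose, Matrix.diagonal_conjTranspose]
        congr 1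
        funext i
        exact hη _
      -- Degenerate Cauchy–Schwarz upgrades the vanishing of v on one square to its vanishing on all
      -- multiples of that cutoff, which kills the coefficient of order r.
      have := eq_zero_of_positive_of_self_eq_zero v hpos
        (a := Matrix.diagonal fun _ : n => η (m + 1 + j)) (by
          rw [hstar, Matrix.diagonal_mul_diagonal]; exact hj)
      rw [hstar] at this
      exact this _

end MatrixFunctionals

/-! ### Positivity of locally finite sums of squares -/

section CompletePositivity

variable {V : Type*} [NormedAddCommGroup V] [NormedSpace ℝ V]
variable {M : Type*} [TopologicalSpace M] [ChartedSpace V M]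

/-- Rank one matrices are squares. -/
theorem exists_star_mul_self_eq {n A : Type*} [Fintype n] [DecidableEq n] [Ring A] [StarRing A]
    (a₀ : n) (c : n → A) :
    ∃ B : Matrix n n A, star B * B = Matrix.of fun a b => star (c a) * c b := by
  refine ⟨Matrix.of fun a b => if a = a₀ then c b else 0, ?_⟩
  ext a b
  rw [Matrix.mul_apply, Finset.sum_eq_single a₀]
  · simp [Matrix.star_apply]
  · intro d _ hd
    simp [hd]
  · simp

theorem vanishesNear_coeff_mul (S : StarProduct V M) {f g : FormalSeries (SmoothFun V M)} {x : M}
    (h : (∀ k, VanishesNear V x (FormalSeries.coeff k f)) ∨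
      ∀ k, VanishesNear V x (FormalSeries.coeff k g)) (n : ℕ) :
    VanishesNear V x (FormalSeries.coeff n (S.mul f g)) := by
  rw [StarProduct.mul, FormalSeries.coeff_map₂]
  refine VanishesNear.sum fun y _ => VanishesNear.sum fun z _ => ?_
  rcases h with h | h
  · obtain ⟨k, hk⟩ := (S.bidiff y.1).1
    exact vanishesNear_of_isDiffOp_id (hk _) (by simp) x _ (h _)
  · obtain ⟨k, hk⟩ := (S.bidiff y.1).2
    exact vanishesNear_of_isDiffOp_id (hk _) (by simp) x _ (h _)

theorem vanishesNear_coeff_const {f : SmoothFun V M} {x : M} (h : VanishesNear V x f) (n : ℕ) :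
    VanishesNear V x (FormalSeries.coeff n (FormalSeries.const f)) := by
  cases n with
  | zero => exact h
  | succ n => exact VanishesNear.zero x

/-- The operators of ⋆ are local in both arguments and at each point one of η − 1 and g has zero
germ, so (η − 1) ⋆ g = 0. -/
theorem const_mul_eq_self (S : StarProduct V M) {η : SmoothFun V M}
    {g : FormalSeries (SmoothFun V M)}
    (h : ∀ x : M, VanishesNear V x (η - 1) ∨ ∀ k, VanishesNear V x (FormalSeries.coeff k g)) :
    S.mul (FormalSeries.const η) g = g := by
  have key : S.mul (FormalSeries.const (η - 1)) g = 0 := by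
    ext1 n
    exact IsSeparated.eq_zero (V := V) (M := M) _ fun x =>
      vanishesNear_coeff_mul S ((h x).imp_left vanishesNear_coeff_const) n
  have hadd := ((isFormal₂_mul S).left g).add (FormalSeries.const (η - 1)) (FormalSeries.const 1)
  rw [← FormalSeries.const_add, sub_add_cancel, key, zero_add] at hadd
  exact hadd.trans (S.one_star g)

theorem mul_const_eq_self (S : StarProduct V M) {η : SmoothFun V M}
    {g : FormalSeries (SmoothFun V M)}
    (h : ∀ x : M, VanishesNear V x (η - 1) ∨ ∀ k, VanishesNear V x (FormalSeries.coeff k g)) :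
    S.mul g (FormalSeries.const η) = g := by
  have key : S.mul g (FormalSeries.const (η - 1)) = 0 := by
    ext1 n
    exact IsSeparated.eq_zero (V := V) (M := M) _ fun x =>
      vanishesNear_coeff_mul S ((h x).symm.imp_right vanishesNear_coeff_const) n
  have hadd := ((isFormal₂_mul S).right g).add (FormalSeries.const (η - 1)) (FormalSeries.const 1)
  rw [← FormalSeries.const_add, sub_add_cancel, key, zero_add] at hadd
  exact hadd.trans (S.star_one g)

variable [FiniteDimensional ℝ V] [IsManifold 𝓘(ℝ, V) ∞ M] [T2Space M]

/-- Locally finite sums of squares are positive. -/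
theorem isPositiveElement_of_isSeriesLocSum [SigmaCompactSpace M] (S : HermitianStarProduct V M)
    {n ι : Type*} [Fintype n] [DecidableEq n] {t : ι → n → FormalSeries (SmoothFun V M)}
    (hlf : LocallyFinite fun i =>
      {x : M | ¬∀ a k, VanishesNear V x (FormalSeries.coeff k (t i a))})
    (H : Matrix n n (DeformedAlgebra S))
    (hH : ∀ a b, IsSeriesLocSum V M (fun i => S.mul (conjSeries (t i a)) (t i b)) (H a b)) :
    IsPositiveElement H := by
  classical
  intro w hw
  rcases isEmpty_or_nonempty n with hn | ⟨⟨a₀⟩⟩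
  · rw [Subsingleton.elim H 0, map_zero]
    exact isNonnegSeries_zero
  obtain ⟨K, η, hKmono, hK, hη, hη0, hη1, hKex⟩ := exists_cutoffs (V := V) (M := M)
  have hlfη : LocallyFinite fun m => {x : M | ¬VanishesNear V x (η m)} := fun x => by
    obtain ⟨m, hm⟩ := hKex x
    refine ⟨K m, hm, (Set.finite_lt_nat m).subset ?_⟩
    rintro j ⟨y, hy, hyK⟩
    by_contra hj
    exact hy (hη0 j y (hKmono (not_lt.mp hj) hyK))
  have hmul : ∀ l m, l < m →
      DeformedAlgebra.ofFun S (η l) * DeformedAlgebra.ofFun S (η m) =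
        DeformedAlgebra.ofFun S (η m) := fun l m hlm =>
    const_mul_eq_self S.toStarProduct fun x => by
      by_cases hx : x ∈ K (l + 1)
      · exact Or.inr (vanishesNear_coeff_const (hη0 m x (hKmono hlm hx)))
      · exact Or.inl (hη1 l x hx)
  refine isNonnegSeries_of_approx fun r => ?_
  obtain ⟨m, hm⟩ := exists_compress_eq_zero hw hη hlfη hmul r
  -- Only finitely many squares meet K(m + 1). Their sum Q has the germ of H there, while η_m equals
  -- 1 near every point outside, so compressing by η_m does not change H − Q.
  have hfin := hlf.finite_nonempty_inter_compact (hK (m + 1))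
  choose B hB' using fun i => exists_star_mul_self_eq a₀ (A := DeformedAlgebra S) (t i)
  have hB : ∀ i a b, (star (B i) * B i) a b = S.mul (conjSeries (t i a)) (t i b) := fun i a b => by
    rw [hB' i]; rfl
  set Q := ∑ i ∈ hfin.toFinset, star (B i) * B i with hQ
  have hHQ : ∀ a b k (x : M), x ∈ K (m + 1) →
      VanishesNear V x (FormalSeries.coeff k ((H - Q) a b)) := fun a b k x hx => by
    have hsum : FormalSeries.coeff k ((H - Q) a b) = FormalSeries.coeff k (H a b) -
        ∑ i ∈ hfin.toFinset, FormalSeries.coeff k (S.mul (conjSeries (t i a)) (t i b)) := by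
      rw [Matrix.sub_apply, hQ, Matrix.sum_apply]
      simp only [hB]
      rw [← FormalSeries.coeff_sum]
      rfl
    rw [hsum]
    refine (hH a b k).sub_sum fun i hi => vanishesNear_coeff_mul _ (Or.inr fun l => ?_) k
    by_contra hne
    exact hi (hfin.mem_toFinset.mpr ⟨x, fun hall => hne (hall b l), hx⟩)
  have hcut : compress S w (η m) (H - Q) = w (H - Q) := by
    change w _ = w _
    congr 1
    ext1 a b
    rw [Matrix.mul_diagonal, Matrix.diagonal_mul]
    have hor : ∀ x : M, VanishesNear V x (η m - 1) ∨
        ∀ k, VanishesNear V x (FormalSeries.coeff k ((H - Q) a b)) := fun x => by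
      by_cases hx : x ∈ K (m + 1)
      · exact Or.inr fun k => hHQ a b k x hx
      · exact Or.inl (hη1 m x hx)
    have h1 : DeformedAlgebra.ofFun S (η m) * (H - Q) a b = (H - Q) a b :=
      const_mul_eq_self S.toStarProduct hor
    rw [h1]
    exact mul_const_eq_self S.toStarProduct hor
  -- Thus w(H) and w(Q) agree below order r, and Q is a finite sum of squares.
  refine ⟨w Q, ?_, fun s hs => ?_⟩
  · rw [hQ, map_sum]
    exact IsNonnegSeries.sum fun i _ => hw (B i)
  · have := hm (H - Q) s hs
    rwa [hcut, map_sub, map_sub, sub_eq_zero] at this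

end CompletePositivity

/-! ### Existence of the deformed metric -/

section Existence

variable {V : Type*} [NormedAddCommGroup V] [NormedSpace ℝ V] [FiniteDimensional ℝ V]
variable {M : Type*} [TopologicalSpace M] [ChartedSpace V M] [IsManifold 𝓘(ℝ, V) ∞ M]
  [T2Space M] [SigmaCompactSpace M]
variable {F : Type*} [NormedAddCommGroup F] [NormedSpace ℂ F] [FiniteDimensional ℂ F]
variable {E : M → Type*} [TopologicalSpace (TotalSpace F E)] [∀ x, TopologicalSpace (E x)]
  [FiberBundle F E] [∀ x, AddCommGroup (E x)] [∀ x, Module ℂ (E x)] [VectorBundle ℂ F E]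
  [ContMDiffVectorBundle ∞ F E 𝓘(ℝ, V)]

omit [FiniteDimensional ℝ V] [IsManifold 𝓘(ℝ, V) ∞ M] [T2Space M] [SigmaCompactSpace M]
  [FiniteDimensional ℂ F] [ContMDiffVectorBundle ∞ F E 𝓘(ℝ, V)] in
theorem sesqSeries_smul_right (h : ℕ → Sections V F E →ₗ⋆[ℂ] Sections V F E →ₗ[ℂ] SmoothFun V M)
    (c : ℂ⟦X⟧) (φ ψ : FormalSeries (Sections V F E)) :
    sesqSeries h φ (c • ψ) = c • sesqSeries h φ ψ := by
  refine FormalSeries.map_smul_of_isFormal ((isFormal₂_sesqSeries h).right φ) (fun c p n => ?_) c ψ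
  simp only [sesqSeries]
  rw [FormalSeries.coeff_map₂_const_right (by simp), FormalSeries.coeff_map₂_const_right (by simp)]
  simp [Finset.smul_sum]

/-- Each algebraic axiom holds for every square Tᵢ(φ)^* ⋆ Tᵢ(ψ) separately and passes to the sum
because locally finite sums are unique; nondegeneracy comes from order zero. -/
theorem nonempty_metricDeformation {S : HermitianStarProduct V M} (D : BundleDeformation F E S)
    (h₀ : HermitianFiberMetric V F E) : Nonempty (MetricDeformation D h₀) := by
  obtain ⟨σ, hlf, hσ⟩ := h₀.exists_parseval_frame
  obtain ⟨T, h, hTm, hTv, hh0, hhd, hsum⟩ := exists_sum_of_squares D h₀ hlf hσ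
  have hsymm : ∀ φ ψ, sesqSeries h φ ψ = conjSeries (sesqSeries h ψ φ) := fun φ ψ =>
    (hsum φ ψ).unique (by simpa only [conjSeries_square] using (hsum ψ φ).conj)
  have hact : ∀ φ ψ f, sesqSeries h φ (D.act ψ f) = S.mul (sesqSeries h φ ψ) f := fun φ ψ f => by
    refine (hsum φ (D.act ψ f)).unique ?_
    have e : ∀ i, square S (T i) φ (D.act ψ f) = S.mul (square S (T i) φ ψ) f := fun i => by
      rw [square, hTm]; exact (S.assoc _ _ _).symm
    simpa only [e] using (hsum φ ψ).mul_right S.toStarProduct f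
  have hvan : ∀ i (x : M), VanishesNear V x (σ i) → ∀ (φ : FormalSeries (Sections V F E)) k,
      VanishesNear V x (FormalSeries.coeff k (FormalSeries.map₁ (T i · ·) φ)) :=
    fun i x hv φ k => by
      rw [FormalSeries.coeff_map₁]
      exact VanishesNear.sum fun y _ => hTv i _ x hv _
  exact ⟨⟨h, hh0, hhd, ⟨fun φ ψ χ => ((isFormal₂_sesqSeries h).right φ).add ψ χ,
    fun c φ ψ => sesqSeries_smul_right h c φ ψ, hsymm, hact, sesqSeries_nondegenerate hh0,
    fun n φ => isPositiveElement_of_isSeriesLocSum S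
      (t := fun i a => FormalSeries.map₁ (T i · ·) (φ a))
      (hlf.subset fun i x hx hv => hx fun a => hvan i x hv (φ a)) _
      fun a b => hsum (φ a) (φ b)⟩⟩⟩

end Existence

/-! ### Composition and square roots of series of operators -/

section FormalCalculus

open FormalSeries

theorem eq_zero_of_add_self {Q : Type*} [AddCommGroup Q] [Module ℂ Q] {q : Q} (h : q + q = 0) :
    q = 0 := by
  rw [← two_smul ℂ q] at h
  exact (smul_eq_zero.mp h).resolve_left two_ne_zero

theorem coeff_zero_mul_of_vanish {V : Type*} [NormedAddCommGroup V] [NormedSpace ℝ V]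
    {M : Type*} [TopologicalSpace M] [ChartedSpace V M] (S : StarProduct V M) (f : SmoothFun V M)
    {g : FormalSeries (SmoothFun V M)} {n : ℕ} (hg : ∀ m < n, coeff m g = 0) :
    coeff n (S.mul (const f) g) = f * coeff n g := by
  rw [StarProduct.mul, coeff_map₂_const_left (by simp), Finset.sum_eq_single (0, n)]
  · exact S.C_zero _ _
  · rintro ⟨i, j⟩ hij hne
    rw [Finset.HasAntidiagonal.mem_antidiagonal] at hij
    have hj : j < n := by
      rcases Nat.eq_zero_or_pos i with rfl | hi
      · exact absurd (by simp at hij; simp [hij]) hne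
      · simp at hij; omega
    rw [hg j hj]; simp
  · simp

variable {A : Type*} [CommRing A] {P Q N : Type*} [AddCommGroup P] [Module A P] [AddCommGroup Q]
  [Module A Q] [AddCommGroup N] [Module A N] [Module ℂ P]

/-- The coefficient of `λ^n` in the composition of two series of operators. -/
def compTerm (n : ℕ) (U T : ℕ → P →ₗ[ℂ] P) : P →ₗ[ℂ] P :=
  ∑ x ∈ antidiagonal n, U x.1 ∘ₗ T x.2

theorem compTerm_apply (n : ℕ) (U T : ℕ → P →ₗ[ℂ] P) (p : P) :
    compTerm n U T p = ∑ x ∈ antidiagonal n, U x.1 (T x.2 p) := by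
  simp [compTerm, LinearMap.sum_apply]

theorem map₁_map₁ {U T W : ℕ → P →ₗ[ℂ] P} (h : ∀ n, compTerm n U T = W n) (p : FormalSeries P) :
    map₁ (U · ·) (map₁ (T · ·) p) = map₁ (W · ·) p := by
  refine IsFormal.ext_const ((isFormal_linear U).comp (isFormal_linear T)) (isFormal_linear W)
    (fun p => ?_) p
  ext1 n
  rw [coeff_map₁_const (by simp), ← h, compTerm_apply, coeff_map₁]
  exact Finset.sum_congr rfl fun x _ => by rw [coeff_map₁_const (by simp)]

theorem exists_isDiffOp_sum_comp {s : Finset (ℕ × ℕ)} {U T : ℕ → P →ₗ[ℂ] P}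
    (hU : ∀ x ∈ s, ∃ k, IsDiffOp (id : A → A) k (U x.1))
    (hT : ∀ x ∈ s, ∃ k, IsDiffOp (id : A → A) k (T x.2)) :
    ∃ k, IsDiffOp (id : A → A) k (fun p => ∑ x ∈ s, U x.1 (T x.2 p)) := by
  choose! k hk using hU
  choose! l hl using hT
  exact ⟨s.sup fun x => l x + k x, IsDiffOp.sum s fun x hx =>
    (IsDiffOp.comp (σ := id) (τ := id) (hk x hx) (by simp) (hl x hx)).mono
      (Finset.le_sup (f := fun x => l x + k x) hx)⟩

theorem update_eq_add_single {Q : Type*} [AddCommGroup Q] {n : ℕ} {T : ℕ → Q} (hT : T n = 0) (t : Q) :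
    Function.update T n t = T + Pi.single n t := by
  funext m
  by_cases hm : m = n
  · subst hm; simp [hT]
  · rw [Function.update_of_ne hm, Pi.add_apply, Pi.single_eq_of_ne hm, add_zero]

/-- At order n the new term t meets only the identity, once on each side; t ∘ t first appears at
order 2n > n. -/
theorem compTerm_update {n : ℕ} (hn : n ≠ 0) {T : ℕ → P →ₗ[ℂ] P} (hT0 : T 0 = LinearMap.id)
    (hT : T n = 0) (t : P →ₗ[ℂ] P) :
    compTerm n (Function.update T n t) (Function.update T n t) = compTerm n T T + (t + t) := by
  rw [update_eq_add_single hT]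
  have h1 : ∑ x ∈ antidiagonal n, T x.1 ∘ₗ (Pi.single n t : ℕ → P →ₗ[ℂ] P) x.2 = t := by
    rw [Finset.sum_eq_single (0, n)]
    · simp [hT0]
    · rintro ⟨i, j⟩ hij hne
      rw [Finset.HasAntidiagonal.mem_antidiagonal] at hij
      have hj : j ≠ n := by rintro rfl; apply hne; simp at hij; simp [hij]
      simp [Pi.single_eq_of_ne hj]
    · simp
  have h2 : ∑ x ∈ antidiagonal n, (Pi.single n t : ℕ → P →ₗ[ℂ] P) x.1 ∘ₗ T x.2 = t := by
    rw [Finset.sum_eq_single (n, 0)]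
    · simp [hT0]
    · rintro ⟨i, j⟩ hij hne
      rw [Finset.HasAntidiagonal.mem_antidiagonal] at hij
      have hi : i ≠ n := by rintro rfl; apply hne; simp at hij; simp [hij]
      simp [Pi.single_eq_of_ne hi]
    · simp
  have h3 : ∑ x ∈ antidiagonal n, (Pi.single n t : ℕ → P →ₗ[ℂ] P) x.1 ∘ₗ
      (Pi.single n t : ℕ → P →ₗ[ℂ] P) x.2 = 0 := by
    refine Finset.sum_eq_zero fun x hx => ?_
    rw [Finset.HasAntidiagonal.mem_antidiagonal] at hx
    rcases ne_or_eq x.1 n with h | h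
    · simp [Pi.single_eq_of_ne h]
    · have h : x.2 ≠ n := by omega
      simp [Pi.single_eq_of_ne h]
  simp only [compTerm, Pi.add_apply, LinearMap.add_comp, LinearMap.comp_add, Finset.sum_add_distrib]
  rw [h1, h2, h3]
  abel

/-- Square roots of series of differential operators starting with the identity. -/
theorem exists_compTerm_sqrt {W : ℕ → P →ₗ[ℂ] P} (hW0 : W 0 = LinearMap.id)
    (hsmul : ∀ (c : ℂ) (T : P →ₗ[ℂ] P), (∃ k, IsDiffOp (id : A → A) k T) →
      ∃ k, IsDiffOp (id : A → A) k (c • T))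
    (hW : ∀ n, ∃ k, IsDiffOp (id : A → A) k (W n)) :
    ∃ U : ℕ → P →ₗ[ℂ] P, U 0 = LinearMap.id ∧ (∀ n, ∃ k, IsDiffOp (id : A → A) k (U n)) ∧
      ∀ n, compTerm n U U = W n := by
  obtain ⟨U, hU⟩ := exists_seq_of_step (α := P →ₗ[ℂ] P)
    (fun n U => U 0 = LinearMap.id ∧ (∃ k, IsDiffOp (id : A → A) k (U n)) ∧ compTerm n U U = W n)
    (fun n T T' h ⟨h1, h2, h3⟩ => ⟨(h 0 n.zero_le) ▸ h1, (h n le_rfl) ▸ h2, by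
      rw [← h3]
      exact Finset.sum_congr rfl fun x hx => by
        rw [h x.1 (Finset.HasAntidiagonal.antidiagonal.fst_le hx),
          h x.2 (Finset.HasAntidiagonal.antidiagonal.snd_le hx)]⟩)
    (fun n T hT => by
      rcases Nat.eq_zero_or_pos n with rfl | hn
      · refine ⟨LinearMap.id, Function.update_self .., ⟨0, ?_⟩, ?_⟩
        · rw [Function.update_self]; exact fun a p => rfl
        · simp [compTerm, hW0]
      · set T₀ := Function.update T n 0 with hT₀
        have hid : T₀ 0 = LinearMap.id := by
          rw [hT₀, Function.update_of_ne hn.ne]; exact (hT 0 hn).1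
        have hord : ∀ m ≤ n, ∃ k, IsDiffOp (id : A → A) k (T₀ m) := fun m hm => by
          rcases hm.lt_or_eq with h | rfl
          · rw [hT₀, Function.update_of_ne h.ne]; exact (hT m h).2.1
          · rw [hT₀, Function.update_self]; exact ⟨0, IsDiffOp.zero _ _⟩
        have hupd : ∀ t, Function.update T n t = Function.update T₀ n t := fun t => by simp [hT₀]
        -- The solution t of `compTerm n T₀ T₀` + 2t = Wₙ.
        refine ⟨(2⁻¹ : ℂ) • (W n - compTerm n T₀ T₀), ?_, ?_, ?_⟩
        · rw [Function.update_of_ne hn.ne]; exact (hT 0 hn).1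
        · rw [Function.update_self]
          refine hsmul _ _ ?_
          obtain ⟨k, hk⟩ := hW n
          obtain ⟨l, hl⟩ := exists_isDiffOp_sum_comp (A := A) (s := antidiagonal n) (U := T₀) (T := T₀)
            (fun x hx => hord _ (Finset.HasAntidiagonal.antidiagonal.fst_le hx))
            (fun x hx => hord _ (Finset.HasAntidiagonal.antidiagonal.snd_le hx))
          refine ⟨max k l, ?_⟩
          have := (hk.mono (le_max_left k l)).sub (hl.mono (le_max_right k l))
          simp only [← compTerm_apply] at this
          exact this
        · rw [hupd, compTerm_update hn.ne' hid (by simp [hT₀]), ← add_smul]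
          norm_num)
  exact ⟨U, (hU 0).1, fun n => (hU n).2.1, fun n => (hU n).2.2⟩

end FormalCalculus

/-! ### Riesz representation by means of the frame -/

section Riesz

variable {V : Type*} [NormedAddCommGroup V] [NormedSpace ℝ V] [FiniteDimensional ℝ V]
variable {M : Type*} [TopologicalSpace M] [ChartedSpace V M] [IsManifold 𝓘(ℝ, V) ∞ M]
  [T2Space M]
variable {F : Type*} [NormedAddCommGroup F] [NormedSpace ℂ F]
variable {E : M → Type*} [TopologicalSpace (TotalSpace F E)] [∀ x, TopologicalSpace (E x)]
  [FiberBundle F E] [∀ x, AddCommGroup (E x)] [∀ x, Module ℂ (E x)] [VectorBundle ℂ F E]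

/-- Sesquilinear operators that are tensorial in the first argument are represented by the fiber
metric. -/
theorem exists_riesz (h : HermitianFiberMetric V F E) {ι : Type*} {σ : ι → Sections V F E}
    (hlf : LocallyFinite (fun i => {x : M | ¬VanishesNear V x (σ i)}))
    (hσ : ∀ φ, IsLocSum V M (fun i => h.pairing (σ i) φ • σ i) φ)
    (d : Sections V F E →ₗ⋆[ℂ] Sections V F E →ₗ[ℂ] SmoothFun V M)
    (hd : ∀ f φ ψ, d (f • φ) ψ = star f * d φ ψ) {k : ℕ}
    (hk : ∀ φ, IsDiffOp (id : SmoothFun V M → SmoothFun V M) k (d φ)) :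
    ∃ t : Sections V F E →ₗ[ℂ] Sections V F E,
      IsDiffOp (id : SmoothFun V M → SmoothFun V M) k t ∧
      ∀ φ ψ, d φ ψ = h.pairing φ (t ψ) := by
  -- The representing operator is t(ψ) = ∑ d(σᵢ, ψ) σᵢ: by antilinearity over functions, h(φ, tψ) =
  -- ∑ d(σᵢ, ψ) h(φ, σᵢ) is d applied to the frame expansion of φ.
  have hex : ∀ ψ, ∃ q, IsLocSum V M (fun i => d (σ i) ψ • σ i) q := fun ψ =>
    exists_isLocSum_section _ (hlf.subset fun i x hx hv => hx (hv.smul _))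
  choose t ht using hex
  refine ⟨⟨⟨t, fun ψ ψ' => ?_⟩, fun c ψ => ?_⟩, ?_, fun φ ψ => ?_⟩
  · refine (ht _).unique ?_
    simpa only [map_add, add_smul] using (ht ψ).add (ht ψ')
  · refine (ht _).unique ?_
    have := (ht ψ).smul (algebraMap ℂ (SmoothFun V M) c)
    simp only [← mul_smul] at this
    simp only [map_smul, RingHom.id_apply]
    exact this
  · rw [← add_zero k]
    exact IsLocSum.isDiffOp (fun i => IsDiffOp.comp (σ := id) (τ := id)
      (D' := fun g : SmoothFun V M => g • σ i) (fun a g => mul_smul a g (σ i))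
      (fun f g => sub_smul f g (σ i)) (hk (σ i))) ht
  · have h1 := (hσ φ).map (D := fun φ => d φ ψ) (fun x y => by simp)
      (vanishesNear_of_isDiffOp_star (k := 0) (fun a p => hd a p ψ) (by simp))
    have h2 := (ht ψ).map (D := h.pairing φ) (h.pairing_sub_right φ)
      (vanishesNear_of_isDiffOp_id (h.isDiffOp_pairing_right φ) (h.pairing_zero_right φ))
    refine h1.unique ?_
    change IsLocSum V M _ (h.pairing φ (t ψ))
    convert h2 using 2 with i
    rw [hd, h.star_pairing, h.pairing_smul_right, mul_comm]

end Riesz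

/-! ### Uniqueness up to isometry -/

section Uniqueness

variable {V : Type*} [NormedAddCommGroup V] [NormedSpace ℝ V]
variable {M : Type*} [TopologicalSpace M] [ChartedSpace V M]
variable {F : Type*} [NormedAddCommGroup F] [NormedSpace ℂ F]
variable {E : M → Type*} [TopologicalSpace (TotalSpace F E)] [∀ x, TopologicalSpace (E x)]
  [FiberBundle F E] [∀ x, AddCommGroup (E x)] [∀ x, Module ℂ (E x)] [VectorBundle ℂ F E]

open FormalSeries

/-- The coefficient of `λ^n` in `h(φ, T(ψ))`. -/
def metricMap (h : ℕ → Sections V F E →ₗ⋆[ℂ] Sections V F E →ₗ[ℂ] SmoothFun V M) (n : ℕ)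
    (T : ℕ → Sections V F E →ₗ[ℂ] Sections V F E) :
    Sections V F E →ₗ⋆[ℂ] Sections V F E →ₗ[ℂ] SmoothFun V M :=
  ∑ x ∈ antidiagonal n, (h x.1).compl₂ (T x.2)

theorem metricMap_apply (h : ℕ → Sections V F E →ₗ⋆[ℂ] Sections V F E →ₗ[ℂ] SmoothFun V M) (n : ℕ)
    (T : ℕ → Sections V F E →ₗ[ℂ] Sections V F E) (φ ψ : Sections V F E) :
    metricMap h n T φ ψ = ∑ x ∈ antidiagonal n, h x.1 φ (T x.2 ψ) := by
  simp [metricMap, LinearMap.sum_apply]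

theorem metricMap_congr {h : ℕ → Sections V F E →ₗ⋆[ℂ] Sections V F E →ₗ[ℂ] SmoothFun V M} {n : ℕ}
    {T T' : ℕ → Sections V F E →ₗ[ℂ] Sections V F E} (hT : ∀ m ≤ n, T m = T' m) :
    metricMap h n T = metricMap h n T' :=
  Finset.sum_congr rfl fun x hx => by
    rw [hT x.2 (Finset.HasAntidiagonal.antidiagonal.snd_le hx)]

theorem metricMap_update {h : ℕ → Sections V F E →ₗ⋆[ℂ] Sections V F E →ₗ[ℂ] SmoothFun V M} {n : ℕ}
    {T : ℕ → Sections V F E →ₗ[ℂ] Sections V F E} (hT : T n = 0)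
    (t : Sections V F E →ₗ[ℂ] Sections V F E) (φ ψ : Sections V F E) :
    metricMap h n (Function.update T n t) φ ψ = metricMap h n T φ ψ + h 0 φ (t ψ) := by
  rw [metricMap_apply, metricMap_apply, update_eq_add_single hT]
  simp only [Pi.add_apply, LinearMap.add_apply, map_add, Finset.sum_add_distrib]
  congr 1
  rw [Finset.sum_eq_single (0, n)]
  · simp
  · rintro ⟨i, j⟩ hij hne
    rw [Finset.HasAntidiagonal.mem_antidiagonal] at hij
    have hj : j ≠ n := by rintro rfl; apply hne; simp at hij; simp [hij]
    simp [Pi.single_eq_of_ne hj]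
  · simp

theorem isFormal₂_sesqSeries_map
    (h : ℕ → Sections V F E →ₗ⋆[ℂ] Sections V F E →ₗ[ℂ] SmoothFun V M)
    (T : ℕ → Sections V F E →ₗ[ℂ] Sections V F E) :
    IsFormal₂ fun φ ψ => sesqSeries h φ (map₁ (T · ·) ψ) :=
  ⟨fun _ => (isFormal₂_sesqSeries h).left _,
    fun φ => ((isFormal₂_sesqSeries h).right φ).comp (isFormal_linear T)⟩

theorem coeff_sesqSeries_map (h : ℕ → Sections V F E →ₗ⋆[ℂ] Sections V F E →ₗ[ℂ] SmoothFun V M)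
    (T : ℕ → Sections V F E →ₗ[ℂ] Sections V F E) (n : ℕ) (φ ψ : Sections V F E) :
    coeff n (sesqSeries h (const φ) (map₁ (T · ·) (const ψ))) = metricMap h n T φ ψ := by
  rw [metricMap_apply, sesqSeries, coeff_map₂_const_left (by simp)]
  exact Finset.sum_congr rfl fun x _ => by rw [coeff_map₁_const (by simp)]

theorem coeff_sesqSeries_const (h : ℕ → Sections V F E →ₗ⋆[ℂ] Sections V F E →ₗ[ℂ] SmoothFun V M)
    (n : ℕ) (φ ψ : Sections V F E) :
    coeff n (sesqSeries h (const φ) (const ψ)) = h n φ ψ :=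
  coeff_map₂_const (by simp) (by simp) n φ ψ

theorem conjSeries_const (f : SmoothFun V M) : conjSeries (const f) = const (star f) := by
  ext1 n
  cases n with
  | zero => rfl
  | succ n => exact star_zero _

/-- The first difference between two deformed metrics is tensorial in the first argument. -/
theorem sub_metricMap_smul_left {S : HermitianStarProduct V M} {D : BundleDeformation F E S}
    {h h' : ℕ → Sections V F E →ₗ⋆[ℂ] Sections V F E →ₗ[ℂ] SmoothFun V M}
    (hact : ∀ φ ψ f, sesqSeries h (D.act φ f) ψ = S.mul (conjSeries f) (sesqSeries h φ ψ))
    (hact' : ∀ φ ψ f, sesqSeries h' (D.act φ f) ψ = S.mul (conjSeries f) (sesqSeries h' φ ψ))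
    {n : ℕ} {T : ℕ → Sections V F E →ₗ[ℂ] Sections V F E}
    (hT : ∀ m < n, metricMap h' m T = h m) (f : SmoothFun V M) (φ ψ : Sections V F E) :
    (h n - metricMap h' n T) (f • φ) ψ = star f * (h n - metricMap h' n T) φ ψ := by
  set d := fun φ ψ => sesqSeries h φ ψ - sesqSeries h' φ (map₁ (T · ·) ψ) with hd_def
  have hd : IsFormal₂ d := (isFormal₂_sesqSeries h).sub (isFormal₂_sesqSeries_map h' T)
  have hcoeff : ∀ m φ ψ, coeff m (d (const φ) (const ψ)) = (h m - metricMap h' m T) φ ψ :=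
    fun m φ ψ => by
      rw [hd_def, coeff_sub, coeff_sesqSeries_const, coeff_sesqSeries_map]; rfl
  have hlt : ∀ φ ψ, ∀ m < n, coeff m (d (const φ) (const ψ)) = 0 := fun φ ψ m hm => by
    rw [hcoeff, hT m hm]; exact sub_self (h m φ ψ)
  -- The left module law holds for both metrics and hence for d. As d starts at order n, the
  -- deformed products in this law reduce to pointwise ones in the coefficient of λⁿ.
  have hmul : d (D.act (const φ) (const f)) (const ψ) =
      S.mul (const (star f)) (d (const φ) (const ψ)) := by
    rw [hd_def]
    simp only
    rw [hact, hact', conjSeries_const]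
    have := ((isFormal₂_mul S.toStarProduct).right (const (star f))).add
      (sesqSeries h (const φ) (const ψ) - sesqSeries h' (const φ) (map₁ (T · ·) (const ψ)))
      (sesqSeries h' (const φ) (map₁ (T · ·) (const ψ)))
    rw [sub_add_cancel] at this
    rw [this, add_sub_cancel_right]
  have h1 := congrArg (coeff n) hmul
  rw [hd.leading hlt, coeff_zero_mul_of_vanish _ _ (hlt φ ψ), hcoeff, hcoeff, BundleDeformation.act,
    coeff_zero_map₂, coeff_const_zero, coeff_const_zero, coeff_const_zero, D.R_zero] at h1
  exact h1

theorem exists_order_metricMap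
    {h : ℕ → Sections V F E →ₗ⋆[ℂ] Sections V F E →ₗ[ℂ] SmoothFun V M}
    (hh : ∀ r, ∃ l, ∀ φ, IsDiffOp (id : SmoothFun V M → SmoothFun V M) l (h r φ))
    {n : ℕ} {T : ℕ → Sections V F E →ₗ[ℂ] Sections V F E}
    (hT : ∀ m ≤ n, ∃ k, IsDiffOp (id : SmoothFun V M → SmoothFun V M) k (T m)) :
    ∃ k, ∀ φ, IsDiffOp (id : SmoothFun V M → SmoothFun V M) k (metricMap h n T φ) := by
  choose l hl using hh
  choose! k hk using hT
  refine ⟨(antidiagonal n).sup fun x => k x.2 + l x.1, fun φ => ?_⟩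
  rw [show ⇑(metricMap h n T φ) = fun ψ => ∑ x ∈ antidiagonal n, h x.1 φ (T x.2 ψ) from
    funext fun ψ => metricMap_apply h n T φ ψ]
  exact IsDiffOp.sum _ fun x hx => (IsDiffOp.comp (σ := id) (τ := id) (hl x.1 φ) (by simp)
    (hk x.2 (Finset.HasAntidiagonal.antidiagonal.snd_le hx))).mono
      (Finset.le_sup (f := fun x : ℕ × ℕ => k x.2 + l x.1) hx)

/-- If the square of a unipotent series is self-adjoint, so is the series. -/
theorem selfAdjoint_of_compTerm_self
    {h : ℕ → Sections V F E →ₗ⋆[ℂ] Sections V F E →ₗ[ℂ] SmoothFun V M}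
    {U W : ℕ → Sections V F E →ₗ[ℂ] Sections V F E} (hU0 : U 0 = LinearMap.id)
    (hU : ∀ n, compTerm n U U = W n)
    (hW : ∀ φ ψ, sesqSeries h (map₁ (W · ·) φ) ψ = sesqSeries h φ (map₁ (W · ·) ψ))
    (φ ψ : FormalSeries (Sections V F E)) :
    sesqSeries h (map₁ (U · ·) φ) ψ = sesqSeries h φ (map₁ (U · ·) ψ) := by
  set s := fun φ ψ => sesqSeries h (map₁ (U · ·) φ) ψ - sesqSeries h φ (map₁ (U · ·) ψ) with hs_def
  have hs : IsFormal₂ s := IsFormal₂.sub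
    ⟨fun ψ => ((isFormal₂_sesqSeries h).left ψ).comp (isFormal_linear U),
      fun _ => (isFormal₂_sesqSeries h).right _⟩ (isFormal₂_sesqSeries_map h U)
  -- The mixed terms h(Uφ, Uψ) cancel, leaving the defect of self-adjointness of U² = W, which is
  -- zero. Since U = id + O(λ), the lowest coefficient of s is its own negative.
  have hadd : ∀ φ ψ, s (map₁ (U · ·) φ) ψ + s φ (map₁ (U · ·) ψ) = 0 := fun φ ψ => by
    simp only [hs_def]
    rw [map₁_map₁ hU, map₁_map₁ hU, hW]
    abel
  have hzero : ∀ φ, coeff 0 (map₁ (U · ·) φ) = coeff 0 φ := fun φ => by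
    rw [coeff_zero_map₁, hU0]; rfl
  have hvan : ∀ n φ ψ, coeff n (s φ ψ) = 0 := by
    intro n
    induction n using Nat.strong_induction_on with
    | _ n ih =>
      intro φ ψ
      have hlt : ∀ φ ψ, ∀ m < n, coeff m (s (const φ) (const ψ)) = 0 := fun φ ψ m hm => ih m hm _ _
      have h1 := congrArg (coeff n) (hadd φ ψ)
      rw [coeff_add, hs.leading hlt, hs.leading hlt φ, hzero, hzero] at h1
      rw [hs.leading hlt]
      exact eq_zero_of_add_self h1
  rw [← sub_eq_zero]
  ext1 n
  exact hvan n φ ψ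

namespace MetricDeformation

variable {S : HermitianStarProduct V M} {D : BundleDeformation F E S}
  {h₀ : HermitianFiberMetric V F E} (H : MetricDeformation D h₀)

theorem sesqSeries_symm (φ ψ : FormalSeries (Sections V F E)) :
    sesqSeries H.h φ ψ = conjSeries (sesqSeries H.h ψ φ) :=
  H.inner.star_symm φ ψ

theorem sesqSeries_act_right (φ ψ : FormalSeries (Sections V F E))
    (f : FormalSeries (SmoothFun V M)) :
    sesqSeries H.h φ (D.act ψ f) = S.mul (sesqSeries H.h φ ψ) f :=
  H.inner.act_right φ ψ f

theorem sesqSeries_act_left (φ ψ : FormalSeries (Sections V F E))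
    (f : FormalSeries (SmoothFun V M)) :
    sesqSeries H.h (D.act φ f) ψ = S.mul (conjSeries f) (sesqSeries H.h φ ψ) := by
  rw [H.sesqSeries_symm, H.sesqSeries_act_right, S.hermitian, ← H.sesqSeries_symm]

variable [FiniteDimensional ℝ V] [IsManifold 𝓘(ℝ, V) ∞ M] [T2Space M]

/-- Any two deformations of a fiber metric differ by a series of differential operators. -/
theorem exists_metricMap_eq {ι : Type*} {σ : ι → Sections V F E}
    (hlf : LocallyFinite (fun i => {x : M | ¬VanishesNear V x (σ i)}))
    (hσ : ∀ φ, IsLocSum V M (fun i => h₀.pairing (σ i) φ • σ i) φ) (H' : MetricDeformation D h₀) :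
    ∃ W : ℕ → Sections V F E →ₗ[ℂ] Sections V F E, W 0 = LinearMap.id ∧
      (∀ n, ∃ k, IsDiffOp (id : SmoothFun V M → SmoothFun V M) k (W n)) ∧
      ∀ n, metricMap H'.h n W = H.h n := by
  obtain ⟨W, hW⟩ := exists_seq_of_step (α := Sections V F E →ₗ[ℂ] Sections V F E)
    (fun n W => W 0 = LinearMap.id ∧
      (∃ k, IsDiffOp (id : SmoothFun V M → SmoothFun V M) k (W n)) ∧ metricMap H'.h n W = H.h n)
    (fun n T T' h ⟨h1, h2, h3⟩ => ⟨(h 0 n.zero_le) ▸ h1, (h n le_rfl) ▸ h2,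
      (metricMap_congr h).symm.trans h3⟩)
    (fun n T hT => by
      rcases Nat.eq_zero_or_pos n with rfl | hn
      · refine ⟨LinearMap.id, Function.update_self .., ⟨0, ?_⟩, ?_⟩
        · rw [Function.update_self]; exact fun a p => rfl
        · ext1 φ; ext1 ψ
          rw [metricMap_apply]
          simp [H.h_zero, H'.h_zero]
      · set T₀ := Function.update T n 0 with hT₀
        have hagree : ∀ m < n, T m = T₀ m := fun m hm => by
          rw [hT₀, Function.update_of_ne hm.ne]
        have hord : ∀ m ≤ n, ∃ k, IsDiffOp (id : SmoothFun V M → SmoothFun V M) k (T₀ m) :=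
          fun m hm => by
            rcases hm.lt_or_eq with h | rfl
            · rw [← hagree m h]; exact (hT m h).2.1
            · rw [hT₀, Function.update_self]; exact ⟨0, IsDiffOp.zero _ _⟩
        have hlt : ∀ m < n, metricMap H'.h m T₀ = H.h m := fun m hm => by
          rw [← (hT m hm).2.2]
          exact metricMap_congr fun l hl => (hagree l (hl.trans_lt hm)).symm
        obtain ⟨l, hl⟩ := (H.bidiff n).2
        obtain ⟨k, hk⟩ := exists_order_metricMap (fun r => (H'.bidiff r).2) hord
        -- The error of order n is tensorial in φ, hence of the form h₀(φ, tψ); taking t as the n-th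
        -- term adds exactly this to `metricMap`.
        obtain ⟨t, ht, hdt⟩ := exists_riesz h₀ hlf hσ (H.h n - metricMap H'.h n T₀)
          (sub_metricMap_smul_left H.sesqSeries_act_left H'.sesqSeries_act_left hlt)
          (k := max l k) fun φ =>
            ((hl φ).mono (le_max_left l k)).sub ((hk φ).mono (le_max_right l k))
        refine ⟨t, ?_, ?_, ?_⟩
        · rw [Function.update_of_ne hn.ne]; exact (hT 0 hn).1
        · rw [Function.update_self]; exact ⟨_, ht⟩
        · ext1 φ; ext1 ψ
          rw [show Function.update T n t = Function.update T₀ n t by simp [hT₀],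
            metricMap_update (by simp [hT₀]), H'.h_zero, ← hdt]
          simp)
  exact ⟨W, (hW 0).1, fun n => (hW n).2.1, fun n => (hW n).2.2⟩

variable [SigmaCompactSpace M] [FiniteDimensional ℂ F] [ContMDiffVectorBundle ∞ F E 𝓘(ℝ, V)]

theorem isIsometric (H' : MetricDeformation D h₀) : H.IsIsometric H' := by
  obtain ⟨σ, hlf, hσ⟩ := h₀.exists_parseval_frame
  obtain ⟨W, hW0, hWd, hW⟩ := H.exists_metricMap_eq hlf hσ H'
  have hHW : ∀ φ ψ, sesqSeries H.h φ ψ = sesqSeries H'.h φ (map₁ (W · ·) ψ) :=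
    (isFormal₂_sesqSeries H.h).ext_const (isFormal₂_sesqSeries_map H'.h W) fun φ ψ => by
      ext1 n
      rw [coeff_sesqSeries_const, coeff_sesqSeries_map, hW]
  -- Both sides equal h(φ, ψ), by the Hermitian symmetry of h and h'.
  have hWs : ∀ φ ψ, sesqSeries H'.h (map₁ (W · ·) φ) ψ = sesqSeries H'.h φ (map₁ (W · ·) ψ) :=
    fun φ ψ => by
      rw [H'.sesqSeries_symm, ← hHW, ← H.sesqSeries_symm, hHW]
  obtain ⟨U, hU0, hUd, hU⟩ := exists_compTerm_sqrt (A := SmoothFun V M) hW0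
    (fun c T ⟨k, hk⟩ => ⟨k, hk.smul (algebraMap ℂ (SmoothFun V M) c)⟩) hWd
  have hUs := selfAdjoint_of_compTerm_self hU0 hU hWs
  -- A self-adjoint map is right linear by nondegeneracy: h'(U(φ • f), ψ) = h'(φ • f, Uψ) = conj(f)
  -- ⋆ h'(φ, Uψ) = h'(Uφ • f, ψ).
  have hUact : ∀ φ f, map₁ (U · ·) (D.act φ f) = D.act (map₁ (U · ·) φ) f := fun φ f => by
    rw [← sub_eq_zero]
    refine sesqSeries_nondegenerate H'.h_zero _ fun ψ => ?_
    have hsub := ((isFormal₂_sesqSeries H'.h).left ψ).add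
      (map₁ (U · ·) (D.act φ f) - D.act (map₁ (U · ·) φ) f) (D.act (map₁ (U · ·) φ) f)
    simp only [sub_add_cancel] at hsub
    rwa [hUs, H'.sesqSeries_act_left, H'.sesqSeries_act_left, hUs, right_eq_add] at hsub
  have hiso : ∀ φ ψ, sesqSeries H.h φ ψ = sesqSeries H'.h (map₁ (U · ·) φ) (map₁ (U · ·) ψ) :=
    fun φ ψ => by rw [hHW, ← map₁_map₁ hU, ← hUs]
  exact ⟨U, ⟨hU0, hUd, hUact⟩, hiso⟩

end MetricDeformation

end Uniqueness

end DefQuant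

end

theorem mainTheorem5
    {V : Type*} [NormedAddCommGroup V] [NormedSpace ℝ V] [FiniteDimensional ℝ V]
    {M : Type*} [TopologicalSpace M] [ChartedSpace V M] [IsManifold 𝓘(ℝ, V) ∞ M]
    [T2Space M] [SecondCountableTopology M]
    {F : Type*} [NormedAddCommGroup F] [NormedSpace ℂ F] [FiniteDimensional ℂ F]
    {E : M → Type*} [TopologicalSpace (TotalSpace F E)] [∀ x, TopologicalSpace (E x)]
    [FiberBundle F E] [∀ x, AddCommGroup (E x)] [∀ x, Module ℂ (E x)] [VectorBundle ℂ F E]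
    [ContMDiffVectorBundle ∞ F E 𝓘(ℝ, V)]
    (S : DefQuant.HermitianStarProduct V M)
    (h₀ : DefQuant.HermitianFiberMetric V F E)
    (D : DefQuant.BundleDeformation F E S) :
    Nonempty (DefQuant.MetricDeformation D h₀) ∧
      ∀ H H' : DefQuant.MetricDeformation D h₀, H.IsIsometric H' := by
  have := FiniteDimensional.proper ℝ V
  have : LocallyCompactSpace M := ChartedSpace.locallyCompactSpace V M
  -- Needed for the partition of unity behind the frame and for the compact exhaustion behind
  -- complete positivity.
  have : SigmaCompactSpace M := sigmaCompactSpace_of_locallyCompact_secondCountable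
  exact ⟨DefQuant.nonempty_metricDeformation D h₀, fun H H' => H.isIsometric H'⟩
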